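/- Let $n\ge 1$, let $O\subset\mathbb R^n$ be a nonempty connected open set and $\lambda_1,\dots,\lambda_n\in C^\infty(O)$ be real valued, ordered and of constant multiplicity: $\{1,\dots,n\}$ splits into consecutive blocks such that on $O$ one has $\lambda_i=\mu_p$ for all $i$ in the $p$-th block, with $\mu_1<\dots<\mu_s$ on $O$. Assume that the system $$\partial_t w_i+\lambda_i(w)\,\partial_x w_i=0,\qquad i=1,\dots,n,\quad t>0,\ x\in\mathbb R,$$ is linearly degenerate ($\partial\lambda_i/\partial w_l=0$ on $O$ whenever $\lambda_l=\lambda_i$) and rich with one and the same factor $N_i=N$: there is $N\in C^\infty(O)$, $N>0$, with $(\lambda_j-\lambda_i)\,\partial N/\partial w_j=N\,\partial\lambda_i/\partial w_j$ for all $i,j$ with $\lambda_j\ne\lambda_i$. A function $w\in L^\infty((0,\infty)\times\mathbb R)$ with values a.e. in a compact subset of $O$ is an entropy solution with initial data $w^0$ if, for every $i$, $$\partial_t N(w)+\partial_x\big(N(w)\lambda_i(w)\big)=0,\qquad \partial_t\big(N(w)w_i\big)+\partial_x\big(N(w)\lambda_i(w)w_i\big)=0$$ in the sense of distributions, with initial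 values $N(w^0)$ and $N(w^0)w^0_i$ (test functions in $C_c^\infty(\mathbb R\times\mathbb R)$ restricted to $t\ge 0$). Let $Q=\prod_i[a_i,b_i]\subset O$ be a compact box; below, data are functions $w^0\in L^1(\mathbb R)^n$ with values a.e. in $Q$ (so $w^0\in L^1\cap L^\infty$). Then: 1. For all such data $w^0$ there is an entropy solution with initial data $w^0$, it is unique (a.e.), and it has a version in $C([0,\infty);L^1(\mathbb R)^n)$, which is the one used below. 2. ($L^1$ stability.) For all such data $w^{1,0}$ and every $\varepsilon>0$ there is $\delta>0$ such that for all such data $w^{2,0}$, if $w^1,w^2$ are the entropy solutions with data $w^{1,0},w^{2,0}$, then $\|w^{2,0}-w^{1,0}\|_{L^1(\mathbb R)}\le\delta$ implies $\|w^2(t,\cdot)-w^1(t,\cdot)\|_{L^1(\mathbb R)}\le\varepsilon$ for all $t\ge 0$. 3. (Strong $L^1$ stability.) For every $V\ge 0$ there is a constant $C>0$, depending only on the system, $Q$ and $V$, such that for all such data $w^{1,0},w^{2,0}$ that also lie in $W^{1,1}(\mathbb R)$ with $\|\partial_x w^{1,0}\|_{L^1(\mathbb R)}\le V$, the corresponding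 entropy solutions satisfy $$\|w^2_i(t,\cdot)-w^1_i(t,\cdot)\|_{L^1(\mathbb R)}\le C\,\|w^{2,0}-w^{1,0}\|_{L^1(\mathbb R)}\qquad\text{for all } t\ge 0,\ i=1,\dots,n.$$ Here $\mathbb R^n$ carries the maximum norm. -/

import Mathlib

open MeasureTheory Set Filter Topology
open scoped ContDiff ENNReal NNReal

/-- The state space `ℝⁿ` (all norms on it are equivalent). -/
abbrev State (n : ℕ) : Type := Fin n → ℝ

/-- The partial derivative `∂f/∂w_j` at `w`. -/
noncomputable def pderivAt {n : ℕ} (j : Fin n) (f : State n → ℝ) (w : State n) : ℝ :=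
  fderiv ℝ f w (Pi.single j 1)

/-- On `O` the eigenvalues are ordered and of constant multiplicity: the indices are grouped in
consecutive blocks `b ⁻¹' {p}`, the `λ_i` of block `p` all equal `μ_p`, and
`μ_1 < μ_2 < ⋯ < μ_s` on `O`. -/
def HasConstantMultiplicity {n : ℕ} (O : Set (State n)) (lam : Fin n → State n → ℝ) : Prop :=
  ∃ (s : ℕ) (b : Fin n → Fin s) (μ : Fin s → State n → ℝ),
    Monotone b ∧ Function.Surjective b ∧
    (∀ i, ∀ w ∈ O, lam i w = μ (b i) w) ∧
    ∀ w ∈ O, StrictMono fun p => μ p w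

/-- Each eigenvalue is independent, on `O`, of the variables `w_l` of its own block
(the `l` with `λ_l = λ_i`). -/
def IsLinearlyDegenerate {n : ℕ} (O : Set (State n)) (lam : Fin n → State n → ℝ) : Prop :=
  ∀ i l, ∀ w ∈ O, lam l w = lam i w → pderivAt l (lam i) w = 0

/-- `N` is a richness factor `N_i` of the `i`th characteristic: a smooth positive function with
`(λ_j - λ_i) ∂N/∂w_j = N ∂λ_i/∂w_j` whenever `λ_j ≠ λ_i`. -/
structure IsRichnessFactor {n : ℕ} (O : Set (State n)) (lam : Fin n → State n → ℝ)
    (i : Fin n) (N : State n → ℝ) : Prop where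
  smooth : ContDiffOn ℝ ∞ N O
  pos : ∀ w ∈ O, 0 < N w
  rich : ∀ j, ∀ w ∈ O, lam j w ≠ lam i w →
    (lam j w - lam i w) * pderivAt j N w = N w * pderivAt j (lam i) w

/-- `∂_t w_i + λ_i(w) ∂_x w_i = 0`, `1 ≤ i ≤ n`, is a linearly degenerate rich system on the
domain `O`, with richness factors `N_i`. -/
structure IsLinDegRichSystem {n : ℕ} (O : Set (State n)) (lam : Fin n → State n → ℝ)
    (N : Fin n → State n → ℝ) : Prop where
  isOpen : IsOpen O
  isConnected : IsConnected O
  smooth : ∀ i, ContDiffOn ℝ ∞ (lam i) O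
  constantMultiplicity : HasConstantMultiplicity O lam
  linearlyDegenerate : IsLinearlyDegenerate O lam
  richnessFactor : ∀ i, IsRichnessFactor O lam i (N i)

/-- The open half plane `t > 0` of points `(t, x)`. -/
def halfPlane : Set (ℝ × ℝ) := Ioi 0 ×ˢ univ

/-- `∂_t u + ∂_x f = 0` for `t > 0` with `u = u0` at `t = 0`, in the sense of distributions
(test functions in `C_c^∞(ℝ × ℝ)`, not necessarily vanishing at `t = 0`). -/
def WeakConservationLaw (u f : ℝ → ℝ → ℝ) (u0 : ℝ → ℝ) : Prop :=
  ∀ φ : ℝ × ℝ → ℝ, ContDiff ℝ ∞ φ → HasCompactSupport φ →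
    (∫ p in halfPlane,
        (u p.1 p.2 * fderiv ℝ φ p (1, 0) + f p.1 p.2 * fderiv ℝ φ p (0, 1)))
      + ∫ x, u0 x * φ (0, x) = 0

/-- `w(t, x)` is an entropy solution, with initial data `w0`, of the linearly degenerate rich
system with eigenvalues `λ_i` and richness factors `N_i` on `O`: it is measurable and essentially
bounded with values (a.e.) in a compact subset of `O`, and for all `i`
`∂_t N_i(w) + ∂_x (N_i(w) λ_i(w)) = 0` and `∂_t (N_i(w) w_i) + ∂_x (N_i(w) λ_i(w) w_i) = 0`. -/
structure IsEntropySolution {n : ℕ} (O : Set (State n)) (lam : Fin n → State n → ℝ)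
    (N : Fin n → State n → ℝ) (w0 : ℝ → State n) (w : ℝ → ℝ → State n) : Prop where
  measurable : AEStronglyMeasurable (fun p : ℝ × ℝ => w p.1 p.2) (volume.restrict halfPlane)
  bounded : ∃ K, IsCompact K ∧ K ⊆ O ∧ ∀ᵐ p ∂(volume.restrict halfPlane), w p.1 p.2 ∈ K
  entropy_one : ∀ i, WeakConservationLaw (fun t x => N i (w t x))
    (fun t x => N i (w t x) * lam i (w t x)) (fun x => N i (w0 x))
  entropy_id : ∀ i, WeakConservationLaw (fun t x => N i (w t x) * w t x i)
    (fun t x => N i (w t x) * lam i (w t x) * w t x i) (fun x => N i (w0 x) * w0 x i)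

/-- `t ↦ w(t, ·)` belongs to `C([0, ∞); L¹(ℝ))`. -/
def IsL1Continuous {n : ℕ} (w : ℝ → ℝ → State n) : Prop :=
  (∀ t, 0 ≤ t → MemLp (w t) 1 volume) ∧
  ∀ s, 0 ≤ s →
    Tendsto (fun t => eLpNorm (fun x => w t x - w s x) 1 volume) (𝓝[Ici 0] s) (𝓝 0)

/-- Admissible initial data: functions in `L¹(ℝ)` with values a.e. in the compact box
`[a_1, b_1] × ⋯ × [a_n, b_n]` (in particular they are in `L^∞(ℝ)`). -/
def IsL1Data {n : ℕ} (a b : State n) (w0 : ℝ → State n) : Prop :=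
  MemLp w0 1 volume ∧ ∀ᵐ x, w0 x ∈ Icc a b

/-- `f ∈ W^{1,1}(ℝ)` with weak derivative `g`. -/
def MemW11 {n : ℕ} (f g : ℝ → State n) : Prop :=
  MemLp f 1 volume ∧ MemLp g 1 volume ∧
  ∀ φ : ℝ → ℝ, ContDiff ℝ ∞ φ → HasCompactSupport φ →
    ∫ x, deriv φ x • f x = - ∫ x, φ x • g x

/-! The common factor decouples the system in mass coordinates. Linear degeneracy and richness
together give `(λ_k - λ_i) ∂_k N = N ∂_k λ_i` for all `i`, `k`; combining two such identities shows
that `N (λ_i - λ_j)` has zero gradient, so it is a constant on the connected set `O`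
(`exists_const`). With a reference index `i₀`, write `N λ_i = N λ_{i₀} + c_i`. In the coordinate `y`
with `dy = N dx - N λ_{i₀} dt`, the `i`th equation becomes the linear transport equation `∂_t w_i +
c_i ∂_y w_i = 0`.

It remains to recover `x` from `dx = N⁻¹ dy + λ_{i₀} dt`. The same identities read `∂_k λ_{i₀} =
-c_k ∂_k (1/N)`, and symmetry of second derivatives kills the mixed derivatives of `1/N` between
different blocks. So on the box `1/N = ∑ η_p` and `λ_{i₀} = κ - ∑ c_p η_p`, where `η_p` sees only
block `p` (`exists_blockSystem`). As block `p` is a function of `y - c_p t`, integration gives `x =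
∑ H_p(y - c_p t) + κ t` with `H_p` a primitive of `η_p` along the data. This is `pos`; it is
bi-Lipschitz in `y` with constants independent of `t`, and composing with its inverse gives the
explicit solution `sol`. The conservation laws follow by changing variables and integrating along
characteristics (`weakLaw`).

For uniqueness, the law for `N` provides any entropy solution with a Lipschitz potential `Z`, its
own mass coordinate. Testing the other laws with functions of `(t, Z - c_i t)` shows that `w_i`
depends on `Z - c_i t` only (`ae_eq_along_characteristic`). The particle velocities are then known
in mass coordinates, so the particle paths, and with them `Z`, are those of the explicit solution
(`ae_massInv_eq`, `ae_eq_sol`).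

For stability, each component of `sol` at time `t` is a component of the data composed with a `foot`
map that contracts distances at most by a factor independent of time. The foot maps of two data
differ, uniformly in `t` and `x`, by an amount controlled by the `L¹` distances of the data in the
variables `x` and `y`. Continuity in `L¹` of composition (`exists_lintegral_comp_sub_comp_le`)
yields stability, and its Lipschitz form for primitives of integrable functions
(`lintegral_comp_sub_comp_le`) yields strong stability. -/

/-- The eigenvalue structure, on a box, of a linearly degenerate rich system with a common
richness factor: `1 / N` is the sum of functions `η p` of the blocks of variables, and the
eigenvalues are linear combinations of the `η p`. -/
structure BlockSystem (n : ℕ) where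
  s : ℕ
  block : Fin n → Fin s
  c : Fin s → ℝ
  κ : ℝ
  η : Fin s → State n → ℝ
  L : ℝ≥0
  m : ℝ
  M : ℝ
  B : ℝ
  m_pos : 0 < m
  lipschitz : ∀ p, LipschitzWith L (η p)
  congr_block : ∀ p w w', (∀ i, block i = p → w i = w' i) → η p w = η p w'
  le_sum : ∀ w, m ≤ ∑ p, η p w
  sum_le : ∀ w, ∑ p, η p w ≤ M
  abs_le : ∀ p w, |η p w| ≤ B

namespace BlockSystem
variable {n : ℕ} (S : BlockSystem n)

/-- The specific volume `1 / N`. -/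
noncomputable def vol (w : State n) : ℝ := ∑ p, S.η p w

/-- The velocity `λ` with Lagrangian speed `k`. -/
noncomputable def vel (k : ℝ) (w : State n) : ℝ := S.κ + ∑ p, (k - S.c p) * S.η p w

end BlockSystem

/-! ### Constancy of `N (λ_i - λ_j)` and splitting of `1/N` over the blocks. -/

section Reduction
variable {n : ℕ}

/-- `w` clamped to the box `[a, b]`. -/
def clamp (a b w : State n) : State n := fun i => max (a i) (min (w i) (b i))

theorem clamp_mem {a b : State n} (hab : a ≤ b) (w : State n) : clamp a b w ∈ Icc a b := by
  constructor <;> intro i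
  · exact le_max_left _ _
  · exact max_le (hab i) (min_le_right _ _)

theorem clamp_eq_self {a b w : State n} (hw : w ∈ Icc a b) : clamp a b w = w := by
  funext i
  simp only [clamp]
  rw [min_eq_left (hw.2 i), max_eq_right (hw.1 i)]

theorem lipschitzWith_clamp (a b : State n) : LipschitzWith 1 (clamp a b) := by
  refine LipschitzWith.of_dist_le_mul fun w w' => ?_
  rw [NNReal.coe_one, one_mul, dist_pi_le_iff dist_nonneg]
  intro i
  refine le_trans ?_ (dist_le_pi_dist w w' i)
  simp only [clamp, Real.dist_eq]
  rw [max_comm, max_comm (a i)]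
  exact (abs_max_sub_max_le_abs _ _ _).trans (by simpa using abs_min_sub_min_le_max (w i) (b i) (w' i) (b i))

/-- The state `w` with the blocks other than `p` replaced by those of `a`. -/
def onBlock {s : ℕ} (β : Fin n → Fin s) (a : State n) (p : Fin s) (w : State n) : State n :=
  fun i => if β i = p then w i else a i

theorem onBlock_mem {s : ℕ} (β : Fin n → Fin s) {a b : State n} (p : Fin s) {w : State n}
    (hw : w ∈ Icc a b) : onBlock β a p w ∈ Icc a b := by
  constructor <;> intro i <;> simp only [onBlock] <;> split_ifs
  · exact hw.1 i
  · exact le_rfl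
  · exact hw.2 i
  · exact (hw.1.trans hw.2) i

theorem lipschitzWith_onBlock {s : ℕ} (β : Fin n → Fin s) (a : State n) (p : Fin s) :
    LipschitzWith 1 (onBlock β a p) := by
  refine LipschitzWith.of_dist_le_mul fun w w' => ?_
  rw [NNReal.coe_one, one_mul, dist_pi_le_iff dist_nonneg]
  intro i
  simp only [onBlock]
  split_ifs
  · exact dist_le_pi_dist w w' i
  · simp

theorem fderiv_eq_sum_pderivAt (f : State n → ℝ) (w v : State n) :
    fderiv ℝ f w v = ∑ j, v j * pderivAt j f w := by
  conv_lhs => rw [pi_eq_sum_univ' v]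
  rw [map_sum]
  refine Finset.sum_congr rfl fun j _ => ?_
  rw [map_smul, smul_eq_mul, pderivAt]

theorem fderiv_eq_zero_of_pderivAt {f : State n → ℝ} {w : State n}
    (h : ∀ j, pderivAt j f w = 0) : fderiv ℝ f w = 0 := by
  ext v
  rw [fderiv_eq_sum_pderivAt]
  simp [h]

/-- A function on a convex set whose gradient vanishes in the direction of a segment takes the
same value at its ends. -/
theorem eq_of_segment_pderivAt {O : Set (State n)} (hO : IsOpen O) {a b : State n}
    (hQ : Icc a b ⊆ O) {f : State n → ℝ} (hf : DifferentiableOn ℝ f O) {w w' : State n}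
    (hw : w ∈ Icc a b) (hw' : w' ∈ Icc a b)
    (h : ∀ j, w j ≠ w' j → ∀ u ∈ Icc a b, pderivAt j f u = 0) : f w = f w' := by
  have hline : ∀ t ∈ Icc (0:ℝ) 1, w + t • (w' - w) ∈ Icc a b := by
    intro t ht
    exact (convex_Icc a b).add_smul_sub_mem hw hw' ht
  have hd : ∀ t ∈ Icc (0:ℝ) 1, HasDerivAt (fun t : ℝ => f (w + t • (w' - w))) 0 t := by
    intro t ht
    have h1 := (hf.differentiableAt (hO.mem_nhds (hQ (hline t ht)))).hasFDerivAt
    have h2 : HasDerivAt (fun t : ℝ => w + t • (w' - w)) (w' - w) t := by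
      simpa using ((hasDerivAt_id t).smul_const (w' - w)).const_add w
    have h3 := h1.comp_hasDerivAt t h2
    have h4 : fderiv ℝ f (w + t • (w' - w)) (w' - w) = 0 := by
      rw [fderiv_eq_sum_pderivAt]
      refine Finset.sum_eq_zero fun j _ => ?_
      by_cases hj : w j = w' j
      · simp [hj]
      · rw [h j hj _ (hline t ht), mul_zero]
    rw [h4] at h3
    exact h3
  have := constant_of_has_deriv_right_zero (f := fun t : ℝ => f (w + t • (w' - w))) (a := 0) (b := 1)
    (fun t ht => (hd t ht).continuousAt.continuousWithinAt)
    (fun t ht => (hd t (Ico_subset_Icc_self ht)).hasDerivWithinAt) 1 (by simp)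
  simpa using this.symm

theorem sum_block_eq {s : ℕ} (β : Fin n → Fin s) (f : Fin n → Fin s → ℝ) :
    ∑ p, ∑ j, (if β j = p then f j p else 0) = ∑ j, f j (β j) := by
  rw [Finset.sum_comm]
  simp

/-- Decomposition of functions whose mixed derivatives between different blocks vanish. -/
theorem sub_eq_sum_onBlock {O : Set (State n)} (hO : IsOpen O) {a b : State n}
    (hQ : Icc a b ⊆ O) {s : ℕ} (β : Fin n → Fin s) (c : Fin s → ℝ) {f g : State n → ℝ}
    (hf : DifferentiableOn ℝ f O) (hg : DifferentiableOn ℝ g O)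
    (hfg : ∀ j, ∀ w ∈ O, pderivAt j f w = c (β j) * pderivAt j g w)
    (hblock : ∀ j, ∀ w ∈ Icc a b, pderivAt j g (onBlock β a (β j) w) = pderivAt j g w)
    {w : State n} (hw : w ∈ Icc a b) :
    f w - f a = ∑ p, c p * (g (onBlock β a p w) - g a) := by
  have haQ : a ∈ Icc a b := ⟨le_rfl, hw.1.trans hw.2⟩
  have hline : ∀ t ∈ Icc (0:ℝ) 1, a + t • (w - a) ∈ Icc a b := by
    intro t ht
    exact (convex_Icc a b).add_smul_sub_mem haQ hw ht
  have honline : ∀ p, ∀ t : ℝ, onBlock β a p (a + t • (w - a)) =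
      a + t • (onBlock β a p w - a) := by
    intro p t
    ext i
    simp only [onBlock, Pi.add_apply, Pi.smul_apply, Pi.sub_apply]
    split_ifs <;> simp
  have hda : ∀ v : State n, ∀ t, HasDerivAt (fun t : ℝ => a + t • (v - a)) (v - a) t := by
    intro v t
    simpa using ((hasDerivAt_id t).smul_const (v - a)).const_add a
  -- Both sides are compared along the segment from `a` to `w`. By `hblock`, `∂_j g` does not change
  -- when the other blocks are reset to `a`, so the derivatives of the two sides agree term by term.
  have hd : ∀ t ∈ Icc (0:ℝ) 1, HasDerivAt (fun t : ℝ => f (a + t • (w - a)) -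
      ∑ p, c p * g (a + t • (onBlock β a p w - a))) 0 t := by
    intro t ht
    have h1 := (hf.differentiableAt (hO.mem_nhds (hQ (hline t ht)))).hasFDerivAt.comp_hasDerivAt
      t (hda w t)
    have h2 : ∀ p, HasDerivAt (fun t : ℝ => c p * g (a + t • (onBlock β a p w - a)))
        (c p * fderiv ℝ g (a + t • (onBlock β a p w - a)) (onBlock β a p w - a)) t := by
      intro p
      have hmem : a + t • (onBlock β a p w - a) ∈ O :=
        hQ ((convex_Icc a b).add_smul_sub_mem haQ (onBlock_mem β p hw) ht)
      exact ((hg.differentiableAt (hO.mem_nhds hmem)).hasFDerivAt.comp_hasDerivAt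
        t (hda _ t)).const_mul (c p)
    have h3 := h1.sub (HasDerivAt.fun_sum fun p (_ : p ∈ Finset.univ) => h2 p)
    have h4 : fderiv ℝ f (a + t • (w - a)) (w - a) - ∑ p, c p *
        fderiv ℝ g (a + t • (onBlock β a p w - a)) (onBlock β a p w - a) = 0 := by
      rw [sub_eq_zero, fderiv_eq_sum_pderivAt]
      have : ∀ p, c p * fderiv ℝ g (a + t • (onBlock β a p w - a)) (onBlock β a p w - a) =
          ∑ j, if β j = p then (w j - a j) * (c p * pderivAt j g (a + t • (w - a))) else 0 := by
        intro p
        rw [fderiv_eq_sum_pderivAt, Finset.mul_sum]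
        refine Finset.sum_congr rfl fun j _ => ?_
        simp only [Pi.sub_apply]
        split_ifs with h
        · rw [← honline, ← h, hblock j _ (hline t ht)]
          simp only [onBlock, if_true]
          ring
        · simp [onBlock, h]
      simp_rw [this]
      rw [sum_block_eq β fun j p => (w j - a j) * (c p * pderivAt j g (a + t • (w - a)))]
      refine Finset.sum_congr rfl fun j _ => ?_
      rw [hfg j _ (hQ (hline t ht)), Pi.sub_apply]
    rw [h4] at h3
    exact h3
  have := constant_of_has_deriv_right_zero (a := 0) (b := 1)
    (fun t ht => (hd t ht).continuousAt.continuousWithinAt)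
    (fun t ht => (hd t (Ico_subset_Icc_self ht)).hasDerivWithinAt) 1 (by simp)
  simp only [one_smul, add_sub_cancel, zero_smul, add_zero] at this
  simp_rw [mul_sub, Finset.sum_sub_distrib]
  linarith

/-- Two functions with gradients proportional with different factors have vanishing mixed
derivatives. -/
theorem pderivAt_pderivAt_eq_zero {O : Set (State n)} (hO : IsOpen O)
    {c : Fin n → ℝ} {f g : State n → ℝ}
    (hf : ContDiffOn ℝ ∞ f O) (hg : ContDiffOn ℝ ∞ g O)
    (hfg : ∀ j, ∀ w ∈ O, pderivAt j f w = c j * pderivAt j g w)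
    {j k : Fin n} (hjk : c j ≠ c k) {w : State n} (hw : w ∈ O) :
    pderivAt k (pderivAt j g) w = 0 := by
  have hdd : ∀ {φ : State n → ℝ}, ContDiffOn ℝ ∞ φ O → DifferentiableAt ℝ (fderiv ℝ φ) w := by
    intro φ hφ
    have h1 : ContDiffAt ℝ ∞ φ w := hφ.contDiffAt (hO.mem_nhds hw)
    have h2 : ContDiffAt ℝ 1 (fderiv ℝ φ) w := h1.fderiv_right (by norm_cast)
    exact h2.differentiableAt one_ne_zero
  have hsecond : ∀ {φ : State n → ℝ}, ContDiffOn ℝ ∞ φ O → ∀ i l,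
      pderivAt l (pderivAt i φ) w = fderiv ℝ (fderiv ℝ φ) w (Pi.single l 1) (Pi.single i 1) := by
    intro φ hφ i l
    have := ((hdd hφ).hasFDerivAt.clm_apply (hasFDerivAt_const (Pi.single i (1:ℝ)) w)).fderiv
    change fderiv ℝ (fun w => fderiv ℝ φ w (Pi.single i 1)) w (Pi.single l 1) = _
    rw [this]
    simp
  have hsymm : ∀ {φ : State n → ℝ}, ContDiffOn ℝ ∞ φ O → ∀ u v,
      fderiv ℝ (fderiv ℝ φ) w u v = fderiv ℝ (fderiv ℝ φ) w v u := by
    intro φ hφ u v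
    have h1 : ContDiffAt ℝ ∞ φ w := hφ.contDiffAt (hO.mem_nhds hw)
    exact (h1.isSymmSndFDerivAt (by simp; norm_cast)) u v
  have key : ∀ i l, fderiv ℝ (fderiv ℝ f) w (Pi.single l 1) (Pi.single i 1) =
      c i * fderiv ℝ (fderiv ℝ g) w (Pi.single l 1) (Pi.single i 1) := by
    intro i l
    rw [← hsecond hf, ← hsecond hg]
    have heq : pderivAt i f =ᶠ[𝓝 w] fun u => c i * pderivAt i g u := by
      filter_upwards [hO.mem_nhds hw] with u hu using hfg i u hu
    have hdg : DifferentiableAt ℝ (pderivAt i g) w := by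
      exact ((hdd hg).hasFDerivAt.clm_apply
        (hasFDerivAt_const (Pi.single i (1:ℝ)) w)).differentiableAt
    rw [pderivAt, heq.fderiv_eq, fderiv_const_mul hdg]
    rfl
  -- The mixed derivative of `f` computed in the two orders is `c j` and also `c k` times that of
  -- `g`.
  have h1 := key j k
  have h2 := key k j
  rw [hsymm hf, hsymm hg] at h2
  rw [h1] at h2
  rw [hsecond hg]
  have : (c j - c k) * fderiv ℝ (fderiv ℝ g) w (Pi.single k 1) (Pi.single j 1) = 0 := by
    linarith
  exact (mul_eq_zero.1 this).resolve_left (sub_ne_zero.2 hjk)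

theorem pderivAt_mul {f g : State n → ℝ} {w : State n} (hf : DifferentiableAt ℝ f w)
    (hg : DifferentiableAt ℝ g w) (j : Fin n) :
    pderivAt j (fun w => f w * g w) w = f w * pderivAt j g w + g w * pderivAt j f w := by
  simp only [pderivAt]
  rw [fderiv_fun_mul hf hg]
  simp

theorem pderivAt_sub {f g : State n → ℝ} {w : State n} (hf : DifferentiableAt ℝ f w)
    (hg : DifferentiableAt ℝ g w) (j : Fin n) :
    pderivAt j (fun w => f w - g w) w = pderivAt j f w - pderivAt j g w := by
  simp only [pderivAt]
  rw [fderiv_fun_sub hf hg]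
  simp

theorem pderivAt_inv {f : State n → ℝ} {w : State n} (hf : DifferentiableAt ℝ f w)
    (h0 : f w ≠ 0) (j : Fin n) :
    pderivAt j (fun w => (f w)⁻¹) w = - pderivAt j f w / f w ^ 2 := by
  have := ((hasDerivAt_inv h0).comp_hasFDerivAt w hf.hasFDerivAt).fderiv
  simp only [pderivAt]
  change fderiv ℝ (Inv.inv ∘ f) w (Pi.single j 1) = _
  rw [this]
  simp [div_eq_mul_inv]
  ring

variable {O : Set (State n)} {lam : Fin n → State n → ℝ} {N : State n → ℝ}

/-- Richness covers `λ_k ≠ λ_i`; when `λ_k = λ_i`, linear degeneracy makes both sides zero. With one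
identity for all pairs, no later step has to distinguish blocks here. -/
theorem IsLinDegRichSystem.sub_mul_pderivAt (hsys : IsLinDegRichSystem O lam fun _ => N)
    (i k : Fin n) {w : State n} (hw : w ∈ O) :
    (lam k w - lam i w) * pderivAt k N w = N w * pderivAt k (lam i) w := by
  by_cases h : lam k w = lam i w
  · rw [hsys.linearlyDegenerate i k w hw h, h]
    ring
  · exact (hsys.richnessFactor i).rich k w hw h

/-- The `k`th derivative of the product is a combination of the richness identities for `(i, k)` and
`(j, k)` and vanishes identically. This is where the factor being common to all characteristics is
essential. -/
theorem IsLinDegRichSystem.exists_const (hsys : IsLinDegRichSystem O lam fun _ => N)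
    (i j : Fin n) {w w' : State n} (hw : w ∈ O) (hw' : w' ∈ O) :
    N w * (lam i w - lam j w) = N w' * (lam i w' - lam j w') := by
  have hN : DifferentiableOn ℝ N O := (hsys.richnessFactor i).smooth.differentiableOn (by simp)
  have hl : ∀ i, DifferentiableOn ℝ (lam i) O := fun i => (hsys.smooth i).differentiableOn (by simp)
  refine hsys.isOpen.is_const_of_fderiv_eq_zero (f := fun w => N w * (lam i w - lam j w))
    hsys.isConnected.isPreconnected (hN.mul ((hl i).sub (hl j))) ?_ hw hw'
  intro u hu
  refine fderiv_eq_zero_of_pderivAt fun k => ?_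
  have hd : ∀ {f : State n → ℝ}, DifferentiableOn ℝ f O → DifferentiableAt ℝ f u :=
    fun hf => hf.differentiableAt (hsys.isOpen.mem_nhds hu)
  rw [pderivAt_mul (hd hN) ((hd (hl i)).fun_sub (hd (hl j))), pderivAt_sub (hd (hl i)) (hd (hl j))]
  have h1 := hsys.sub_mul_pderivAt i k hu
  have h2 := hsys.sub_mul_pderivAt j k hu
  linear_combination -h1 + h2

/-- The splitting of `1/N` and of the eigenvalues holds on the box only, since it integrates along
segments. The constants `c`, by contrast, are valid on all of `O`, which uniqueness needs because a
competing solution may a priori leave the box. -/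
theorem IsLinDegRichSystem.exists_blockSystem (hsys : IsLinDegRichSystem O lam fun _ => N)
    {a b : State n} (hab : a ≤ b) (hQ : Icc a b ⊆ O) (i₀ : Fin n) :
    ∃ S : BlockSystem n,
      (∀ w ∈ Icc a b, N w = (S.vol w)⁻¹ ∧ ∀ i, lam i w = S.vel (S.c (S.block i)) w) ∧
      (∀ w ∈ O, ∀ i, N w * (lam i w - lam i₀ w) = S.c (S.block i)) ∧ S.c (S.block i₀) = 0 := by
  obtain ⟨s, β, μ, hβ, hsurj, hlam, hμ⟩ := hsys.constantMultiplicity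
  have haQ : a ∈ Icc a b := ⟨le_rfl, hab⟩
  have haO := hQ haQ
  have hpos : ∀ w ∈ O, 0 < N w := (hsys.richnessFactor i₀).pos
  set c : Fin s → ℝ := fun p => N a * (μ p a - μ (β i₀) a) with hc
  have hcβ : ∀ w ∈ O, ∀ i, N w * (lam i w - lam i₀ w) = c (β i) := by
    intro w hw i
    rw [hsys.exists_const i i₀ hw haO, hlam i a haO, hlam i₀ a haO]
  -- Distinct blocks have distinct eigenvalues, hence distinct constants; this is what forces the
  -- mixed derivatives of `1/N` to vanish.
  have hcinj : ∀ p q, p ≠ q → c p ≠ c q := by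
    intro p q hpq h
    apply hpq
    apply (hμ a haO).injective
    have := mul_left_cancel₀ (hpos a haO).ne' h
    simpa using this
  have hNs : ContDiffOn ℝ ∞ N O := (hsys.richnessFactor i₀).smooth
  have hNd : DifferentiableOn ℝ N O := hNs.differentiableOn (by simp)
  set h : State n → ℝ := fun w => (N w)⁻¹ with hh
  have hhs : ContDiffOn ℝ ∞ h O := hNs.inv fun w hw => (hpos w hw).ne'
  have hhd : DifferentiableOn ℝ h O := hhs.differentiableOn (by simp)
  have hgrad : ∀ k, ∀ w ∈ O, pderivAt k (lam i₀) w = -c (β k) * pderivAt k h w := by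
    intro k w hw
    have hN0 := (hpos w hw).ne'
    rw [pderivAt_inv (hNd.differentiableAt (hsys.isOpen.mem_nhds hw)) hN0, ← hcβ w hw k]
    have := hsys.sub_mul_pderivAt i₀ k hw
    field_simp
    linear_combination -this
  have hblock : ∀ j, ∀ w ∈ Icc a b, pderivAt j h (onBlock β a (β j) w) = pderivAt j h w := by
    intro j w hw
    refine eq_of_segment_pderivAt hsys.isOpen hQ (f := pderivAt j h) ?_ (onBlock_mem β _ hw) hw ?_
    · intro u hu
      have h1 : ContDiffAt ℝ ∞ h u := hhs.contDiffAt (hsys.isOpen.mem_nhds hu)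
      have h2 : ContDiffAt ℝ 1 (fderiv ℝ h) u := h1.fderiv_right (by norm_cast)
      exact (((h2.differentiableAt one_ne_zero).hasFDerivAt.clm_apply
        (hasFDerivAt_const (Pi.single j (1:ℝ)) u)).differentiableAt).differentiableWithinAt
    · intro k hk u hu
      have hkj : β k ≠ β j := by
        intro hkj
        simp [onBlock, hkj] at hk
      refine pderivAt_pderivAt_eq_zero hsys.isOpen (c := fun j => -c (β j)) (hsys.smooth i₀) hhs
        hgrad (fun h => ?_) (hQ hu)
      exact hcinj _ _ hkj (neg_injective h).symm
  have hdech : ∀ w ∈ Icc a b, h w - h a = ∑ p, (h (onBlock β a p w) - h a) := by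
    intro w hw
    have := sub_eq_sum_onBlock hsys.isOpen hQ β (fun _ => 1) hhd hhd (by simp) hblock hw
    simpa using this
  have hdecl : ∀ w ∈ Icc a b, lam i₀ w - lam i₀ a = ∑ p, -c p * (h (onBlock β a p w) - h a) := by
    intro w hw
    exact sub_eq_sum_onBlock hsys.isOpen hQ β (fun p => -c p)
      ((hsys.smooth i₀).differentiableOn (by simp)) hhd hgrad hblock hw
  have hcompact : IsCompact (Icc a b) := isCompact_Icc
  have hhcont : ContinuousOn h (Icc a b) := hhd.continuousOn.mono hQ
  obtain ⟨wm, hwm, hmin⟩ := hcompact.exists_isMinOn ⟨a, haQ⟩ hhcont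
  obtain ⟨wM, hwM, hmax⟩ := hcompact.exists_isMaxOn ⟨a, haQ⟩ hhcont
  obtain ⟨L, hL⟩ : ∃ L, LipschitzOnWith L h (Icc a b) := by
    have hcd : ContinuousOn (fun w => ‖fderiv ℝ h w‖₊) (Icc a b) :=
      ((hhs.continuousOn_fderiv_of_isOpen hsys.isOpen (by simp)).mono hQ).nnnorm
    obtain ⟨L, hL⟩ := (hcompact.image_of_continuousOn hcd).bddAbove
    refine ⟨L, (convex_Icc a b).lipschitzOnWith_of_nnnorm_fderiv_le (𝕜 := ℝ) ?_ ?_⟩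
    · intro w hw
      exact hhd.differentiableAt (hsys.isOpen.mem_nhds (hQ hw))
    · intro w hw
      exact hL ⟨w, hw, rfl⟩
  -- Clamping makes the bounds and the Lipschitz estimate global. The leftover constant `h a` of the
  -- splitting is put in the block of `i₀`: there `c` vanishes, so the formula for `λ_{i₀}` is not
  -- disturbed.
  set η : Fin s → State n → ℝ := fun p w =>
    h (onBlock β a p (clamp a b w)) - h a + if p = β i₀ then h a else 0 with hη
  have hsum : ∀ w, ∑ p, η p w = h (clamp a b w) := by
    intro w
    simp only [hη, Finset.sum_add_distrib, Finset.sum_ite_eq', Finset.mem_univ, if_true]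
    rw [← hdech _ (clamp_mem hab w)]
    ring
  have hc0 : c (β i₀) = 0 := by simp [hc]
  refine ⟨⟨s, β, c, lam i₀ a, η, L, h wm, h wM, 2 * h wM, inv_pos.2 (hpos _ (hQ hwm)), ?_, ?_, ?_,
    ?_, ?_⟩, ?_, hcβ, hc0⟩
  · intro p
    refine LipschitzWith.of_dist_le_mul fun w w' => ?_
    have h1 := hL.dist_le_mul _ (onBlock_mem β p (clamp_mem hab w)) _
      (onBlock_mem β p (clamp_mem hab w'))
    have h2 := ((lipschitzWith_onBlock β a p).comp (lipschitzWith_clamp a b)).dist_le_mul w w'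
    simp only [hη, dist_add_right, dist_sub_right]
    refine h1.trans ?_
    gcongr
    simpa using h2
  · intro p w w' hww
    simp only [hη]
    congr 3
    ext i
    simp only [onBlock, clamp]
    split_ifs with hi
    · rw [hww i hi]
    · rfl
  · intro w
    rw [hsum]
    exact hmin (clamp_mem hab w)
  · intro w
    rw [hsum]
    exact hmax (clamp_mem hab w)
  · intro p w
    have h1 : h (onBlock β a p (clamp a b w)) ≤ h wM := hmax (onBlock_mem β p (clamp_mem hab w))
    have h2 : 0 < h (onBlock β a p (clamp a b w)) :=
      inv_pos.2 (hpos _ (hQ (onBlock_mem β p (clamp_mem hab w))))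
    have h3 : h a ≤ h wM := hmax haQ
    have h4 : 0 < h a := inv_pos.2 (hpos _ haO)
    simp only [hη]
    rw [abs_le]
    split_ifs <;> constructor <;> linarith
  · intro w hw
    have hvol : h w = ∑ p, η p w := by rw [hsum, clamp_eq_self hw]
    refine ⟨?_, fun i => ?_⟩
    · simp only [BlockSystem.vol]
      rw [← hvol, hh, inv_inv]
    · simp only [BlockSystem.vel]
      have h1 : ∑ p, (c (β i) - c p) * η p w = c (β i) * h w - ∑ p, c p * η p w := by
        rw [hvol, Finset.mul_sum, ← Finset.sum_sub_distrib]
        simp_rw [sub_mul]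
      have h2 : ∑ p, c p * η p w = -(lam i₀ w - lam i₀ a) := by
        rw [hdecl w hw, ← Finset.sum_neg_distrib]
        refine Finset.sum_congr rfl fun p _ => ?_
        simp only [hη]
        rw [clamp_eq_self hw]
        split_ifs with hp
        · rw [hp, hc0]; ring
        · ring
      rw [h1, h2, ← hcβ w (hQ hw) i, hh]
      have := (hpos w (hQ hw)).ne'
      field_simp
      ring

end Reduction

/-! ### Bi-Lipschitz changes of variables on the line. -/

/-- Increasing functions on the line with difference quotients between `m` and `M`. -/
structure BiLip (m M : ℝ) (f : ℝ → ℝ) : Prop where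
  pos : 0 < m
  lower : ∀ x y, x ≤ y → m * (y - x) ≤ f y - f x
  upper : ∀ x y, x ≤ y → f y - f x ≤ M * (y - x)

namespace BiLip
variable {m M : ℝ} {f : ℝ → ℝ}

theorem le (hf : BiLip m M f) : m ≤ M := by
  have h1 := hf.lower 0 1 zero_le_one
  have h2 := hf.upper 0 1 zero_le_one
  linarith

theorem strictMono (hf : BiLip m M f) : StrictMono f := by
  intro x y hxy
  have := hf.lower x y hxy.le
  have := mul_pos hf.pos (sub_pos.2 hxy)
  linarith

theorem abs_lower (hf : BiLip m M f) (x y : ℝ) : m * |x - y| ≤ |f x - f y| := by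
  rcases le_total x y with h | h
  · rw [abs_sub_comm, abs_sub_comm (f x), abs_of_nonneg (sub_nonneg.2 h),
      abs_of_nonneg (sub_nonneg.2 (hf.strictMono.monotone h))]
    exact hf.lower x y h
  · rw [abs_of_nonneg (sub_nonneg.2 h), abs_of_nonneg (sub_nonneg.2 (hf.strictMono.monotone h))]
    exact hf.lower y x h

theorem abs_upper (hf : BiLip m M f) (x y : ℝ) : |f x - f y| ≤ M * |x - y| := by
  rcases le_total x y with h | h
  · rw [abs_sub_comm, abs_sub_comm x, abs_of_nonneg (sub_nonneg.2 h),
      abs_of_nonneg (sub_nonneg.2 (hf.strictMono.monotone h))]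
    exact hf.upper x y h
  · rw [abs_of_nonneg (sub_nonneg.2 h), abs_of_nonneg (sub_nonneg.2 (hf.strictMono.monotone h))]
    exact hf.upper y x h

theorem continuous (hf : BiLip m M f) : Continuous f := by
  have : LipschitzWith M.toNNReal f := LipschitzWith.of_dist_le_mul fun x y => by
    rw [Real.coe_toNNReal _ (hf.pos.le.trans hf.le)]
    exact hf.abs_upper x y
  exact this.continuous

theorem surjective (hf : BiLip m M f) : Function.Surjective f := by
  refine hf.continuous.surjective ?_ ?_
  · refine tendsto_atTop_mono' atTop (f₁ := fun x => m * x + f 0) ?_ ?_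
    · filter_upwards [eventually_ge_atTop 0] with x hx
      have := hf.lower 0 x hx
      linarith
    · exact tendsto_atTop_add_const_right _ _ (tendsto_id.const_mul_atTop hf.pos)
  · refine tendsto_atBot_mono' atBot (f₁ := fun x => m * x + f 0) ?_ ?_
    · filter_upwards [eventually_le_atBot 0] with x hx
      have := hf.lower x 0 hx
      linarith
    · exact tendsto_atBot_add_const_right _ _ (tendsto_id.const_mul_atBot hf.pos)

theorem apply_inv (hf : BiLip m M f) (y : ℝ) : f (Function.invFun f y) = y :=
  Function.invFun_eq (hf.surjective y)

theorem inv_apply (hf : BiLip m M f) (x : ℝ) : Function.invFun f (f x) = x :=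
  Function.leftInverse_invFun hf.strictMono.injective x

theorem inv (hf : BiLip m M f) : BiLip M⁻¹ m⁻¹ (Function.invFun f) := by
  have hM : 0 < M := hf.pos.trans_le hf.le
  have hmono : ∀ x y, x ≤ y → Function.invFun f x ≤ Function.invFun f y := by
    intro x y hxy
    rw [← hf.strictMono.le_iff_le, hf.apply_inv, hf.apply_inv]
    exact hxy
  refine ⟨inv_pos.2 hM, fun x y hxy => ?_, fun x y hxy => ?_⟩
  · have := hf.upper _ _ (hmono x y hxy)
    rw [hf.apply_inv, hf.apply_inv] at this
    rw [inv_mul_le_iff₀ hM]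
    exact this
  · have := hf.lower _ _ (hmono x y hxy)
    rw [hf.apply_inv, hf.apply_inv] at this
    rw [le_inv_mul_iff₀ hf.pos]
    exact this

/-- Change of variables: a bi-Lipschitz primitive of `ρ` maps `ρ dx` to Lebesgue measure. -/
theorem measurePreserving (hf : BiLip m M f) {ρ : ℝ → ℝ} (hρ0 : ∀ᵐ x, 0 ≤ ρ x)
    (hρi : ∀ x y, IntervalIntegrable ρ volume x y)
    (h : ∀ x y, f y - f x = ∫ s in x..y, ρ s) :
    MeasurePreserving f (volume.withDensity fun x => ENNReal.ofReal (ρ x)) volume := by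
  refine ⟨hf.continuous.measurable, ?_⟩
  refine (Real.measure_ext_Ioo_rat fun p q => ?_).symm
  symm
  rw [Measure.map_apply hf.continuous.measurable measurableSet_Ioo, Real.volume_Ioo,
    withDensity_apply _ (hf.continuous.measurable measurableSet_Ioo)]
  set x := Function.invFun f p
  set y := Function.invFun f q
  -- It suffices to compare the measures on intervals with rational ends, whose preimages are again
  -- intervals.
  have hpre : f ⁻¹' Ioo (p:ℝ) q = Ioo x y := by
    ext z
    simp only [mem_preimage, mem_Ioo]
    rw [← hf.strictMono.lt_iff_lt (a := x), ← hf.strictMono.lt_iff_lt (b := y), hf.apply_inv,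
      hf.apply_inv]
  rw [hpre]
  rcases le_or_gt x y with hxy | hxy
  · have hxy' := h x y
    rw [hf.apply_inv, hf.apply_inv, intervalIntegral.integral_of_le hxy,
      integral_Ioc_eq_integral_Ioo] at hxy'
    rw [hxy', ofReal_integral_eq_lintegral_ofReal]
    · exact ((hρi x y).1.mono_set Ioo_subset_Ioc_self)
    · exact ae_restrict_of_ae hρ0
  · have h1 : (q:ℝ) - p ≤ 0 := by
      have := hf.strictMono hxy
      rw [hf.apply_inv, hf.apply_inv] at this
      linarith
    rw [Ioo_eq_empty (not_lt.2 hxy.le), ENNReal.ofReal_of_nonpos h1]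
    simp

end BiLip

/-- A map that does not contract distances by more than a factor `m` maps Lebesgue measure to a
measure bounded by `m⁻¹` times Lebesgue measure. -/
theorem map_volume_le {m : ℝ} (hm : 0 < m) {A : ℝ → ℝ} (hAm : Measurable A)
    (hA : ∀ x y, m * |x - y| ≤ |A x - A y|) :
    Measure.map A volume ≤ ENNReal.ofReal m⁻¹ • (volume : Measure ℝ) := by
  have hanti : AntilipschitzWith (m⁻¹).toNNReal A := by
    refine AntilipschitzWith.of_le_mul_dist fun x y => ?_
    rw [Real.coe_toNNReal _ (inv_nonneg.2 hm.le), Real.dist_eq, Real.dist_eq, le_inv_mul_iff₀ hm]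
    exact hA x y
  refine Measure.le_iff.2 fun s hs => ?_
  -- On the line Lebesgue measure is one-dimensional Hausdorff measure, for which antilipschitz maps
  -- control preimages; neither monotonicity nor surjectivity of `A` is required.
  rw [Measure.map_apply hAm hs, Measure.smul_apply, smul_eq_mul, ← hausdorffMeasure_real]
  have := hanti.hausdorffMeasure_preimage_le zero_le_one s
  rwa [ENNReal.rpow_one] at this

theorem lintegral_comp_le {m : ℝ} (hm : 0 < m) {A : ℝ → ℝ} (hAm : Measurable A)
    (hA : ∀ x y, m * |x - y| ≤ |A x - A y|) {g : ℝ → ℝ≥0∞} (hg : AEMeasurable g) :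
    ∫⁻ x, g (A x) ≤ ENNReal.ofReal m⁻¹ * ∫⁻ x, g x := by
  have hle := map_volume_le hm hAm hA
  have hac : Measure.map A volume ≪ (volume : Measure ℝ) :=
    Measure.absolutelyContinuous_of_le_smul hle
  rw [← lintegral_map' (hg.mono_ac hac) hAm.aemeasurable]
  refine (lintegral_mono' hle le_rfl).trans ?_
  rw [lintegral_smul_measure, smul_eq_mul]

theorem quasiMeasurePreserving_of_abs_lower {m : ℝ} (hm : 0 < m) {A : ℝ → ℝ} (hAm : Measurable A)
    (hA : ∀ x y, m * |x - y| ≤ |A x - A y|) :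
    Measure.QuasiMeasurePreserving A volume volume :=
  ⟨hAm, Measure.absolutelyContinuous_of_le_smul (map_volume_le hm hAm hA)⟩

/-- A primitive of a function between `m` and `M` is bi-Lipschitz. -/
theorem BiLip.of_integral {m M : ℝ} (hm : 0 < m) {f ρ : ℝ → ℝ}
    (hρi : ∀ x y, IntervalIntegrable ρ volume x y) (hρ : ∀ᵐ x, m ≤ ρ x ∧ ρ x ≤ M)
    (h : ∀ x y, f y - f x = ∫ s in x..y, ρ s) : BiLip m M f := by
  refine ⟨hm, fun x y hxy => ?_, fun x y hxy => ?_⟩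
  · rw [h]
    have := intervalIntegral.integral_mono_ae (μ := volume) hxy
      (intervalIntegrable_const (c := m)) (hρi x y) (hρ.mono fun x hx => hx.1)
    simpa [mul_comm] using this
  · rw [h]
    have := intervalIntegral.integral_mono_ae (μ := volume) hxy (hρi x y)
      (intervalIntegrable_const (c := M)) (hρ.mono fun x hx => hx.2)
    simpa [mul_comm] using this

theorem intervalIntegrable_of_abs_le {ρ : ℝ → ℝ} (hρ : AEStronglyMeasurable ρ) {C : ℝ}
    (hC : ∀ᵐ x, |ρ x| ≤ C) (x y : ℝ) : IntervalIntegrable ρ volume x y := by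
  rw [intervalIntegrable_iff]
  exact Measure.integrableOn_of_bounded (M := C) (by simp)
    hρ (ae_restrict_of_ae hC)

/-! ### The explicit solution in Lagrangian mass coordinates. -/

namespace BlockSystem
variable {n : ℕ} (S : BlockSystem n)

theorem continuous_η (p : Fin S.s) : Continuous (S.η p) := (S.lipschitz p).continuous

theorem continuous_vol : Continuous S.vol := continuous_finsetSum _ fun p _ => S.continuous_η p

theorem continuous_vel (k : ℝ) : Continuous (S.vel k) :=
  continuous_const.add
    (continuous_finsetSum _ fun p _ => continuous_const.mul (S.continuous_η p))

theorem vol_pos (w : State n) : 0 < S.vol w := S.m_pos.trans_le (S.le_sum w)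

theorem m_le_M : S.m ≤ S.M := (S.le_sum 0).trans (S.sum_le 0)

theorem M_pos : 0 < S.M := S.m_pos.trans_le S.m_le_M

/-- A bound for `vel k`. -/
noncomputable def velBound (k : ℝ) : ℝ := |S.κ| + ∑ p, |k - S.c p| * S.B

theorem abs_vel_le (k : ℝ) (w : State n) : |S.vel k w| ≤ S.velBound k := by
  refine (abs_add_le _ _).trans (add_le_add_right ?_ _)
  refine (Finset.abs_sum_le_sum_abs _ _).trans (Finset.sum_le_sum fun p _ => ?_)
  rw [abs_mul]
  exact mul_le_mul_of_nonneg_left (S.abs_le p w) (abs_nonneg _)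

theorem velBound_nonneg (k : ℝ) : 0 ≤ S.velBound k := (abs_nonneg _).trans (S.abs_vel_le k 0)

variable (w₀ : ℝ → State n)

/-- The initial mass coordinate. -/
noncomputable def mass (x : ℝ) : ℝ := ∫ s in (0:ℝ)..x, (S.vol (w₀ s))⁻¹

/-- The inverse of the initial mass coordinate. -/
noncomputable def pos₀ : ℝ → ℝ := Function.invFun (S.mass w₀)

/-- The initial data in the mass coordinate. -/
noncomputable def data (y : ℝ) : State n := w₀ (S.pos₀ w₀ y)

/-- The solution in Lagrangian coordinates. -/
noncomputable def lag (t y : ℝ) : State n :=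
  fun i => S.data w₀ (y - S.c (S.block i) * t) i

/-- Primitives of the block functions along the data. -/
noncomputable def prim (p : Fin S.s) (z : ℝ) : ℝ := ∫ s in (0:ℝ)..z, S.η p (S.data w₀ s)

/-- The position, at time `t`, of the particle with mass coordinate `y`. -/
noncomputable def pos (t y : ℝ) : ℝ := ∑ p, S.prim w₀ p (y - S.c p * t) + S.κ * t

/-- The mass coordinate. -/
noncomputable def massAt (t : ℝ) : ℝ → ℝ := Function.invFun (S.pos w₀ t)

/-- The solution. -/
noncomputable def sol (t x : ℝ) : State n := S.lag w₀ t (S.massAt w₀ t x)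

variable {w₀}

/-- All variables of block `p` are translated with the same speed `c p`, and `η p` sees no others,
so it is translated as a whole. -/
theorem η_lag (p : Fin S.s) (t y : ℝ) : S.η p (S.lag w₀ t y) = S.η p (S.data w₀ (y - S.c p * t)) :=
  S.congr_block p _ _ fun i hi => by simp [lag, hi]

theorem vol_lag (t y : ℝ) : S.vol (S.lag w₀ t y) = ∑ p, S.η p (S.data w₀ (y - S.c p * t)) := by
  simp [vol, η_lag]

theorem inv_vol_bounds (w : State n) : S.M⁻¹ ≤ (S.vol w)⁻¹ ∧ (S.vol w)⁻¹ ≤ S.m⁻¹ :=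
  ⟨inv_anti₀ (S.vol_pos w) (S.sum_le w), inv_anti₀ S.m_pos (S.le_sum w)⟩

theorem measurable_inv_vol (hw₀ : Measurable w₀) : Measurable fun s => (S.vol (w₀ s))⁻¹ :=
  (S.continuous_vol.measurable.comp hw₀).inv

theorem intervalIntegrable_inv_vol (hw₀ : Measurable w₀) (x y : ℝ) :
    IntervalIntegrable (fun s => (S.vol (w₀ s))⁻¹) volume x y := by
  refine intervalIntegrable_of_abs_le (S.measurable_inv_vol hw₀).aestronglyMeasurable (C := S.m⁻¹)
    (Eventually.of_forall fun s => ?_) x y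
  rw [abs_of_pos (inv_pos.2 (S.vol_pos _))]
  exact (S.inv_vol_bounds _).2

theorem mass_sub (hw₀ : Measurable w₀) (x y : ℝ) :
    S.mass w₀ y - S.mass w₀ x = ∫ s in x..y, (S.vol (w₀ s))⁻¹ :=
  intervalIntegral.integral_interval_sub_left (S.intervalIntegrable_inv_vol hw₀ _ _)
    (S.intervalIntegrable_inv_vol hw₀ _ _)

theorem biLip_mass (hw₀ : Measurable w₀) : BiLip S.M⁻¹ S.m⁻¹ (S.mass w₀) :=
  BiLip.of_integral (inv_pos.2 S.M_pos) (S.intervalIntegrable_inv_vol hw₀)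
    (Eventually.of_forall fun _ => S.inv_vol_bounds _) (S.mass_sub hw₀)

theorem biLip_pos₀ (hw₀ : Measurable w₀) : BiLip S.m S.M (S.pos₀ w₀) := by
  simpa [pos₀] using (S.biLip_mass hw₀).inv

theorem measurable_data (hw₀ : Measurable w₀) : Measurable (S.data w₀) :=
  hw₀.comp (S.biLip_pos₀ hw₀).continuous.measurable

theorem measurable_lag (hw₀ : Measurable w₀) :
    Measurable fun p : ℝ × ℝ => S.lag w₀ p.1 p.2 := by
  refine measurable_pi_lambda _ fun i => ?_
  exact (measurable_pi_apply i).comp ((S.measurable_data hw₀).comp (by fun_prop))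

theorem measurable_η_data (hw₀ : Measurable w₀) (p : Fin S.s) :
    Measurable fun s => S.η p (S.data w₀ s) :=
  (S.continuous_η p).measurable.comp (S.measurable_data hw₀)

theorem intervalIntegrable_η_data (hw₀ : Measurable w₀) (p : Fin S.s) (x y : ℝ) :
    IntervalIntegrable (fun s => S.η p (S.data w₀ s)) volume x y :=
  intervalIntegrable_of_abs_le (S.measurable_η_data hw₀ p).aestronglyMeasurable (C := S.B)
    (Eventually.of_forall fun _ => S.abs_le p _) x y

theorem prim_sub (hw₀ : Measurable w₀) (p : Fin S.s) (x y : ℝ) :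
    S.prim w₀ p y - S.prim w₀ p x = ∫ s in x..y, S.η p (S.data w₀ s) :=
  intervalIntegral.integral_interval_sub_left (S.intervalIntegrable_η_data hw₀ p _ _)
    (S.intervalIntegrable_η_data hw₀ p _ _)

theorem abs_prim_sub_le (hw₀ : Measurable w₀) (p : Fin S.s) (x y : ℝ) :
    |S.prim w₀ p y - S.prim w₀ p x| ≤ S.B * |y - x| := by
  rw [S.prim_sub hw₀]
  rw [← Real.norm_eq_abs]
  exact intervalIntegral.norm_integral_le_of_norm_le_const fun s _ => S.abs_le p (S.data w₀ s)

theorem intervalIntegrable_vol_lag (hw₀ : Measurable w₀) (t x y : ℝ) :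
    IntervalIntegrable (fun y => S.vol (S.lag w₀ t y)) volume x y := by
  refine intervalIntegrable_of_abs_le (C := S.M) ?_ (Eventually.of_forall fun y => ?_) x y
  · exact (S.continuous_vol.measurable.comp
      ((S.measurable_lag hw₀).comp (by fun_prop : Measurable fun y : ℝ => (t, y)))).aestronglyMeasurable
  · rw [abs_of_pos (S.vol_pos _)]
    exact S.sum_le _

/-- The density of `pos` in `y` is the sum of the translated block functions, which is the specific
volume of the Lagrangian state. The bounds on `vol` then make `pos` bi-Lipschitz uniformly in time.
-/
theorem pos_sub (hw₀ : Measurable w₀) (t x y : ℝ) :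
    S.pos w₀ t y - S.pos w₀ t x = ∫ s in x..y, S.vol (S.lag w₀ t s) := by
  have h1 : ∀ p, ∫ s in x..y, S.η p (S.data w₀ (s - S.c p * t)) =
      S.prim w₀ p (y - S.c p * t) - S.prim w₀ p (x - S.c p * t) := by
    intro p
    rw [S.prim_sub hw₀, intervalIntegral.integral_comp_sub_right
      (fun s => S.η p (S.data w₀ s)) (S.c p * t)]
  simp_rw [vol_lag]
  rw [intervalIntegral.integral_finsetSum]
  · simp_rw [h1, Finset.sum_sub_distrib, pos]
    ring
  · intro p _
    exact (S.intervalIntegrable_η_data hw₀ p (x - S.c p * t) (y - S.c p * t)).comp_sub_right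
      (S.c p * t) |> fun h => by simpa using h

theorem biLip_pos (hw₀ : Measurable w₀) (t : ℝ) : BiLip S.m S.M (S.pos w₀ t) :=
  BiLip.of_integral S.m_pos (S.intervalIntegrable_vol_lag hw₀ t)
    (Eventually.of_forall fun _ => ⟨S.le_sum _, S.sum_le _⟩) (S.pos_sub hw₀ t)

theorem biLip_massAt (hw₀ : Measurable w₀) (t : ℝ) : BiLip S.M⁻¹ S.m⁻¹ (S.massAt w₀ t) :=
  (S.biLip_pos hw₀ t).inv

theorem measurePreserving_mass (hw₀ : Measurable w₀) :
    MeasurePreserving (S.mass w₀)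
      (volume.withDensity fun x => ENNReal.ofReal (S.vol (w₀ x))⁻¹) volume :=
  (S.biLip_mass hw₀).measurePreserving
    (Eventually.of_forall fun _ => (inv_pos.2 (S.vol_pos _)).le)
    (S.intervalIntegrable_inv_vol hw₀) (S.mass_sub hw₀)

theorem sol_pos (hw₀ : Measurable w₀) (t y : ℝ) : S.sol w₀ t (S.pos w₀ t y) = S.lag w₀ t y := by
  rw [sol, massAt, (S.biLip_pos hw₀ t).inv_apply]

/-- Two descriptions of the initial position must agree: an integral of `vol` over mass, and the
inverse of the integral of `1/vol` over space. Changing variables by `mass` turns the first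
integrand into `vol * (1/vol) = 1`. -/
theorem pos_zero (hw₀ : Measurable w₀) (y : ℝ) : S.pos w₀ 0 y = S.pos₀ w₀ y := by
  have h0 : S.pos w₀ 0 0 = 0 := by simp [pos, prim]
  have hpos₀0 : S.pos₀ w₀ 0 = 0 := by
    have : S.mass w₀ 0 = 0 := by simp [mass]
    rw [← this, pos₀, (S.biLip_mass hw₀).inv_apply, this]
  have hd : ∀ z, S.lag w₀ 0 z = S.data w₀ z := by
    intro z
    ext i
    simp [lag]
  have h1 := S.pos_sub hw₀ 0 0 y
  simp_rw [hd, h0, sub_zero] at h1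
  rw [h1]
  have hmp := S.measurePreserving_mass hw₀
  have key : ∀ u v, u ≤ v → ∫ s in u..v, S.vol (S.data w₀ s) = S.pos₀ w₀ v - S.pos₀ w₀ u := by
    intro u v huv
    have hmono := (S.biLip_pos₀ hw₀).strictMono.monotone huv
    rw [intervalIntegral.integral_of_le huv]
    have hemb : MeasurableEmbedding (S.mass w₀) :=
      (S.biLip_mass hw₀).continuous.measurableEmbedding (S.biLip_mass hw₀).strictMono.injective
    rw [← hmp.setIntegral_preimage_emb hemb]
    have hpre : S.mass w₀ ⁻¹' Ioc u v = Ioc (S.pos₀ w₀ u) (S.pos₀ w₀ v) := by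
      ext z
      have hz : z = S.pos₀ w₀ (S.mass w₀ z) := ((S.biLip_mass hw₀).inv_apply z).symm
      conv_rhs => rw [hz]
      simp only [mem_preimage, mem_Ioc, (S.biLip_pos₀ hw₀).strictMono.lt_iff_lt,
        (S.biLip_pos₀ hw₀).strictMono.le_iff_le]
    have hdm : ∀ z, S.data w₀ (S.mass w₀ z) = w₀ z := by
      intro z
      rw [data, pos₀, (S.biLip_mass hw₀).inv_apply]
    simp_rw [hpre, hdm]
    have hrestr : (volume.withDensity fun x => ENNReal.ofReal (S.vol (w₀ x))⁻¹).restrict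
        (Ioc (S.pos₀ w₀ u) (S.pos₀ w₀ v)) = (volume.restrict (Ioc (S.pos₀ w₀ u)
          (S.pos₀ w₀ v))).withDensity fun x => ((S.vol (w₀ x))⁻¹.toNNReal : ℝ≥0∞) :=
      restrict_withDensity measurableSet_Ioc _
    rw [hrestr, integral_withDensity_eq_integral_smul
      (S.measurable_inv_vol hw₀).real_toNNReal]
    have : ∀ x, (S.vol (w₀ x))⁻¹.toNNReal • S.vol (w₀ x) = 1 := by
      intro x
      rw [NNReal.smul_def, Real.coe_toNNReal _ (inv_pos.2 (S.vol_pos _)).le, smul_eq_mul,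
        inv_mul_cancel₀ (S.vol_pos _).ne']
    simp_rw [this]
    simp [hmono]
  have : ∫ s in (0:ℝ)..y, S.vol (S.data w₀ s) = S.pos₀ w₀ y := by
    rcases le_total 0 y with hy | hy
    · rw [key _ _ hy, hpos₀0, sub_zero]
    · rw [intervalIntegral.integral_symm, key _ _ hy, hpos₀0]
      ring
  exact this

/-- The equation of a characteristic. -/
theorem pos_add_mul (hw₀ : Measurable w₀) (k t z : ℝ) :
    S.pos w₀ t (z + k * t) =
      S.pos₀ w₀ z + ∫ s in (0:ℝ)..t, S.vel k (S.lag w₀ s (z + k * s)) := by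
  have hint : ∀ p, IntervalIntegrable
      (fun s => (k - S.c p) * S.η p (S.data w₀ (z + (k - S.c p) * s))) volume 0 t := by
    intro p
    refine intervalIntegrable_of_abs_le (C := |k - S.c p| * S.B) ?_
      (Eventually.of_forall fun s => ?_) _ _
    · exact (((S.measurable_η_data hw₀ p).comp
        (by fun_prop : Measurable fun s : ℝ => z + (k - S.c p) * s)).const_mul _).aestronglyMeasurable
    · rw [abs_mul]
      exact mul_le_mul_of_nonneg_left (S.abs_le p _) (abs_nonneg _)
  -- Along `y = z + k t` the argument of the `p`th primitive moves with relative speed `k - c p`;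
  -- together with `κ` these contributions make up `vel k`.
  have h1 : ∀ p, ∫ s in (0:ℝ)..t, (k - S.c p) * S.η p (S.data w₀ (z + (k - S.c p) * s)) =
      S.prim w₀ p (z + (k - S.c p) * t) - S.prim w₀ p z := by
    intro p
    rw [intervalIntegral.integral_const_mul, S.prim_sub hw₀]
    have := intervalIntegral.mul_integral_comp_add_mul (a := 0) (b := t)
      (f := fun s => S.η p (S.data w₀ s)) (k - S.c p) z
    simpa using this
  have h2 : ∀ s, S.vel k (S.lag w₀ s (z + k * s)) =
      S.κ + ∑ p, (k - S.c p) * S.η p (S.data w₀ (z + (k - S.c p) * s)) := by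
    intro s
    simp only [vel, η_lag]
    congr 1
    refine Finset.sum_congr rfl fun p _ => ?_
    congr 3
    ring
  simp_rw [h2]
  rw [intervalIntegral.integral_add (by simp)
    (by simpa [Finset.sum_fn] using IntervalIntegrable.sum Finset.univ fun p _ => hint p),
    intervalIntegral.integral_finsetSum fun p _ => hint p, ← S.pos_zero hw₀]
  simp_rw [h1, Finset.sum_sub_distrib, pos]
  simp only [intervalIntegral.integral_const, smul_eq_mul, mul_zero, sub_zero, add_zero]
  have h3 : ∀ p, z + k * t - S.c p * t = z + (k - S.c p) * t := fun p => by ring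
  simp_rw [h3]
  ring

/-- A particle with fixed mass coordinate is a characteristic of Lagrangian speed `0`, so the
relevant bound is `velBound 0`. -/
theorem abs_pos_sub_le (hw₀ : Measurable w₀) (t s y : ℝ) :
    |S.pos w₀ t y - S.pos w₀ s y| ≤ S.velBound 0 * |t - s| := by
  have h : S.pos w₀ t y - S.pos w₀ s y = S.κ * (t - s) +
      ∑ p, (S.prim w₀ p (y - S.c p * t) - S.prim w₀ p (y - S.c p * s)) := by
    rw [Finset.sum_sub_distrib, pos, pos]
    ring
  rw [h, velBound, add_mul, Finset.sum_mul]
  refine (abs_add_le _ _).trans (add_le_add (abs_mul _ _).le ?_)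
  refine (Finset.abs_sum_le_sum_abs _ _).trans (Finset.sum_le_sum fun p _ => ?_)
  refine (S.abs_prim_sub_le hw₀ p _ _).trans (le_of_eq ?_)
  have : y - S.c p * t - (y - S.c p * s) = (0 - S.c p) * (t - s) := by ring
  rw [this, abs_mul]
  ring

/-- At time `t` the particle that was at `x` at time `s` has moved by a bounded multiple of `|t -
s|`; the lower slope `m` of `pos` converts this displacement into a difference of mass coordinates.
-/
theorem abs_massAt_sub_le (hw₀ : Measurable w₀) (t s x : ℝ) :
    |S.massAt w₀ t x - S.massAt w₀ s x| ≤ S.m⁻¹ * (S.velBound 0 * |t - s|) := by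
  have h := (S.biLip_pos hw₀ t).abs_lower (S.massAt w₀ t x) (S.massAt w₀ s x)
  rw [massAt, (S.biLip_pos hw₀ t).apply_inv, ← massAt] at h
  have h2 := S.abs_pos_sub_le hw₀ s t (S.massAt w₀ s x)
  rw [massAt, (S.biLip_pos hw₀ s).apply_inv, ← massAt, abs_sub_comm s t] at h2
  rw [le_inv_mul_iff₀ S.m_pos]
  exact h.trans h2

theorem continuous_pos (hw₀ : Measurable w₀) : Continuous fun p : ℝ × ℝ => S.pos w₀ p.1 p.2 := by
  refine continuous_prod_of_continuous_lipschitzWith _ (S.velBound 0).toNNReal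
    (fun t => (S.biLip_pos hw₀ t).continuous) fun y => LipschitzWith.of_dist_le_mul fun t s => ?_
  rw [Real.coe_toNNReal _ (S.velBound_nonneg 0)]
  exact S.abs_pos_sub_le hw₀ t s y

theorem continuous_massAt (hw₀ : Measurable w₀) :
    Continuous fun p : ℝ × ℝ => S.massAt w₀ p.1 p.2 := by
  refine continuous_prod_of_continuous_lipschitzWith _ (S.m⁻¹ * S.velBound 0).toNNReal
    (fun t => (S.biLip_massAt hw₀ t).continuous) fun y => LipschitzWith.of_dist_le_mul fun t s => ?_
  rw [Real.coe_toNNReal _ (mul_nonneg (inv_nonneg.2 S.m_pos.le) (S.velBound_nonneg 0)), mul_assoc]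
  exact S.abs_massAt_sub_le hw₀ t s y

theorem measurable_sol (hw₀ : Measurable w₀) : Measurable fun p : ℝ × ℝ => S.sol w₀ p.1 p.2 :=
  (S.measurable_lag hw₀).comp (measurable_fst.prodMk (S.continuous_massAt hw₀).measurable)

end BlockSystem

/-! ### Changes of variables on the half plane and integration along curves. -/

/-- A family of maps of the line, each of which maps `ρ(t, x) dx` to Lebesgue measure. -/
theorem measurePreserving_prodMk {μ : Measure ℝ} [SFinite μ] {f : ℝ → ℝ → ℝ} {ρ : ℝ × ℝ → ℝ≥0∞}
    (hf : Measurable fun p : ℝ × ℝ => f p.1 p.2) (hρ : Measurable ρ)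
    (h : ∀ᵐ t ∂μ, MeasurePreserving (f t) (volume.withDensity fun x => ρ (t, x)) volume) :
    MeasurePreserving (fun p : ℝ × ℝ => (p.1, f p.1 p.2))
      ((μ.prod volume).withDensity ρ) (μ.prod volume) := by
  have hm : Measurable fun p : ℝ × ℝ => (p.1, f p.1 p.2) := measurable_fst.prodMk hf
  refine ⟨hm, Measure.ext fun A hA => ?_⟩
  rw [Measure.map_apply hm hA, withDensity_apply _ (hm hA), ← lintegral_indicator (hm hA),
    lintegral_prod _ ((hρ.indicator (hm hA)).aemeasurable), Measure.prod_apply hA]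
  refine lintegral_congr_ae ?_
  filter_upwards [h] with t ht
  have hs : MeasurableSet (Prod.mk t ⁻¹' A) := measurable_prodMk_left hA
  rw [← ht.measure_preimage hs.nullMeasurableSet, withDensity_apply _ (ht.measurable hs),
    ← lintegral_indicator (ht.measurable hs)]
  rfl

theorem volume_restrict_halfPlane :
    (volume : Measure (ℝ × ℝ)).restrict halfPlane = (volume.restrict (Ioi 0)).prod volume := by
  rw [halfPlane, Measure.volume_eq_prod, ← Measure.prod_restrict, Measure.restrict_univ]

theorem measurableSet_halfPlane : MeasurableSet halfPlane := measurableSet_Ioi.prod .univ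

theorem integral_withDensity_ofReal {α : Type*} [MeasurableSpace α] {μ : Measure α} {ρ : α → ℝ}
    (hρ : Measurable ρ) (hρ0 : ∀ᵐ x ∂μ, 0 ≤ ρ x) (F : α → ℝ) :
    ∫ x, F x ∂(μ.withDensity fun x => ENNReal.ofReal (ρ x)) = ∫ x, ρ x * F x ∂μ := by
  have h := integral_withDensity_eq_integral_smul (μ := μ) hρ.real_toNNReal F
  have h2 : (fun x => ENNReal.ofReal (ρ x)) = fun x => ((ρ x).toNNReal : ℝ≥0∞) := rfl
  rw [h2, h]
  refine integral_congr_ae ?_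
  filter_upwards [hρ0] with x hx
  rw [NNReal.smul_def, Real.coe_toNNReal _ hx, smul_eq_mul]

theorem MeasureTheory.MeasurePreserving.integral_comp_eq {α β : Type*} [MeasurableSpace α]
    [MeasurableSpace β] {μ : Measure α} {ν : Measure β} {f : α → β} (hf : MeasurePreserving f μ ν)
    {F : β → ℝ} (hF : AEStronglyMeasurable F ν) : ∫ x, F (f x) ∂μ = ∫ y, F y ∂ν := by
  rw [← hf.map_eq] at hF ⊢
  exact (integral_map hf.measurable.aemeasurable hF).symm

/-- Bounded functions with bounded support are integrable. -/
theorem integrable_of_abs_le_of_support {μ : Measure (ℝ × ℝ)} [IsLocallyFiniteMeasure μ]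
    {F : ℝ × ℝ → ℝ} (hF : AEStronglyMeasurable F μ) {C R : ℝ} (hC : ∀ᵐ p ∂μ, |F p| ≤ C)
    (hR : ∀ᵐ p ∂μ, R < ‖p‖ → F p = 0) : Integrable F μ := by
  have h1 : IntegrableOn F (Metric.closedBall 0 R) μ :=
    Measure.integrableOn_of_bounded (M := C) (isCompact_closedBall 0 R).measure_lt_top.ne hF
      (ae_restrict_of_ae hC)
  rw [← integrable_indicator_iff Metric.isClosed_closedBall.measurableSet] at h1
  refine h1.congr ?_
  filter_upwards [hR] with p hp
  by_cases h : p ∈ Metric.closedBall (0 : ℝ × ℝ) R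
  · rw [indicator_of_mem h]
  · rw [indicator_of_notMem h, hp]
    simpa using h

theorem exists_test_bound {φ : ℝ × ℝ → ℝ} (hφ : ContDiff ℝ ∞ φ) (hc : HasCompactSupport φ) :
    ∃ C R : ℝ, 0 ≤ C ∧ 0 < R ∧ (∀ p, |φ p| ≤ C ∧ |fderiv ℝ φ p (1, 0)| ≤ C ∧ |fderiv ℝ φ p (0, 1)| ≤ C) ∧
      ∀ p, R < ‖p‖ → φ p = 0 ∧ fderiv ℝ φ p = 0 := by
  obtain ⟨C0, hC0⟩ := hφ.continuous.bounded_above_of_compact_support hc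
  obtain ⟨C1, hC1⟩ := (hφ.continuous_fderiv (by simp)).bounded_above_of_compact_support
    (hc.fderiv (𝕜 := ℝ))
  obtain ⟨R, hR⟩ := hc.isCompact.isBounded.subset_closedBall (0 : ℝ × ℝ)
  refine ⟨max C0 C1, max R 1, ?_, by positivity, fun p => ⟨?_, ?_, ?_⟩, fun p hp => ⟨?_, ?_⟩⟩
  · exact (norm_nonneg _).trans ((hC0 0).trans (le_max_left _ _))
  · exact (hC0 p).trans (le_max_left _ _)
  · refine le_trans ?_ ((hC1 p).trans (le_max_right _ _))
    simpa using (fderiv ℝ φ p).le_opNorm (1, 0)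
  · refine le_trans ?_ ((hC1 p).trans (le_max_right _ _))
    simpa using (fderiv ℝ φ p).le_opNorm (0, 1)
  · refine image_eq_zero_of_notMem_tsupport fun h => ?_
    have := hR h
    rw [mem_closedBall_zero_iff] at this
    exact absurd hp (not_lt.2 (this.trans (le_max_left _ _)))
  · refine image_eq_zero_of_notMem_tsupport (f := fderiv ℝ φ) fun h => ?_
    have := hR (tsupport_fderiv_subset ℝ h)
    rw [mem_closedBall_zero_iff] at this
    exact absurd hp (not_lt.2 (this.trans (le_max_left _ _)))

/-- The fundamental theorem of calculus along a Lipschitz curve. -/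
theorem integral_fderiv_along {φ : ℝ × ℝ → ℝ} (hφ : ContDiff ℝ 1 φ) {T : ℝ} (hT : 0 ≤ T)
    (hφT : ∀ t x, T ≤ t → φ (t, x) = 0) {ℓ : ℝ → ℝ} (hℓ : Measurable ℓ) {C : ℝ}
    (hC : ∀ t, |ℓ t| ≤ C) {γ : ℝ → ℝ} {γ₀ : ℝ} (hγ : ∀ t, γ t = γ₀ + ∫ s in (0:ℝ)..t, ℓ s) :
    ∫ t in Ioi (0:ℝ), (fderiv ℝ φ (t, γ t) (1, 0) + ℓ t * fderiv ℝ φ (t, γ t) (0, 1)) =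
      - φ (0, γ₀) := by
  have hint : ∀ x y, IntervalIntegrable ℓ volume x y :=
    intervalIntegrable_of_abs_le hℓ.aestronglyMeasurable (Eventually.of_forall hC)
  have hlip : LipschitzWith C.toNNReal γ := LipschitzWith.of_dist_le_mul fun t s => by
    rw [Real.coe_toNNReal _ ((abs_nonneg _).trans (hC 0)), hγ, hγ, dist_add_left, Real.dist_eq,
      intervalIntegral.integral_interval_sub_left (hint _ _) (hint _ _), ← Real.norm_eq_abs,
      Real.dist_eq]
    exact intervalIntegral.norm_integral_le_of_norm_le_const fun s _ => hC s
  -- The curve is only Lipschitz, so the fundamental theorem is applied to `φ` along it as an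
  -- absolutely continuous function on `[0, T]`, with the chain rule at almost every `t`.
  set G : ℝ → ℝ := fun t => φ (t, γ t) with hG
  have hGl : LocallyLipschitz G :=
    hφ.locallyLipschitz.comp ((LipschitzWith.id.prodMk hlip).locallyLipschitz)
  obtain ⟨K, hK⟩ := hGl.locallyLipschitzOn.exists_lipschitzOnWith_of_compact
    (isCompact_uIcc (a := 0) (b := T))
  have hFTC := hK.absolutelyContinuousOnInterval.integral_deriv_eq_sub
  have hderiv : ∀ᵐ t, deriv G t =
      fderiv ℝ φ (t, γ t) (1, 0) + ℓ t * fderiv ℝ φ (t, γ t) (0, 1) := by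
    have hloc : LocallyIntegrable ℓ volume := by
      refine (locallyIntegrable_const C).mono hℓ.aestronglyMeasurable (Eventually.of_forall fun t => ?_)
      exact (hC t).trans (le_abs_self _)
    filter_upwards [LocallyIntegrable.ae_hasDerivAt_integral hloc] with t ht
    have h1 : HasDerivAt γ (ℓ t) t := by
      have := (ht 0).const_add γ₀
      exact this.congr_of_eventuallyEq (Eventually.of_forall hγ)
    have h2 : HasDerivAt (fun t => (t, γ t)) ((1:ℝ), ℓ t) t := (hasDerivAt_id t).prodMk h1
    have h3 := ((hφ.differentiable one_ne_zero (t, γ t)).hasFDerivAt.comp_hasDerivAt t h2).deriv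
    change deriv (φ ∘ fun t => (t, γ t)) t = _
    rw [h3]
    have : ((1:ℝ), ℓ t) = (1, 0) + ℓ t • (0, 1) := by simp
    rw [this, map_add, map_smul, smul_eq_mul]
  have hzero : ∀ t, T < t → fderiv ℝ φ (t, γ t) = 0 := by
    intro t ht
    have : φ =ᶠ[𝓝 (t, γ t)] fun _ => 0 := by
      filter_upwards [(isOpen_Ioi.preimage continuous_fst).mem_nhds (show (t, γ t).1 ∈ Ioi T from ht)]
        with p hp
      exact hφT p.1 p.2 (le_of_lt hp)
    rw [this.fderiv_eq]
    simp
  rw [setIntegral_eq_of_subset_of_forall_sdiff_eq_zero measurableSet_Ioi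
    (Ioc_subset_Ioi_self : Ioc 0 T ⊆ Ioi 0), ← intervalIntegral.integral_of_le hT]
  · rw [← intervalIntegral.integral_congr_ae (hderiv.mono fun t ht _ => ht), hFTC, hG]
    simp only [hφT T _ le_rfl, hγ 0]
    simp
  · intro t ht
    rw [hzero t (by simpa [ht.1.out] using ht.2)]
    simp

/-! ### The conservation laws of the explicit solution. -/

namespace BlockSystem
variable {n : ℕ} (S : BlockSystem n) {w₀ : ℝ → State n}

theorem measurePreserving_pos_add (hw₀ : Measurable w₀) (t d : ℝ) :
    MeasurePreserving (fun z => S.pos w₀ t (z + d))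
      (volume.withDensity fun z => ENNReal.ofReal (S.vol (S.lag w₀ t (z + d)))) volume := by
  have hint := S.intervalIntegrable_vol_lag hw₀ t
  have hsub : ∀ x y, S.pos w₀ t (y + d) - S.pos w₀ t (x + d) =
      ∫ s in x..y, S.vol (S.lag w₀ t (s + d)) := by
    intro x y
    rw [S.pos_sub hw₀, intervalIntegral.integral_comp_add_right (fun s => S.vol (S.lag w₀ t s))]
  have hint' : ∀ x y, IntervalIntegrable (fun s => S.vol (S.lag w₀ t (s + d))) volume x y := by
    intro x y
    simpa using (hint (x + d) (y + d)).comp_add_right d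
  exact (BiLip.of_integral S.m_pos hint'
    (Eventually.of_forall fun _ => ⟨S.le_sum _, S.sum_le _⟩) hsub).measurePreserving
    (Eventually.of_forall fun _ => (S.vol_pos _).le) hint' hsub

theorem pos_zero_zero : S.pos w₀ 0 0 = 0 := by simp [pos, prim]

theorem measurable_lag_add (hw₀ : Measurable w₀) (k : ℝ) :
    Measurable fun p : ℝ × ℝ => S.lag w₀ p.1 (p.2 + k * p.1) :=
  (S.measurable_lag hw₀).comp (measurable_fst.prodMk (by fun_prop : Measurable fun p : ℝ × ℝ =>
    p.2 + k * p.1))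

theorem measurable_vol_lag_add (hw₀ : Measurable w₀) (k : ℝ) :
    Measurable fun p : ℝ × ℝ => S.vol (S.lag w₀ p.1 (p.2 + k * p.1)) :=
  S.continuous_vol.measurable.comp (S.measurable_lag_add hw₀ k)

theorem measurable_pos_add (hw₀ : Measurable w₀) (k : ℝ) :
    Measurable fun p : ℝ × ℝ => S.pos w₀ p.1 (p.2 + k * p.1) :=
  Measurable.comp (g := fun q : ℝ × ℝ => S.pos w₀ q.1 q.2) (f := fun p : ℝ × ℝ =>
    (p.1, p.2 + k * p.1)) (S.continuous_pos hw₀).measurable (by fun_prop)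

/-- Here `z = y - k t` labels the characteristics of Lagrangian speed `k`. On each time slice
passing from `y` to `z` is a translation, so the density stays the specific volume. -/
theorem measurePreserving_char (hw₀ : Measurable w₀) (k : ℝ) :
    MeasurePreserving (fun p : ℝ × ℝ => (p.1, S.pos w₀ p.1 (p.2 + k * p.1)))
      (((volume.restrict (Ioi (0:ℝ))).prod volume).withDensity fun p =>
        ENNReal.ofReal (S.vol (S.lag w₀ p.1 (p.2 + k * p.1))))
      ((volume.restrict (Ioi (0:ℝ))).prod volume) :=
  measurePreserving_prodMk (f := fun t z => S.pos w₀ t (z + k * t)) (S.measurable_pos_add hw₀ k)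
    (S.measurable_vol_lag_add hw₀ k).ennreal_ofReal
    (Eventually.of_forall fun t => S.measurePreserving_pos_add hw₀ t (k * t))

set_option maxHeartbeats 1000000 in
/-- Conservation laws satisfied by the solution. -/
theorem weakLaw (hw₀ : Measurable w₀) (k : ℝ) {g : ℝ → ℝ} (hg : Measurable g) {B : ℝ}
    (hB : ∀ z, |g z| ≤ B) :
    WeakConservationLaw
      (fun t x => (S.vol (S.sol w₀ t x))⁻¹ * g (S.massAt w₀ t x - k * t))
      (fun t x => (S.vol (S.sol w₀ t x))⁻¹ * S.vel k (S.sol w₀ t x) * g (S.massAt w₀ t x - k * t))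
      (fun x => (S.vol (w₀ x))⁻¹ * g (S.mass w₀ x)) := by
  intro φ hφ hc
  obtain ⟨C, R, hC0, hR0, hC, hR⟩ := exists_test_bound hφ hc
  set μ : Measure (ℝ × ℝ) := (volume.restrict (Ioi (0:ℝ))).prod volume with hμ
  let P : ℝ × ℝ → ℝ × ℝ := fun p => (p.1, S.pos w₀ p.1 (p.2 + k * p.1))
  have hlagm := S.measurable_lag_add hw₀ k
  have hvolm := S.measurable_vol_lag_add hw₀ k
  have hmp : MeasurePreserving P (μ.withDensity fun p =>
      ENNReal.ofReal (S.vol (S.lag w₀ p.1 (p.2 + k * p.1)))) μ := S.measurePreserving_char hw₀ k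
  have hφt : Measurable fun p => fderiv ℝ φ p (1, 0) :=
    ((hφ.continuous_fderiv (by simp)).clm_apply continuous_const).measurable
  have hφx : Measurable fun p => fderiv ℝ φ p (0, 1) :=
    ((hφ.continuous_fderiv (by simp)).clm_apply continuous_const).measurable
  have hmassm := (S.continuous_massAt hw₀).measurable
  have hsolm := S.measurable_sol hw₀
  have hgm : Measurable fun p : ℝ × ℝ => g (S.massAt w₀ p.1 p.2 - k * p.1) :=
    hg.comp (hmassm.sub (by fun_prop))
  rw [volume_restrict_halfPlane, ← hμ]
  -- Pulling back to the labels `(t, z)` produces the density `vol`, which cancels the factor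
  -- `1/vol`, and turns the transported quantity into `g z`, independent of `t`.
  have hstep1 := hmp.integral_comp_eq (F := fun p =>
    (S.vol (S.sol w₀ p.1 p.2))⁻¹ * g (S.massAt w₀ p.1 p.2 - k * p.1) * fderiv ℝ φ p (1, 0) +
    (S.vol (S.sol w₀ p.1 p.2))⁻¹ * S.vel k (S.sol w₀ p.1 p.2) *
      g (S.massAt w₀ p.1 p.2 - k * p.1) * fderiv ℝ φ p (0, 1)) (by
    have h1 := (S.continuous_vol.measurable.comp hsolm).inv
    have h2 := (S.continuous_vel k).measurable.comp hsolm
    exact (((h1.mul hgm).mul hφt).add (((h1.mul h2).mul hgm).mul hφx)).aestronglyMeasurable)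
  rw [← hstep1, integral_withDensity_ofReal hvolm (Eventually.of_forall fun _ => (S.vol_pos _).le)]
  have hstep2 : ∀ p : ℝ × ℝ, S.vol (S.lag w₀ p.1 (p.2 + k * p.1)) *
      ((S.vol (S.sol w₀ (P p).1 (P p).2))⁻¹ * g (S.massAt w₀ (P p).1 (P p).2 - k * (P p).1) *
        fderiv ℝ φ (P p) (1, 0) + (S.vol (S.sol w₀ (P p).1 (P p).2))⁻¹ *
        S.vel k (S.sol w₀ (P p).1 (P p).2) * g (S.massAt w₀ (P p).1 (P p).2 - k * (P p).1) *
        fderiv ℝ φ (P p) (0, 1)) = g p.2 * (fderiv ℝ φ (P p) (1, 0) +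
          S.vel k (S.lag w₀ p.1 (p.2 + k * p.1)) * fderiv ℝ φ (P p) (0, 1)) := by
    intro p
    simp only [P, S.sol_pos hw₀]
    rw [massAt, (S.biLip_pos hw₀ p.1).inv_apply, add_sub_cancel_right]
    have := (S.vol_pos (S.lag w₀ p.1 (p.2 + k * p.1))).ne'
    field_simp
  simp_rw [hstep2]
  have hint : Integrable (fun p : ℝ × ℝ => g p.2 * (fderiv ℝ φ (P p) (1, 0) +
          S.vel k (S.lag w₀ p.1 (p.2 + k * p.1)) * fderiv ℝ φ (P p) (0, 1))) μ := by
    refine integrable_of_abs_le_of_support (C := B * (C + S.velBound k * C))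
      (R := R + |k| * R + S.m⁻¹ * (R + S.velBound 0 * R)) ?_
      (Eventually.of_forall fun p => ?_) (Eventually.of_forall fun p hp => ?_)
    · exact ((hg.comp measurable_snd).mul ((hφt.comp hmp.measurable).add
        (((S.continuous_vel k).measurable.comp hlagm).mul
          (hφx.comp hmp.measurable)))).aestronglyMeasurable
    · rw [abs_mul]
      refine mul_le_mul (hB _) ?_ (abs_nonneg _) ((abs_nonneg _).trans (hB 0))
      refine (abs_add_le _ _).trans (add_le_add (hC _).2.1 ?_)
      rw [abs_mul]
      exact mul_le_mul (S.abs_vel_le k _) (hC _).2.2 (abs_nonneg _) (S.velBound_nonneg k)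
    -- If `P p` lies in the `R`-ball, then `t` is bounded by `R`, the speed bound controls `pos t
    -- 0`, and the lower slope `m` controls `z + k t`, hence `z`. Integrability on this region
    -- allows the order of integration to be exchanged.
    · suffices h : R < ‖P p‖ by
        rw [(hR _ h).2]
        simp
      by_contra hle
      rw [not_lt, Prod.norm_def, max_le_iff] at hle
      obtain ⟨h1, h2⟩ := hle
      simp only [P, Real.norm_eq_abs] at h1 h2
      have h3 := (S.biLip_pos hw₀ p.1).abs_lower (p.2 + k * p.1) 0
      have h4 := S.abs_pos_sub_le hw₀ p.1 0 0
      rw [S.pos_zero_zero, sub_zero, sub_zero] at h4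
      rw [sub_zero] at h3
      have h5 : |p.2 + k * p.1| ≤ S.m⁻¹ * (R + S.velBound 0 * R) := by
        rw [le_inv_mul_iff₀ S.m_pos]
        refine h3.trans ((abs_sub _ _).trans (add_le_add h2 (h4.trans ?_)))
        exact mul_le_mul_of_nonneg_left h1 (S.velBound_nonneg 0)
      have h6 : |p.2| ≤ |p.2 + k * p.1| + |k| * R := by
        have : p.2 = (p.2 + k * p.1) - k * p.1 := by ring
        conv_lhs => rw [this]
        refine (abs_sub _ _).trans (add_le_add le_rfl ?_)
        rw [abs_mul]
        exact mul_le_mul_of_nonneg_left h1 (abs_nonneg _)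
      have h7 : 0 ≤ S.m⁻¹ * (R + S.velBound 0 * R) := (abs_nonneg _).trans h5
      have h8 : 0 ≤ |k| * R := by positivity
      have : ‖p‖ ≤ R + |k| * R + S.m⁻¹ * (R + S.velBound 0 * R) := by
        rw [Prod.norm_def, max_le_iff]
        constructor
        · rw [Real.norm_eq_abs]
          linarith
        · rw [Real.norm_eq_abs]
          linarith
      exact absurd hp (not_lt.2 this)
  rw [hμ, integral_prod_symm _ hint]
  have hinner : ∀ z, ∫ t in Ioi (0:ℝ), g z * (fderiv ℝ φ (P (t, z)) (1, 0) +
      S.vel k (S.lag w₀ t (z + k * t)) * fderiv ℝ φ (P (t, z)) (0, 1)) =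
      - (g z * φ (0, S.pos₀ w₀ z)) := by
    intro z
    rw [integral_const_mul]
    -- The test function is known to vanish only at norms strictly above `R`, whence the time `R +
    -- 1`.
    have := integral_fderiv_along (hφ.of_le (by simp)) (T := R + 1) (by positivity)
      (fun t x ht => (hR (t, x) (by
        rw [Prod.norm_def, Real.norm_eq_abs]
        exact lt_of_lt_of_le (by linarith) ((le_abs_self t).trans (le_max_left _ _)))).1)
      (ℓ := fun t => S.vel k (S.lag w₀ t (z + k * t)))
      ((S.continuous_vel k).measurable.comp (hlagm.comp (by fun_prop : Measurable fun t : ℝ => (t, z))))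
      (fun t => S.abs_vel_le k _) (fun t => S.pos_add_mul hw₀ k t z)
    simp only [P]
    rw [this]
    ring
  simp_rw [hinner, integral_neg]
  -- The boundary term is an integral over labels; the initial mass coordinate carries it back to
  -- `x` with density `1/vol`.
  have hmass := (S.measurePreserving_mass hw₀).integral_comp_eq
    (F := fun z => g z * φ (0, S.pos₀ w₀ z)) (by
      refine (hg.mul (hφ.continuous.measurable.comp (measurable_const.prodMk ?_))).aestronglyMeasurable
      exact (S.biLip_pos₀ hw₀).continuous.measurable)
  rw [← hmass, integral_withDensity_ofReal (S.measurable_inv_vol hw₀)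
    (Eventually.of_forall fun _ => (inv_pos.2 (S.vol_pos _)).le), neg_add_eq_zero]
  refine integral_congr_ae (Eventually.of_forall fun x => ?_)
  simp only
  rw [pos₀, (S.biLip_mass hw₀).inv_apply]
  ring

end BlockSystem

/-! ### Mollification and vanishing weak derivatives. -/

section Mollify
set_option linter.unusedSectionVars false
open scoped Convolution
open ContinuousLinearMap

variable {E : Type*} [NormedAddCommGroup E] [NormedSpace ℝ E] [FiniteDimensional ℝ E]
  [MeasurableSpace E] [BorelSpace E] (μ : Measure E) [μ.IsAddHaarMeasure]

/-- A bump function with support of radius `2 / (k + 1)`. -/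
noncomputable def shrinkingBump (E : Type*) [NormedAddCommGroup E] (k : ℕ) : ContDiffBump (0 : E) where
  rIn := 1 / (k + 1)
  rOut := 2 / (k + 1)
  rIn_pos := by positivity
  rIn_lt_rOut := by
    gcongr
    norm_num

/-- Mollification at scale `2 / (k + 1)`. -/
noncomputable def mollify (k : ℕ) (q : E → ℝ) : E → ℝ :=
  (shrinkingBump E k).normed μ ⋆[lsmul ℝ ℝ, μ] q

variable {μ} {q : E → ℝ}

theorem mollify_contDiff (hq : LocallyIntegrable q μ) (k : ℕ) : ContDiff ℝ ∞ (mollify μ k q) :=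
  (shrinkingBump E k).hasCompactSupport_normed.contDiff_convolution_left _
    (shrinkingBump E k).contDiff_normed hq

theorem ae_tendsto_mollify (hq : LocallyIntegrable q μ) :
    ∀ᵐ x ∂μ, Tendsto (fun k => mollify μ k q x) atTop (𝓝 (q x)) := by
  refine ContDiffBump.ae_convolution_tendsto_right_of_locallyIntegrable
    (φ := fun k => shrinkingBump E k) (K := 2) ?_ (Eventually.of_forall fun k => ?_) hq
  · change Tendsto (fun k : ℕ => (2 : ℝ) / (k + 1)) atTop (𝓝 0)
    have := (tendsto_one_div_add_atTop_nhds_zero_nat (𝕜 := ℝ)).const_mul 2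
    simpa [mul_one_div, div_eq_mul_inv] using this
  · change (2 : ℝ) / (k + 1) ≤ 2 * (1 / (k + 1))
    rw [mul_one_div]

theorem mollify_apply (k : ℕ) (x : E) :
    mollify μ k q x = ∫ s, (shrinkingBump E k).normed μ (x - s) * q s ∂μ := by
  rw [mollify, convolution_eq_swap]
  rfl

/-- The derivative of a mollification is obtained by testing with a test function. -/
theorem fderiv_mollify (hq : LocallyIntegrable q μ) (k : ℕ) (x v : E) :
    fderiv ℝ (mollify μ k q) x v =
      - ∫ s, q s * fderiv ℝ (fun s => (shrinkingBump E k).normed μ (x - s)) s v ∂μ := by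
  set ρ := (shrinkingBump E k).normed μ with hρ
  have hρc : HasCompactSupport ρ := (shrinkingBump E k).hasCompactSupport_normed
  have hρs : ContDiff ℝ 1 ρ := (shrinkingBump E k).contDiff_normed
  have h1 := (hρc.hasFDerivAt_convolution_left (lsmul ℝ ℝ) hρs hq x).fderiv
  rw [mollify, ← hρ, h1, convolution_eq_swap, ContinuousLinearMap.integral_apply]
  · rw [← integral_neg]
    congr 1
    ext s
    have h2 : fderiv ℝ (fun s => ρ (x - s)) s = - fderiv ℝ ρ (x - s) := by
      have h3 : HasFDerivAt (fun s => x - s) (-ContinuousLinearMap.id ℝ E) s := by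
        simpa using (hasFDerivAt_id s).const_sub x
      have h4 := ((hρs.differentiable one_ne_zero (x - s)).hasFDerivAt.comp s h3).fderiv
      change fderiv ℝ (ρ ∘ fun s => x - s) s = _
      rw [h4]
      ext
      simp
    rw [h2]
    simp [precompL, mul_comm]
  · have := (hρc.fderiv (𝕜 := ℝ)).convolutionExists_left (μ := μ) (L := (lsmul ℝ ℝ).precompL E)
      (hρs.continuous_fderiv one_ne_zero) hq x
    exact this.integrable_swap

theorem contDiff_testBump (k : ℕ) (x : E) :
    ContDiff ℝ ∞ fun s => (shrinkingBump E k).normed μ (x - s) :=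
  (shrinkingBump E k).contDiff_normed.comp (contDiff_const.sub contDiff_id)

theorem hasCompactSupport_testBump (k : ℕ) (x : E) :
    HasCompactSupport fun s => (shrinkingBump E k).normed μ (x - s) :=
  (shrinkingBump E k).hasCompactSupport_normed.comp_homeomorph (Homeomorph.subLeft x)

theorem integrable_testBump_mul (hq : LocallyIntegrable q μ) (k : ℕ) (x : E) :
    Integrable (fun s => (shrinkingBump E k).normed μ (x - s) * q s) μ := by
  have := ((shrinkingBump E k).hasCompactSupport_normed (μ := μ)).convolutionExists_left (μ := μ)
    (L := lsmul ℝ ℝ) ((shrinkingBump E k).contDiff_normed (μ := μ) (n := 0)).continuous hq x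
  exact this.integrable_swap

theorem integral_testBump (k : ℕ) (x : E) :
    ∫ s, (shrinkingBump E k).normed μ (x - s) ∂μ = 1 := by
  rw [integral_sub_left_eq_self (fun s => (shrinkingBump E k).normed μ s) μ x]
  exact (shrinkingBump E k).integral_normed

theorem integrable_testBump (k : ℕ) (x : E) :
    Integrable (fun s => (shrinkingBump E k).normed μ (x - s)) μ :=
  (contDiff_testBump k x).continuous.integrable_of_hasCompactSupport (hasCompactSupport_testBump k x)

theorem le_mollify (hq : LocallyIntegrable q μ) {m : ℝ} (hm : ∀ᵐ x ∂μ, m ≤ q x) (k : ℕ) (x : E) :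
    m ≤ mollify μ k q x := by
  rw [mollify_apply]
  have h1 : ∫ s, (shrinkingBump E k).normed μ (x - s) * m ∂μ = m := by
    rw [integral_mul_const, integral_testBump, one_mul]
  rw [← h1]
  refine integral_mono_ae ((integrable_testBump k x).mul_const m) (integrable_testBump_mul hq k x) ?_
  filter_upwards [hm] with s hs
  exact mul_le_mul_of_nonneg_left hs ((shrinkingBump E k).nonneg_normed _)

theorem mollify_le (hq : LocallyIntegrable q μ) {M : ℝ} (hM : ∀ᵐ x ∂μ, q x ≤ M) (k : ℕ) (x : E) :
    mollify μ k q x ≤ M := by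
  rw [mollify_apply]
  have h1 : ∫ s, (shrinkingBump E k).normed μ (x - s) * M ∂μ = M := by
    rw [integral_mul_const, integral_testBump, one_mul]
  conv_rhs => rw [← h1]
  refine integral_mono_ae (integrable_testBump_mul hq k x) ((integrable_testBump k x).mul_const M) ?_
  filter_upwards [hM] with s hs
  exact mul_le_mul_of_nonneg_left hs ((shrinkingBump E k).nonneg_normed _)

theorem locallyIntegrable_of_abs_le (hq : AEStronglyMeasurable q μ) {C : ℝ}
    (hC : ∀ᵐ x ∂μ, |q x| ≤ C) : LocallyIntegrable q μ := by
  refine (locallyIntegrable_const C).mono hq ?_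
  filter_upwards [hC] with x hx
  exact hx.trans (le_abs_self _)

/-- Functions with vanishing weak directional derivative have mollifications which are constant in
that direction. -/
theorem mollify_add_smul (hq : LocallyIntegrable q μ) {v : E}
    (h : ∀ φ : E → ℝ, ContDiff ℝ ∞ φ → HasCompactSupport φ → ∫ s, q s * fderiv ℝ φ s v ∂μ = 0)
    (k : ℕ) (x : E) (t : ℝ) : mollify μ k q (x + t • v) = mollify μ k q x := by
  have hd : ∀ t : ℝ, HasDerivAt (fun t : ℝ => mollify μ k q (x + t • v)) 0 t := by
    intro t
    have h1 : HasDerivAt (fun t : ℝ => x + t • v) v t := by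
      simpa using ((hasDerivAt_id t).smul_const v).const_add x
    have h2 := ((mollify_contDiff hq k).differentiable (by simp) (x + t • v)).hasFDerivAt.comp_hasDerivAt
      t h1
    rw [fderiv_mollify hq, h _ (contDiff_testBump k _) (hasCompactSupport_testBump k _), neg_zero]
      at h2
    exact h2
  have := is_const_of_deriv_eq_zero (fun t => (hd t).differentiableAt) (fun t => (hd t).deriv) t 0
  simpa using this

end Mollify

/-- A locally integrable function on the line with vanishing weak derivative is constant. -/
theorem exists_ae_eq_const_of_integral_mul_deriv {q : ℝ → ℝ} (hq : LocallyIntegrable q volume)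
    (h : ∀ φ : ℝ → ℝ, ContDiff ℝ ∞ φ → HasCompactSupport φ → ∫ s, q s * deriv φ s = 0) :
    ∃ c, ∀ᵐ x, q x = c := by
  have hlim := ae_tendsto_mollify hq
  have hconst : ∀ k x, mollify volume k q x = mollify volume k q 0 := by
    intro k x
    have := mollify_add_smul hq (v := (1:ℝ)) (fun φ hφ hc => h φ hφ hc) k 0 x
    simpa using this
  simp_rw [hconst] at hlim
  obtain ⟨x₀, hx₀⟩ := hlim.exists
  refine ⟨q x₀, ?_⟩
  filter_upwards [hlim] with x hx
  exact tendsto_nhds_unique hx hx₀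

/-- A locally integrable function on the plane which vanishes for `t < 0` and has vanishing weak
`t`-derivative is zero. -/
theorem ae_eq_zero_of_integral_mul_fderiv {q : ℝ × ℝ → ℝ} (hq : LocallyIntegrable q volume)
    (h : ∀ φ : ℝ × ℝ → ℝ, ContDiff ℝ ∞ φ → HasCompactSupport φ →
      ∫ s, q s * fderiv ℝ φ s (1, 0) = 0)
    (h0 : ∀ᵐ p : ℝ × ℝ, p.1 < 0 → q p = 0) : ∀ᵐ p, q p = 0 := by
  filter_upwards [ae_tendsto_mollify hq] with p hp
  have hz : ∀ k, mollify volume k q p = 0 := by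
    intro k
    -- Shifting to time `-3` leaves the mollification unchanged, and a bump of radius at most `2`
    -- then sees only times below `-1`, where the function vanishes.
    rw [← mollify_add_smul hq h k p (-p.1 - 3), mollify_apply]
    refine integral_eq_zero_of_ae ?_
    filter_upwards [h0] with s hs
    by_cases hs0 : s.1 < 0
    · simp [hs hs0]
    · have : (shrinkingBump (ℝ × ℝ) k).normed volume (p + (-p.1 - 3) • (1, 0) - s) = 0 := by
        rw [← Function.notMem_support, ContDiffBump.support_normed_eq, Metric.mem_ball, not_lt,
          dist_zero_right]
        have h1 : (shrinkingBump (ℝ × ℝ) k).rOut ≤ 2 := by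
          change (2:ℝ) / (k + 1) ≤ 2
          exact div_le_self (by norm_num) (by linarith [Nat.cast_nonneg (α := ℝ) k])
        refine h1.trans ?_
        refine le_trans ?_ (norm_fst_le _)
        rw [Real.norm_eq_abs]
        refine le_trans ?_ (neg_le_abs _)
        simp
        linarith
      rw [this, zero_mul]
      rfl
  simp_rw [hz] at hp
  exact tendsto_nhds_unique hp tendsto_const_nhds

/-! ### Moduli of continuity, in `L¹`, of composition with maps of the line. -/

/-- Composition of an `L¹` function with maps that do not contract distances is uniformly
continuous in the map. -/
theorem exists_lintegral_comp_sub_comp_le {f : ℝ → ℝ} (hf : Measurable f) (hfi : Integrable f)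
    {m : ℝ} (hm : 0 < m) {ε : ℝ≥0∞} (hε : ε ≠ 0) :
    ∃ δ : ℝ, 0 < δ ∧ ∀ A B : ℝ → ℝ, Measurable A → Measurable B →
      (∀ x y, m * |x - y| ≤ |A x - A y|) → (∀ x y, m * |x - y| ≤ |B x - B y|) →
      (∀ x, |A x - B x| ≤ δ) → ∫⁻ x, ‖f (A x) - f (B x)‖ₑ ≤ ε := by
  set K : ℝ≥0∞ := ENNReal.ofReal m⁻¹ with hK
  have hK0 : K ≠ 0 := (ENNReal.ofReal_pos.2 (inv_pos.2 hm)).ne'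
  have hKt : K ≠ ⊤ := ENNReal.ofReal_ne_top
  have hε3 : ε / 3 ≠ 0 := by simp [hε]
  have hε' : ε / 3 / K ≠ 0 := by simp [hε, hKt]
  -- Composition may enlarge `L¹` norms by the factor `K`; the tolerance is divided by `K` in
  -- advance.
  obtain ⟨g, hgc, hg, hgcont, hgi⟩ := hfi.exists_hasCompactSupport_lintegral_sub_le hε'
  set V : ℝ≥0∞ := volume (tsupport g) with hV
  have hVt : V ≠ ⊤ := hgc.isCompact.measure_lt_top.ne
  -- The difference `g ∘ A - g ∘ B` vanishes unless `A x` or `B x` is in the support of `g`, and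
  -- each of these events has measure at most `K * V`.
  obtain ⟨η, hη0, hη⟩ : ∃ η : ℝ, 0 < η ∧ ENNReal.ofReal η * (K * V + K * V) ≤ ε / 3 := by
    have hlim : Tendsto (fun η : ℝ => ENNReal.ofReal η * (K * V + K * V)) (𝓝[>] 0) (𝓝 0) := by
      have h1 : Tendsto (fun η : ℝ => ENNReal.ofReal η) (𝓝[>] 0) (𝓝 0) := by
        have := (ENNReal.continuous_ofReal.tendsto 0)
        rw [ENNReal.ofReal_zero] at this
        exact this.mono_left nhdsWithin_le_nhds
      have := ENNReal.Tendsto.mul_const (b := K * V + K * V) h1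
        (Or.inr (by simp [ENNReal.mul_eq_top, hKt, hVt]))
      simpa using this
    have h2 := (hlim.eventually (Iic_mem_nhds (pos_iff_ne_zero.2 hε3))).and self_mem_nhdsWithin
    obtain ⟨η, h3, h4⟩ := h2.exists
    exact ⟨η, h4, h3⟩
  obtain ⟨δ, hδ0, hδ⟩ := Metric.uniformContinuous_iff.1
    (hgcont.uniformContinuous_of_tendsto_cocompact (x := 0) hgc.is_zero_at_infty) η hη0
  refine ⟨δ / 2, by positivity, fun A B hA hB hAm hBm hAB => ?_⟩
  have hfg : Measurable fun x => ‖f x - g x‖ₑ := (hf.sub hgcont.measurable).enorm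
  have hfirst : ∀ A : ℝ → ℝ, Measurable A → (∀ x y, m * |x - y| ≤ |A x - A y|) →
      ∫⁻ x, ‖f (A x) - g (A x)‖ₑ ≤ ε / 3 := by
    intro A hA hAm
    refine (lintegral_comp_le hm hA hAm hfg.aemeasurable).trans ?_
    refine (mul_le_mul_right hg K).trans ?_
    rw [ENNReal.mul_div_cancel hK0 hKt]
  have hsupp : ∀ A : ℝ → ℝ, Measurable A → (∀ x y, m * |x - y| ≤ |A x - A y|) →
      ∫⁻ x, (tsupport g).indicator 1 (A x) ≤ K * V := by
    intro A hA hAm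
    have hms := (isClosed_tsupport g).measurableSet
    refine (lintegral_comp_le hm hA hAm
      ((measurable_const (a := (1:ℝ≥0∞))).indicator hms).aemeasurable).trans ?_
    rw [lintegral_indicator hms]
    simp [hV, hK]
  have hmid : ∫⁻ x, ‖g (A x) - g (B x)‖ₑ ≤ ε / 3 := by
    refine le_trans (lintegral_mono (g := fun x => ENNReal.ofReal η *
      ((tsupport g).indicator 1 (A x) + (tsupport g).indicator 1 (B x))) fun x => ?_) ?_
    · by_cases h : A x ∈ tsupport g ∨ B x ∈ tsupport g
      · have h1 : (1:ℝ≥0∞) ≤ (tsupport g).indicator 1 (A x) + (tsupport g).indicator 1 (B x) := by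
          rcases h with h | h
          · rw [indicator_of_mem h]
            exact le_self_add
          · rw [indicator_of_mem h (1 : ℝ → ℝ≥0∞)]
            exact le_add_self
        refine le_trans ?_ (mul_le_mul_right h1 _)
        rw [mul_one, Real.enorm_eq_ofReal_abs]
        refine ENNReal.ofReal_le_ofReal (le_of_lt (hδ ?_))
        rw [Real.dist_eq]
        linarith [hAB x]
      · rw [not_or] at h
        simp [image_eq_zero_of_notMem_tsupport h.1, image_eq_zero_of_notMem_tsupport h.2]
    · rw [lintegral_const_mul' _ _ ENNReal.ofReal_ne_top, lintegral_add_left]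
      · exact (mul_le_mul_right (add_le_add (hsupp A hA hAm) (hsupp B hB hBm)) _).trans hη
      · exact ((measurable_const (a := (1:ℝ≥0∞))).indicator
          (isClosed_tsupport g).measurableSet).comp hA
  calc ∫⁻ x, ‖f (A x) - f (B x)‖ₑ
      ≤ ∫⁻ x, (‖f (A x) - g (A x)‖ₑ + ‖g (A x) - g (B x)‖ₑ + ‖f (B x) - g (B x)‖ₑ) := by
        refine lintegral_mono fun x => ?_
        have h1 : f (A x) - f (B x) = (f (A x) - g (A x)) + (g (A x) - g (B x)) -
          (f (B x) - g (B x)) := by ring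
        rw [h1]
        exact (enorm_sub_le).trans (add_le_add (enorm_add_le _ _) le_rfl)
    _ ≤ ε / 3 + ε / 3 + ε / 3 := by
        have hfA : Measurable fun x => ‖f (A x) - g (A x)‖ₑ := hfg.comp hA
        have hfB : Measurable fun x => ‖f (B x) - g (B x)‖ₑ := hfg.comp hB
        rw [lintegral_add_right _ hfB, lintegral_add_left hfA]
        exact add_le_add (add_le_add (hfirst A hA hAm) hmid) (hfirst B hB hBm)
    _ = ε := ENNReal.add_thirds ε

/-- The Lipschitz version of `exists_lintegral_comp_sub_comp_le`, for primitives of integrable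
functions. -/
theorem lintegral_comp_sub_comp_le {f g : ℝ → ℝ} (hg : Integrable g) {c : ℝ}
    (hfg : ∀ᵐ x, f x = c + ∫ s in (0:ℝ)..x, g s) {m : ℝ} (hm : 0 < m) {A B : ℝ → ℝ}
    (hA : Measurable A) (hB : Measurable B)
    (hAm : ∀ x y, m * |x - y| ≤ |A x - A y|) (hBm : ∀ x y, m * |x - y| ≤ |B x - B y|)
    {δ : ℝ} (hAB : ∀ x, |A x - B x| ≤ δ) :
    ∫⁻ x, ‖f (A x) - f (B x)‖ₑ ≤ ENNReal.ofReal (2 * m⁻¹ * δ) * ∫⁻ x, ‖g x‖ₑ := by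
  set G : ℝ → ℝ≥0∞ := fun s => ‖hg.1.mk g s‖ₑ with hG
  have hGm : Measurable G := hg.1.stronglyMeasurable_mk.measurable.enorm
  have hGg : ∀ᵐ s, G s = ‖g s‖ₑ := by
    filter_upwards [hg.1.ae_eq_mk] with s hs
    rw [hG, hs]
  have hae := (quasiMeasurePreserving_of_abs_lower hm hA hAm).ae hfg
  have hbe := (quasiMeasurePreserving_of_abs_lower hm hB hBm).ae hfg
  -- The increment of `f` is bounded by the integral of `|g|` between `B x` and `A x`, hence over
  -- the `s` with `(x, s) ∈ D`. After exchanging integrals, the set of `x` for each `s` is the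
  -- preimage under `A` of an interval of length `2 δ`.
  set D : Set (ℝ × ℝ) := {p | |A p.1 - p.2| ≤ δ} with hD
  have hDm : MeasurableSet D :=
    measurableSet_le (((hA.comp measurable_fst).sub measurable_snd).abs) measurable_const
  have hpt : ∀ᵐ x, ‖f (A x) - f (B x)‖ₑ ≤ ∫⁻ s, D.indicator (fun p => G p.2) (x, s) := by
    filter_upwards [hae, hbe] with x hx hy
    have h1 : f (A x) - f (B x) = ∫ s in (B x)..(A x), g s := by
      rw [hx, hy, add_sub_add_left_eq_sub, intervalIntegral.integral_interval_sub_left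
        hg.intervalIntegrable hg.intervalIntegrable]
    rw [h1, intervalIntegral.intervalIntegral_eq_integral_uIoc, enorm_smul]
    have h2 : ‖(if B x ≤ A x then (1:ℝ) else -1)‖ₑ = 1 := by split_ifs <;> simp
    rw [h2, one_mul]
    refine (enorm_integral_le_lintegral_enorm _).trans ?_
    rw [← lintegral_indicator measurableSet_uIoc]
    refine lintegral_mono_ae ?_
    filter_upwards [hGg] with s hs
    by_cases h : s ∈ uIoc (B x) (A x)
    · rw [indicator_of_mem h]
      have : (x, s) ∈ D := by
        change |A x - s| ≤ δ
        exact (abs_sub_right_of_mem_uIcc (uIoc_subset_uIcc h)).trans (hAB x)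
      rw [indicator_of_mem this, hs]
    · rw [indicator_of_notMem h]
      exact bot_le
  refine (lintegral_mono_ae hpt).trans ?_
  have hmeas : Measurable (D.indicator fun p => G p.2) := (hGm.comp measurable_snd).indicator hDm
  rw [lintegral_lintegral_swap (f := fun x s => D.indicator (fun p => G p.2) (x, s))
    hmeas.aemeasurable,
    ← lintegral_congr_ae hGg, ← lintegral_const_mul _ hGm]
  refine lintegral_mono fun s => ?_
  have h1 : ∀ x, D.indicator (fun p => G p.2) (x, s) =
      (Metric.closedBall s δ).indicator (fun _ => G s) (A x) := by
    intro x
    simp only [indicator, hD, mem_ofPred_eq, Metric.mem_closedBall, Real.dist_eq]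
  simp_rw [h1]
  refine (lintegral_comp_le hm hA hAm ((measurable_const (a := G s)).indicator
    Metric.isClosed_closedBall.measurableSet).aemeasurable).trans ?_
  rw [lintegral_indicator Metric.isClosed_closedBall.measurableSet, lintegral_const,
    Measure.restrict_apply_univ, Real.volume_closedBall, mul_comm (G s), ← mul_assoc,
    ← ENNReal.ofReal_mul (inv_nonneg.2 hm.le)]
  refine le_of_eq ?_
  congr 2
  ring

/-- A function with integrable weak derivative is a primitive. -/
theorem exists_ae_eq_primitive {f g : ℝ → ℝ} (hf : LocallyIntegrable f volume) (hg : Integrable g)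
    (h : ∀ φ : ℝ → ℝ, ContDiff ℝ ∞ φ → HasCompactSupport φ →
      ∫ x, deriv φ x * f x = - ∫ x, φ x * g x) :
    ∃ c, ∀ᵐ x, f x = c + ∫ s in (0:ℝ)..x, g s := by
  set G : ℝ → ℝ := fun x => ∫ s in (0:ℝ)..x, g s with hG
  have hGc : Continuous G := intervalIntegral.continuous_primitive
    (fun _ _ => hg.intervalIntegrable) 0
  -- The function minus the primitive has zero weak derivative, hence is constant. This needs
  -- integration by parts for the absolutely continuous primitive, on an interval containing the
  -- support of `φ` in its interior.
  suffices hw : ∀ φ : ℝ → ℝ, ContDiff ℝ ∞ φ → HasCompactSupport φ →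
      ∫ s, (f s - G s) * deriv φ s = 0 by
    obtain ⟨c, hc⟩ := exists_ae_eq_const_of_integral_mul_deriv
      (hf.sub hGc.locallyIntegrable) hw
    refine ⟨c, ?_⟩
    filter_upwards [hc] with x hx
    simp only [Pi.sub_apply] at hx
    linarith
  intro φ hφ hφc
  obtain ⟨R, hR⟩ := hφc.isCompact.isBounded.subset_closedBall (0 : ℝ)
  have hout : ∀ x, R < |x| → φ x = 0 ∧ deriv φ x = 0 := by
    intro x hx
    have hx' : x ∉ tsupport φ := fun h => by
      have := hR h
      rw [mem_closedBall_zero_iff, Real.norm_eq_abs] at this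
      linarith
    exact ⟨image_eq_zero_of_notMem_tsupport hx',
      image_eq_zero_of_notMem_tsupport fun h => hx' (tsupport_deriv_subset h)⟩
  set T : ℝ := |R| + 1 with hT
  have hRT : R < T := (le_abs_self R).trans_lt (lt_add_one _)
  have hTpos : 0 < T := by positivity
  have hfull : ∀ F : ℝ → ℝ, (∀ x, R < |x| → F x = 0) → ∫ x, F x = ∫ x in (-T)..T, F x := by
    intro F hF
    rw [intervalIntegral.integral_of_le (by linarith)]
    refine (setIntegral_eq_integral_of_forall_compl_eq_zero fun x hx => hF x ?_).symm
    rw [mem_Ioc, not_and_or, not_lt, not_le] at hx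
    rcases hx with hx | hx
    · exact lt_of_lt_of_le hRT (le_trans (by linarith) (neg_le_abs x))
    · exact hRT.trans (hx.trans_le (le_abs_self x))
  have hGac : AbsolutelyContinuousOnInterval G (-T) T :=
    (hg.intervalIntegrable (a := -T) (b := T)).absolutelyContinuousOnInterval_intervalIntegral
      (by rw [mem_uIcc]; left; constructor <;> linarith)
  obtain ⟨K, hK⟩ := (hφ.of_le (by simp : (1 : WithTop ℕ∞) ≤ (∞ : WithTop ℕ∞))).locallyLipschitz.locallyLipschitzOn.exists_lipschitzOnWith_of_compact
    (isCompact_uIcc (a := -T) (b := T))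
  have hparts := hGac.integral_mul_deriv_eq_deriv_mul hK.absolutelyContinuousOnInterval
  have hdG : ∀ᵐ x, deriv G x = g x := by
    filter_upwards [LocallyIntegrable.ae_hasDerivAt_integral hg.locallyIntegrable] with x hx
    exact (hx 0).deriv
  have hφT : φ T = 0 ∧ φ (-T) = 0 := by
    refine ⟨(hout T ?_).1, (hout (-T) ?_).1⟩
    · rwa [abs_of_pos hTpos]
    · rwa [abs_neg, abs_of_pos hTpos]
  rw [hφT.1, hφT.2, mul_zero, mul_zero, sub_zero, zero_sub,
    ← hfull (fun x => G x * deriv φ x) (fun x hx => by simp [(hout x hx).2]),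
    intervalIntegral.integral_congr_ae (g := fun x => φ x * g x)
      (hdG.mono fun x hx _ => by rw [hx, mul_comm]),
    ← hfull (fun x => φ x * g x) (fun x hx => by simp [(hout x hx).1])] at hparts
  have hdc : Continuous (deriv φ) := hφ.continuous_deriv (by simp)
  have hdcs : HasCompactSupport (deriv φ) := hφc.deriv
  have h1 : Integrable fun x => f x * deriv φ x := by
    simpa [mul_comm] using hf.integrable_smul_left_of_hasCompactSupport hdc hdcs
  have h2 : Integrable fun x => G x * deriv φ x :=
    (hGc.mul hdc).integrable_of_hasCompactSupport hdcs.mul_left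
  simp_rw [sub_mul]
  rw [integral_sub h1 h2, hparts]
  have := h φ hφ hφc
  simp_rw [mul_comm (deriv φ _)] at this
  rw [this]
  ring

/-- `ε` bounds the `L¹` distance of the compositions of `f` with two maps at distance `δ` which do
not contract distances by more than a factor `m`. -/
def CompModulus (m : ℝ) (f : ℝ → ℝ) (δ : ℝ) (ε : ℝ≥0∞) : Prop :=
  ∀ A B : ℝ → ℝ, Measurable A → Measurable B →
    (∀ x y, m * |x - y| ≤ |A x - A y|) → (∀ x y, m * |x - y| ≤ |B x - B y|) →
    (∀ x, |A x - B x| ≤ δ) → ∫⁻ x, ‖f (A x) - f (B x)‖ₑ ≤ ε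

theorem eventually_compModulus {f : ℝ → ℝ} (hf : Measurable f) (hfi : Integrable f)
    {m : ℝ} (hm : 0 < m) {ε : ℝ≥0∞} (hε : ε ≠ 0) :
    ∀ᶠ δ in 𝓝[>] (0:ℝ), CompModulus m f δ ε := by
  obtain ⟨δ, hδ, h⟩ := exists_lintegral_comp_sub_comp_le hf hfi hm hε
  filter_upwards [mem_nhdsWithin_of_mem_nhds (Iic_mem_nhds hδ)] with δ' hδ' A B hA hB hAm hBm hAB
  exact h A B hA hB hAm hBm fun x => (hAB x).trans hδ'

theorem eLpNorm_one_le_sum {n : ℕ} {u : ℝ → State n} (hu : Measurable u) :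
    eLpNorm u 1 volume ≤ ∑ i, ∫⁻ x, ‖u x i‖ₑ := by
  rw [eLpNorm_one_eq_lintegral_enorm, ← lintegral_finsetSum]
  · refine lintegral_mono fun x => ?_
    rw [enorm_eq_nnnorm]
    have : ‖u x‖₊ ≤ ∑ i, ‖u x i‖₊ :=
      Finset.sup_le fun i _ => Finset.single_le_sum (f := fun i => ‖u x i‖₊)
        (fun _ _ => bot_le) (Finset.mem_univ i)
    calc (‖u x‖₊ : ℝ≥0∞) ≤ ((∑ i, ‖u x i‖₊ : ℝ≥0) : ℝ≥0∞) := by exact_mod_cast this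
      _ = ∑ i, ‖u x i‖ₑ := by push_cast; rfl
  · intro i _
    exact ((measurable_pi_apply i).comp hu).enorm

theorem lintegral_enorm_apply_le {n : ℕ} (u : ℝ → State n) (i : Fin n) :
    ∫⁻ x, ‖u x i‖ₑ ≤ eLpNorm u 1 volume := by
  rw [eLpNorm_one_eq_lintegral_enorm]
  refine lintegral_mono fun x => ?_
  rw [enorm_eq_nnnorm, enorm_eq_nnnorm]
  exact ENNReal.coe_le_coe.2 (nnnorm_le_pi_nnnorm (u x) i)

/-! ### Continuity in time and stability of the explicit solution. -/

namespace BlockSystem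
variable {n : ℕ} (S : BlockSystem n) {w₀ : ℝ → State n}

/-- The foot at `t = 0` of the characteristic of the `i`th family through `(t, x)`. -/
noncomputable def foot (w₀ : ℝ → State n) (t : ℝ) (i : Fin n) (x : ℝ) : ℝ :=
  S.pos₀ w₀ (S.massAt w₀ t x - S.c (S.block i) * t)

theorem sol_apply (t x : ℝ) (i : Fin n) : S.sol w₀ t x i = w₀ (S.foot w₀ t i x) i := rfl

theorem continuous_foot (hw₀ : Measurable w₀) (t : ℝ) (i : Fin n) :
    Continuous (S.foot w₀ t i) :=
  (S.biLip_pos₀ hw₀).continuous.comp ((S.biLip_massAt hw₀ t).continuous.sub continuous_const)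

/-- A lower bound of the distortion of the maps `pos₀` and `foot`. -/
noncomputable def distortion : ℝ := min S.m (S.m * S.M⁻¹)

theorem distortion_pos : 0 < S.distortion :=
  lt_min S.m_pos (mul_pos S.m_pos (inv_pos.2 S.M_pos))

/-- The foot map is a composition of `massAt`, with slope at least `1/M`, a translation, and `pos₀`,
with slope at least `m`. Neither constant depends on `t` or on the data, which makes the stability
estimates uniform in time. -/
theorem abs_foot_lower (hw₀ : Measurable w₀) (t : ℝ) (i : Fin n) (x y : ℝ) :
    S.distortion * |x - y| ≤ |S.foot w₀ t i x - S.foot w₀ t i y| := by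
  refine le_trans ?_ ((S.biLip_pos₀ hw₀).abs_lower _ _)
  rw [sub_sub_sub_cancel_right]
  refine le_trans ?_ (mul_le_mul_of_nonneg_left ((S.biLip_massAt hw₀ t).abs_lower x y) S.m_pos.le)
  rw [← mul_assoc]
  exact mul_le_mul_of_nonneg_right (min_le_right _ _) (abs_nonneg _)

theorem abs_pos₀_lower (hw₀ : Measurable w₀) (x y : ℝ) :
    S.distortion * |x - y| ≤ |S.pos₀ w₀ x - S.pos₀ w₀ y| :=
  (mul_le_mul_of_nonneg_right (min_le_left _ _) (abs_nonneg _)).trans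
    ((S.biLip_pos₀ hw₀).abs_lower _ _)

theorem measurable_sol_apply (hw₀ : Measurable w₀) (t : ℝ) : Measurable (S.sol w₀ t) :=
  Measurable.comp (g := fun p : ℝ × ℝ => S.sol w₀ p.1 p.2) (f := fun x => (t, x))
    (S.measurable_sol hw₀) measurable_prodMk_left

theorem memLp_sol (hw₀ : Measurable w₀) (hi : MemLp w₀ 1 volume) (t : ℝ) :
    MemLp (S.sol w₀ t) 1 volume := by
  have hm : Measurable (S.sol w₀ t) := S.measurable_sol_apply hw₀ t
  refine ⟨hm.aestronglyMeasurable, (eLpNorm_one_le_sum hm).trans_lt ?_⟩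
  refine ENNReal.sum_lt_top.2 fun i _ => ?_
  simp only [sol_apply]
  have hmi : Measurable fun x => ‖w₀ x i‖ₑ := ((measurable_pi_apply i).comp hw₀).enorm
  refine (lintegral_comp_le S.distortion_pos (S.continuous_foot hw₀ t i).measurable
    (S.abs_foot_lower hw₀ t i) hmi.aemeasurable).trans_lt ?_
  exact ENNReal.mul_lt_top ENNReal.ofReal_lt_top ((lintegral_enorm_apply_le w₀ i).trans_lt hi.2)

theorem integrable_apply (hi : MemLp w₀ 1 volume) (i : Fin n) : Integrable fun x => w₀ x i :=
  (memLp_one_iff_integrable.1 hi).eval i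

/-- Each component is a fixed integrable function composed with the foot map, and the foot moves by
at most a multiple of `|t - s|`, uniformly in `x`. -/
theorem tendsto_sol (hw₀ : Measurable w₀) (hi : MemLp w₀ 1 volume) (s : ℝ) :
    Tendsto (fun t => eLpNorm (fun x => S.sol w₀ t x - S.sol w₀ s x) 1 volume) (𝓝 s) (𝓝 0) := by
  have hm : ∀ t, Measurable (S.sol w₀ t) :=
    S.measurable_sol_apply hw₀
  have hcomp : ∀ i, Tendsto (fun t => ∫⁻ x, ‖S.sol w₀ t x i - S.sol w₀ s x i‖ₑ) (𝓝 s) (𝓝 0) := by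
    intro i
    rw [ENNReal.tendsto_nhds_zero]
    intro ε hε
    obtain ⟨δ, hδ, hmod⟩ := exists_lintegral_comp_sub_comp_le
      ((measurable_pi_apply i).comp hw₀) (integrable_apply hi i) S.distortion_pos hε.ne'
    set C : ℝ := S.M * (S.m⁻¹ * S.velBound 0 + |S.c (S.block i)|) with hC
    have hlim : Tendsto (fun t => C * |t - s|) (𝓝 s) (𝓝 0) := by
      have : Continuous fun t => C * |t - s| := by fun_prop
      simpa using this.tendsto s
    filter_upwards [hlim.eventually (Iic_mem_nhds hδ)] with t ht
    refine hmod _ _ (S.continuous_foot hw₀ t i).measurable (S.continuous_foot hw₀ s i).measurable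
      (S.abs_foot_lower hw₀ t i) (S.abs_foot_lower hw₀ s i) fun x => le_trans ?_ ht
    refine ((S.biLip_pos₀ hw₀).abs_upper _ _).trans ?_
    rw [hC, mul_assoc]
    refine mul_le_mul_of_nonneg_left ?_ S.M_pos.le
    have h1 : S.massAt w₀ t x - S.c (S.block i) * t - (S.massAt w₀ s x - S.c (S.block i) * s) =
        (S.massAt w₀ t x - S.massAt w₀ s x) - S.c (S.block i) * (t - s) := by ring
    rw [h1, add_mul, mul_assoc]
    refine (abs_sub _ _).trans (add_le_add (S.abs_massAt_sub_le hw₀ t s x) (abs_mul _ _).le)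
  have hsum := tendsto_finsetSum Finset.univ fun i (_ : i ∈ Finset.univ) => hcomp i
  rw [Finset.sum_const_zero] at hsum
  refine tendsto_of_tendsto_of_tendsto_of_le_of_le tendsto_const_nhds hsum (fun _ => bot_le)
    fun t => ?_
  exact eLpNorm_one_le_sum ((hm t).sub (hm s))

theorem isL1Continuous_sol (hw₀ : Measurable w₀) (hi : MemLp w₀ 1 volume) :
    IsL1Continuous (S.sol w₀) :=
  ⟨fun t _ => S.memLp_sol hw₀ hi t,
    fun s _ => (S.tendsto_sol hw₀ hi s).mono_left nhdsWithin_le_nhds⟩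

theorem abs_vol_sub_le (w w' : State n) : |S.vol w - S.vol w'| ≤ S.s * S.L * ‖w - w'‖ := by
  rw [vol, vol, ← Finset.sum_sub_distrib]
  refine (Finset.abs_sum_le_sum_abs _ _).trans ?_
  refine (Finset.sum_le_sum fun p _ => (S.lipschitz p).dist_le_mul w w').trans ?_
  rw [dist_eq_norm]
  simp [mul_assoc]

/-- A Lipschitz constant of `N = 1 / vol`. -/
noncomputable def densLip : ℝ := S.s * S.L * (S.m⁻¹ * S.m⁻¹)

theorem densLip_nonneg : 0 ≤ S.densLip := by
  have := S.m_pos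
  unfold densLip
  positivity

theorem abs_inv_vol_sub_le (w w' : State n) :
    |(S.vol w)⁻¹ - (S.vol w')⁻¹| ≤ S.densLip * ‖w - w'‖ := by
  have h1 := S.vol_pos w
  have h2 := S.vol_pos w'
  have h3 : (S.vol w)⁻¹ - (S.vol w')⁻¹ = (S.vol w' - S.vol w) * ((S.vol w)⁻¹ * (S.vol w')⁻¹) := by
    field_simp
  rw [h3, abs_mul, abs_of_pos (a := (S.vol w)⁻¹ * (S.vol w')⁻¹) (by positivity), abs_sub_comm]
  calc |S.vol w - S.vol w'| * ((S.vol w)⁻¹ * (S.vol w')⁻¹)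
      ≤ (S.s * S.L * ‖w - w'‖) * (S.m⁻¹ * S.m⁻¹) :=
        mul_le_mul (S.abs_vol_sub_le w w')
          (mul_le_mul (S.inv_vol_bounds w).2 (S.inv_vol_bounds w').2 (by positivity)
            (inv_nonneg.2 S.m_pos.le)) (by positivity) (by positivity)
    _ = S.densLip * ‖w - w'‖ := by rw [densLip]; ring

section Stability
variable {w₁ w₂ : ℝ → State n} (h₁ : Measurable w₁) (h₂ : Measurable w₂)
include h₁ h₂

theorem abs_mass_sub_mass_le (hi : Integrable fun x => w₂ x - w₁ x) (x : ℝ) :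
    |S.mass w₂ x - S.mass w₁ x| ≤ S.densLip * ∫ x, ‖w₂ x - w₁ x‖ := by
  rw [mass, mass, ← intervalIntegral.integral_sub (S.intervalIntegrable_inv_vol h₂ _ _)
    (S.intervalIntegrable_inv_vol h₁ _ _), ← Real.norm_eq_abs]
  refine intervalIntegral.norm_integral_le_integral_norm_uIoc.trans ?_
  rw [← integral_const_mul]
  refine (setIntegral_mono_on (g := fun x => S.densLip * ‖w₂ x - w₁ x‖)
    ?_ (hi.norm.const_mul _).integrableOn measurableSet_uIoc
    fun s _ => S.abs_inv_vol_sub_le _ _).trans ?_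
  · exact (intervalIntegrable_iff.1 ((S.intervalIntegrable_inv_vol h₂ _ _).sub
      (S.intervalIntegrable_inv_vol h₁ _ _))).norm
  · exact setIntegral_le_integral (hi.norm.const_mul _)
      (Eventually.of_forall fun s => mul_nonneg S.densLip_nonneg (norm_nonneg _))

/-- The mass coordinate of the first datum at `pos₀ w₂ y` misses `y` by the difference of the two
mass coordinates; the slope of `mass`, at least `1/M`, bounds the displacement. -/
theorem abs_pos₀_sub_pos₀_le (hi : Integrable fun x => w₂ x - w₁ x) (y : ℝ) :
    |S.pos₀ w₂ y - S.pos₀ w₁ y| ≤ S.M * (S.densLip * ∫ x, ‖w₂ x - w₁ x‖) := by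
  have h := (S.biLip_mass h₁).abs_lower (S.pos₀ w₂ y) (S.pos₀ w₁ y)
  have h3 := S.abs_mass_sub_mass_le h₁ h₂ hi (S.pos₀ w₂ y)
  rw [pos₀, pos₀, (S.biLip_mass h₁).apply_inv, ← pos₀] at h
  rw [pos₀, (S.biLip_mass h₂).apply_inv, ← pos₀, abs_sub_comm] at h3
  rw [← pos₀] at h
  exact (inv_mul_le_iff₀ S.M_pos).1 (h.trans h3)

/-- Insert `w₁ ∘ A`. The change of data under one map costs the distortion; the change of map for
one datum costs its modulus. Only `w₁` needs a modulus, so `δ` can be chosen before `w₂`. -/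
theorem lintegral_comp_sub_le {δ : ℝ} {ε : ℝ≥0∞} {i : Fin n} {A B : ℝ → ℝ}
    (hmod : CompModulus S.distortion (fun x => w₁ x i) δ ε)
    (hA : Measurable A) (hB : Measurable B)
    (hAm : ∀ x y, S.distortion * |x - y| ≤ |A x - A y|)
    (hBm : ∀ x y, S.distortion * |x - y| ≤ |B x - B y|) (hAB : ∀ x, |A x - B x| ≤ δ) :
    ∫⁻ x, ‖w₂ (A x) i - w₁ (B x) i‖ₑ ≤
      ENNReal.ofReal S.distortion⁻¹ * eLpNorm (fun x => w₂ x - w₁ x) 1 volume + ε := by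
  have hm₁ : Measurable fun x => w₁ x i := (measurable_pi_apply i).comp h₁
  have hm₂ : Measurable fun x => w₂ x i := (measurable_pi_apply i).comp h₂
  have hd : Measurable fun x => ‖w₂ x i - w₁ x i‖ₑ := (hm₂.sub hm₁).enorm
  calc ∫⁻ x, ‖w₂ (A x) i - w₁ (B x) i‖ₑ
      ≤ ∫⁻ x, (‖w₂ (A x) i - w₁ (A x) i‖ₑ + ‖w₁ (A x) i - w₁ (B x) i‖ₑ) := by
        refine lintegral_mono fun x => ?_
        rw [← sub_add_sub_cancel (w₂ (A x) i) (w₁ (A x) i)]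
        exact enorm_add_le _ _
    _ = (∫⁻ x, ‖w₂ (A x) i - w₁ (A x) i‖ₑ) + ∫⁻ x, ‖w₁ (A x) i - w₁ (B x) i‖ₑ :=
        lintegral_add_left (f := fun x => ‖w₂ (A x) i - w₁ (A x) i‖ₑ) (hd.comp hA) _
    _ ≤ ENNReal.ofReal S.distortion⁻¹ * eLpNorm (fun x => w₂ x - w₁ x) 1 volume + ε := by
        have hAB' : ∫⁻ x, ‖w₁ (A x) i - w₁ (B x) i‖ₑ ≤ ε := hmod A B hA hB hAm hBm hAB
        refine add_le_add ?_ hAB'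
        refine (lintegral_comp_le S.distortion_pos hA hAm hd.aemeasurable).trans ?_
        exact mul_le_mul_right (lintegral_enorm_apply_le (fun x => w₂ x - w₁ x) i) _

/-- The drifts `κ t` cancel, and each primitive changes by at most `L` times the total `L¹`
distance, whatever the shift `c p * t`; hence the bound does not grow with `t`. -/
theorem abs_pos_sub_pos_le (hi : Integrable fun y => S.data w₂ y - S.data w₁ y) (t y : ℝ) :
    |S.pos w₂ t y - S.pos w₁ t y| ≤ S.s * S.L * ∫ y, ‖S.data w₂ y - S.data w₁ y‖ := by
  have hp : ∀ p z, |S.prim w₂ p z - S.prim w₁ p z| ≤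
      S.L * ∫ y, ‖S.data w₂ y - S.data w₁ y‖ := by
    intro p z
    rw [prim, prim, ← intervalIntegral.integral_sub (S.intervalIntegrable_η_data h₂ p _ _)
      (S.intervalIntegrable_η_data h₁ p _ _), ← Real.norm_eq_abs]
    refine intervalIntegral.norm_integral_le_integral_norm_uIoc.trans ?_
    rw [← integral_const_mul]
    refine (setIntegral_mono_on (g := fun y => S.L * ‖S.data w₂ y - S.data w₁ y‖)
      ?_ (hi.norm.const_mul _).integrableOn measurableSet_uIoc
      fun s _ => ?_).trans ?_
    · exact (intervalIntegrable_iff.1 ((S.intervalIntegrable_η_data h₂ p _ _).sub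
        (S.intervalIntegrable_η_data h₁ p _ _))).norm
    · rw [← dist_eq_norm, ← dist_eq_norm]
      exact (S.lipschitz p).dist_le_mul _ _
    · exact setIntegral_le_integral (hi.norm.const_mul _)
        (Eventually.of_forall fun s => mul_nonneg S.L.2 (norm_nonneg _))
  have h : S.pos w₂ t y - S.pos w₁ t y =
      ∑ p, (S.prim w₂ p (y - S.c p * t) - S.prim w₁ p (y - S.c p * t)) := by
    rw [Finset.sum_sub_distrib, pos, pos]
    ring
  rw [h]
  refine (Finset.abs_sum_le_sum_abs _ _).trans
    ((Finset.sum_le_sum fun p _ => hp p _).trans (le_of_eq ?_))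
  simp [mul_assoc]

theorem abs_massAt_sub_massAt_le (hi : Integrable fun y => S.data w₂ y - S.data w₁ y) (t x : ℝ) :
    |S.massAt w₂ t x - S.massAt w₁ t x| ≤
      S.m⁻¹ * (S.s * S.L * ∫ y, ‖S.data w₂ y - S.data w₁ y‖) := by
  have h := (S.biLip_pos h₁ t).abs_lower (S.massAt w₂ t x) (S.massAt w₁ t x)
  have h3 := S.abs_pos_sub_pos_le h₁ h₂ hi t (S.massAt w₂ t x)
  rw [massAt, massAt, (S.biLip_pos h₁ t).apply_inv, ← massAt] at h
  rw [massAt, (S.biLip_pos h₂ t).apply_inv, ← massAt, abs_sub_comm] at h3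
  rw [← massAt] at h
  exact (le_inv_mul_iff₀ S.m_pos).2 (h.trans h3)

/-- Stability of the solutions, in terms of the moduli of continuity of the composition with the
data `w₁`. -/
theorem lintegral_sol_sub_sol_le (hi₁ : MemLp w₁ 1 volume) (hi₂ : MemLp w₂ 1 volume)
    {d δ₁ δ₂ ε₁ : ℝ} {ε₂ : ℝ≥0∞} (hε₁ : 0 ≤ ε₁) (hd0 : 0 ≤ d)
    (hd : eLpNorm (fun x => w₂ x - w₁ x) 1 volume = ENNReal.ofReal d)
    (hδ₁ : S.M * (S.densLip * d) ≤ δ₁)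
    (hmod₁ : ∀ i, CompModulus S.distortion (fun x => w₁ x i) δ₁ (ENNReal.ofReal ε₁))
    (hδ₂ : S.M * (S.m⁻¹ * (S.s * S.L * (n * (S.distortion⁻¹ * d + ε₁)))) +
      S.M * (S.densLip * d) ≤ δ₂)
    (hmod₂ : ∀ i, CompModulus S.distortion (fun x => w₁ x i) δ₂ ε₂) (t : ℝ) (i : Fin n) :
    ∫⁻ x, ‖S.sol w₂ t x i - S.sol w₁ t x i‖ₑ ≤
      ENNReal.ofReal S.distortion⁻¹ * eLpNorm (fun x => w₂ x - w₁ x) 1 volume + ε₂ := by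
  have hi : Integrable fun x => w₂ x - w₁ x :=
    (memLp_one_iff_integrable.1 hi₂).sub (memLp_one_iff_integrable.1 hi₁)
  have hdi : ∫ x, ‖w₂ x - w₁ x‖ = d := by
    rw [integral_norm_eq_lintegral_enorm hi.1, ← eLpNorm_one_eq_lintegral_enorm, hd,
      ENNReal.toReal_ofReal hd0]
  have hpos₀ := S.abs_pos₀_sub_pos₀_le h₁ h₂ hi
  rw [hdi] at hpos₀
  have hdm : Measurable fun y => S.data w₂ y - S.data w₁ y :=
    (S.measurable_data h₂).sub (S.measurable_data h₁)
  -- First use of the modulus: the data are compared in mass coordinates, where they are composed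
  -- with the two maps `pos₀`.
  have hdata : eLpNorm (fun y => S.data w₂ y - S.data w₁ y) 1 volume ≤
      ENNReal.ofReal (n * (S.distortion⁻¹ * d + ε₁)) := by
    refine (eLpNorm_one_le_sum hdm).trans ?_
    refine (Finset.sum_le_sum fun i _ => S.lintegral_comp_sub_le h₁ h₂ (hmod₁ i)
      (S.biLip_pos₀ h₂).continuous.measurable (S.biLip_pos₀ h₁).continuous.measurable
      (S.abs_pos₀_lower h₂) (S.abs_pos₀_lower h₁) fun y => (hpos₀ y).trans hδ₁).trans ?_
    have := S.distortion_pos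
    rw [hd, ← ENNReal.ofReal_mul (by positivity), ← ENNReal.ofReal_add (by positivity) hε₁,
      Finset.sum_const, Finset.card_univ, Fintype.card_fin, nsmul_eq_mul,
      ENNReal.ofReal_mul (by positivity), ENNReal.ofReal_natCast]
  have hdataI : Integrable fun y => S.data w₂ y - S.data w₁ y :=
    memLp_one_iff_integrable.1 ⟨hdm.aestronglyMeasurable, hdata.trans_lt ENNReal.ofReal_lt_top⟩
  have hdata' : ∫ y, ‖S.data w₂ y - S.data w₁ y‖ ≤ n * (S.distortion⁻¹ * d + ε₁) := by
    rw [integral_norm_eq_lintegral_enorm hdataI.1, ← eLpNorm_one_eq_lintegral_enorm]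
    have := S.distortion_pos
    exact ENNReal.toReal_le_of_le_ofReal (by positivity) hdata
  refine S.lintegral_comp_sub_le h₁ h₂ (hmod₂ i) (S.continuous_foot h₂ t i).measurable
    (S.continuous_foot h₁ t i).measurable (S.abs_foot_lower h₂ t i) (S.abs_foot_lower h₁ t i)
    fun x => le_trans ?_ hδ₂
  -- The displacement of the foot comes from the change of mass coordinate at time `t`, through the
  -- Lipschitz map `pos₀ w₁`, and from the change of `pos₀` itself. The modulus at `δ₂` is its
  -- second use.
  have h4 : S.foot w₂ t i x - S.foot w₁ t i x =
      (S.pos₀ w₁ (S.massAt w₂ t x - S.c (S.block i) * t) -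
        S.pos₀ w₁ (S.massAt w₁ t x - S.c (S.block i) * t)) +
      (S.pos₀ w₂ (S.massAt w₂ t x - S.c (S.block i) * t) -
        S.pos₀ w₁ (S.massAt w₂ t x - S.c (S.block i) * t)) := by
    rw [foot, foot]
    ring
  change |S.foot w₂ t i x - S.foot w₁ t i x| ≤ _
  rw [h4]
  refine (abs_add_le _ _).trans (add_le_add ?_ (hpos₀ _))
  refine ((S.biLip_pos₀ h₁).abs_upper _ _).trans (mul_le_mul_of_nonneg_left ?_ S.M_pos.le)
  rw [sub_sub_sub_cancel_right]
  refine (S.abs_massAt_sub_massAt_le h₁ h₂ hdataI t x).trans ?_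
  have := S.m_pos
  gcongr

end Stability

end BlockSystem

/-! ### Lipschitz potentials of bounded divergence-free fields. -/

/-- The closed form `u dx - f dt`. -/
noncomputable def potentialForm (u f : ℝ × ℝ → ℝ) (p : ℝ × ℝ) : ℝ × ℝ →L[ℝ] ℝ :=
  u p • ContinuousLinearMap.snd ℝ ℝ ℝ - f p • ContinuousLinearMap.fst ℝ ℝ ℝ

theorem potentialForm_apply (u f : ℝ × ℝ → ℝ) (p v : ℝ × ℝ) :
    potentialForm u f p v = u p * v.2 - f p * v.1 := by
  simp [potentialForm]

/-- The potential of a smooth divergence-free field. -/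
theorem exists_smooth_potential {u f : ℝ × ℝ → ℝ} (hu : ContDiff ℝ ∞ u) (hf : ContDiff ℝ ∞ f)
    (h : ∀ p, fderiv ℝ u p (1, 0) + fderiv ℝ f p (0, 1) = 0) :
    ∃ Z : ℝ × ℝ → ℝ, ContDiff ℝ ∞ Z ∧ (∀ p, fderiv ℝ Z p = potentialForm u f p) ∧
      ∀ p, Z p = ∫ s in (0:ℝ)..1, (u (s • p) * p.2 - f (s • p) * p.1) := by
  have hω : ContDiff ℝ ∞ (potentialForm u f) :=
    (hu.smul contDiff_const).sub (hf.smul contDiff_const)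
  have hd : ∀ p, fderiv ℝ (potentialForm u f) p =
      (fderiv ℝ u p).smulRight (ContinuousLinearMap.snd ℝ ℝ ℝ) -
        (fderiv ℝ f p).smulRight (ContinuousLinearMap.fst ℝ ℝ ℝ) := by
    intro p
    have h1 := (hu.differentiable (by simp) p).hasFDerivAt.smul_const
      (ContinuousLinearMap.snd ℝ ℝ ℝ)
    have h2 := (hf.differentiable (by simp) p).hasFDerivAt.smul_const
      (ContinuousLinearMap.fst ℝ ℝ ℝ)
    exact (h1.sub h2).fderiv
  have hsplit : ∀ (L : ℝ × ℝ →L[ℝ] ℝ) (v : ℝ × ℝ), L v = v.1 * L (1, 0) + v.2 * L (0, 1) := by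
    intro L v
    have : v = v.1 • (1, 0) + v.2 • (0, 1) := by ext <;> simp
    conv_lhs => rw [this]
    rw [map_add, map_smul, map_smul, smul_eq_mul, smul_eq_mul]
  have hZ : ∀ p, HasFDerivAt (fun p => ∫ᶜ x in .segment 0 p, potentialForm u f x)
      (potentialForm u f p) p := by
    intro p
    rw [← hasFDerivWithinAt_univ]
    refine convex_univ.hasFDerivWithinAt_curveIntegral_segment_of_hasFDerivWithinAt_symmetric
      (dω := fderiv ℝ (potentialForm u f)) (fun x _ => ?_) (fun x _ v _ w _ => ?_) (mem_univ _)
      (mem_univ _)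
    · exact (hω.differentiable (by simp) x).hasFDerivAt.hasFDerivWithinAt
    · rw [hd]
      simp only [sub_apply, ContinuousLinearMap.smulRight_apply,
        smul_apply, ContinuousLinearMap.coe_snd', ContinuousLinearMap.coe_fst',
        smul_eq_mul]
      rw [hsplit (fderiv ℝ u x) v, hsplit (fderiv ℝ u x) w, hsplit (fderiv ℝ f x) v,
        hsplit (fderiv ℝ f x) w]
      -- The antisymmetric part of the derivative of the form is the divergence times the area form,
      -- so the form is closed.
      linear_combination (v.1 * w.2 - v.2 * w.1) * h x
  refine ⟨fun p => ∫ᶜ x in .segment 0 p, potentialForm u f x, ?_, fun p => (hZ p).fderiv, ?_⟩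
  · rw [contDiff_infty_iff_fderiv]
    refine ⟨fun p => (hZ p).differentiableAt, ?_⟩
    have : fderiv ℝ (fun p => ∫ᶜ x in .segment 0 p, potentialForm u f x) = potentialForm u f :=
      funext fun p => (hZ p).fderiv
    rw [this]
    exact hω
  · intro p
    change ∫ᶜ x in .segment 0 p, potentialForm u f x = _
    rw [curveIntegral_segment]
    refine intervalIntegral.integral_congr fun s _ => ?_
    simp [potentialForm_apply, AffineMap.lineMap_apply]

/-- `Z` is the potential of the bounded divergence-free field `(u, f)`, with smooth approximations
`Zs k`. -/
structure IsPotential (u f : ℝ × ℝ → ℝ) (Zs : ℕ → ℝ × ℝ → ℝ) (Z : ℝ × ℝ → ℝ) : Prop where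
  smooth : ∀ k, ContDiff ℝ ∞ (Zs k)
  fderiv_snd : ∀ k p, fderiv ℝ (Zs k) p (0, 1) = mollify volume k u p
  fderiv_fst : ∀ k p, fderiv ℝ (Zs k) p (1, 0) = -mollify volume k f p
  zero : ∀ k, Zs k 0 = 0
  tendsto : ∀ p, Tendsto (fun k => Zs k p) atTop (𝓝 (Z p))

theorem abs_mollify_le {f : ℝ × ℝ → ℝ} (hf : AEStronglyMeasurable f volume) {C : ℝ}
    (hC : ∀ᵐ p, |f p| ≤ C) (k : ℕ) (p : ℝ × ℝ) : |mollify volume k f p| ≤ C := by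
  have hl := locallyIntegrable_of_abs_le hf hC
  rw [abs_le]
  exact ⟨le_mollify hl (hC.mono fun p hp => (abs_le.1 hp).1) k p,
    mollify_le hl (hC.mono fun p hp => (abs_le.1 hp).2) k p⟩

theorem abs_sub_le_of_fderiv {Z : ℝ × ℝ → ℝ} (hZ : ContDiff ℝ ∞ Z) {C : ℝ}
    (h1 : ∀ p, |fderiv ℝ Z p (1, 0)| ≤ C) (h2 : ∀ p, |fderiv ℝ Z p (0, 1)| ≤ C) (p q : ℝ × ℝ) :
    |Z p - Z q| ≤ 2 * C * ‖p - q‖ := by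
  refine convex_univ.norm_image_sub_le_of_norm_fderiv_le (𝕜 := ℝ) (C := 2 * C)
    (fun x _ => hZ.differentiable (by simp) x) (fun x _ => ?_) (mem_univ q) (mem_univ p)
  have hC : 0 ≤ C := (abs_nonneg _).trans (h1 0)
  refine ContinuousLinearMap.opNorm_le_bound _ (by positivity) fun v => ?_
  have hv : v = v.1 • (1, 0) + v.2 • (0, 1) := by ext <;> simp
  have h3 : fderiv ℝ Z x v = v.1 * fderiv ℝ Z x (1, 0) + v.2 * fderiv ℝ Z x (0, 1) := by
    conv_lhs => rw [hv]
    rw [map_add, map_smul, map_smul, smul_eq_mul, smul_eq_mul]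
  rw [h3, Real.norm_eq_abs]
  calc |v.1 * fderiv ℝ Z x (1, 0) + v.2 * fderiv ℝ Z x (0, 1)|
      ≤ |v.1| * |fderiv ℝ Z x (1, 0)| + |v.2| * |fderiv ℝ Z x (0, 1)| := by
        rw [← abs_mul, ← abs_mul]
        exact abs_add_le _ _
    _ ≤ ‖v‖ * C + ‖v‖ * C :=
        add_le_add (mul_le_mul (norm_fst_le v) (h1 x) (abs_nonneg _) (norm_nonneg _))
          (mul_le_mul (norm_snd_le v) (h2 x) (abs_nonneg _) (norm_nonneg _))
    _ = 2 * C * ‖v‖ := by ring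

/-- A property which holds almost everywhere in the plane holds almost everywhere on almost every
line through the origin. -/
theorem ae_ae_smul {P : ℝ × ℝ → Prop} (h : ∀ᵐ p, P p) : ∀ᵐ p : ℝ × ℝ, ∀ᵐ s : ℝ, P (s • p) := by
  set T : Set (ℝ × ℝ) := toMeasurable volume {p | ¬ P p} with hT
  have hT0 : volume T = 0 := by rw [hT, measure_toMeasurable]; exact h
  have hTm : MeasurableSet T := measurableSet_toMeasurable _ _
  have hm : MeasurableSet {x : (ℝ × ℝ) × ℝ | x.2 • x.1 ∉ T} := by
    have : Measurable fun x : (ℝ × ℝ) × ℝ => x.2 • x.1 := by fun_prop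
    exact this hTm.compl
  have key : ∀ᵐ p : ℝ × ℝ, ∀ᵐ s : ℝ, s • p ∉ T := by
    rw [Measure.ae_ae_comm hm]
    have : ∀ᵐ s : ℝ, s ≠ 0 := by simp [ae_iff]
    filter_upwards [this] with s hs
    rw [ae_iff]
    simp only [not_not]
    change volume ((fun p => s • p) ⁻¹' T) = 0
    rw [Measure.addHaar_preimage_smul _ hs, hT0, mul_zero]
  filter_upwards [key] with p hp
  filter_upwards [hp] with s hs
  by_contra hP
  exact hs (subset_toMeasurable _ _ hP)

/-- The potentials of the mollified fields, normalized at the origin, are integrals along rays. On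
almost every ray the mollifications converge almost everywhere, so the potentials converge at almost
every point; their common Lipschitz constant extends convergence to every point. -/
theorem exists_potential {u f : ℝ × ℝ → ℝ} (hu : AEStronglyMeasurable u volume)
    (hf : AEStronglyMeasurable f volume) {C : ℝ} (huC : ∀ᵐ p, |u p| ≤ C) (hfC : ∀ᵐ p, |f p| ≤ C)
    (hdiv : ∀ φ : ℝ × ℝ → ℝ, ContDiff ℝ ∞ φ → HasCompactSupport φ →
      ∫ p, (u p * fderiv ℝ φ p (1, 0) + f p * fderiv ℝ φ p (0, 1)) = 0) :
    ∃ Zs Z, IsPotential u f Zs Z := by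
  have hul := locallyIntegrable_of_abs_le hu huC
  have hfl := locallyIntegrable_of_abs_le hf hfC
  have hdivk : ∀ k p, fderiv ℝ (mollify volume k u) p (1, 0) +
      fderiv ℝ (mollify volume k f) p (0, 1) = 0 := by
    intro k p
    rw [fderiv_mollify hul, fderiv_mollify hfl, ← neg_add, neg_eq_zero, ← integral_add]
    · exact hdiv _ (contDiff_testBump k p) (hasCompactSupport_testBump k p)
    · have h1 := ((contDiff_testBump (μ := volume) k p).continuous_fderiv (by simp)).clm_apply
        (continuous_const (y := ((1:ℝ), (0:ℝ))))
      have h2 : HasCompactSupport fun s => fderiv ℝ (fun s => (shrinkingBump (ℝ × ℝ) k).normed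
          volume (p - s)) s (1, 0) := (hasCompactSupport_testBump k p).fderiv_apply (𝕜 := ℝ) _
      simpa [mul_comm] using hul.integrable_smul_left_of_hasCompactSupport h1 h2
    · have h1 := ((contDiff_testBump (μ := volume) k p).continuous_fderiv (by simp)).clm_apply
        (continuous_const (y := ((0:ℝ), (1:ℝ))))
      have h2 : HasCompactSupport fun s => fderiv ℝ (fun s => (shrinkingBump (ℝ × ℝ) k).normed
          volume (p - s)) s (0, 1) := (hasCompactSupport_testBump k p).fderiv_apply (𝕜 := ℝ) _
      simpa [mul_comm] using hfl.integrable_smul_left_of_hasCompactSupport h1 h2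
  choose Zs hZs hdZ hZint using fun k => exists_smooth_potential (mollify_contDiff hul k)
    (mollify_contDiff hfl k) (hdivk k)
  have hsnd : ∀ k p, fderiv ℝ (Zs k) p (0, 1) = mollify volume k u p := by
    intro k p
    rw [hdZ, potentialForm_apply]
    simp
  have hfst : ∀ k p, fderiv ℝ (Zs k) p (1, 0) = -mollify volume k f p := by
    intro k p
    rw [hdZ, potentialForm_apply]
    simp
  have hlip : ∀ k p q, |Zs k p - Zs k q| ≤ 2 * C * ‖p - q‖ := by
    intro k
    refine abs_sub_le_of_fderiv (hZs k) (fun p => ?_) fun p => ?_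
    · rw [hfst, abs_neg]
      exact abs_mollify_le hf hfC k p
    · rw [hsnd]
      exact abs_mollify_le hu huC k p
  have hC0 : 0 ≤ C := by
    obtain ⟨p, hp⟩ := huC.exists
    exact (abs_nonneg _).trans hp
  have hae : ∀ᵐ p : ℝ × ℝ, CauchySeq fun k => Zs k p := by
    filter_upwards [ae_ae_smul (ae_tendsto_mollify hul), ae_ae_smul (ae_tendsto_mollify hfl)]
      with p h1 h2
    have hlim : Tendsto (fun k => ∫ s in (0:ℝ)..1, (mollify volume k u (s • p) * p.2 -
        mollify volume k f (s • p) * p.1)) atTop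
        (𝓝 (∫ s in (0:ℝ)..1, (u (s • p) * p.2 - f (s • p) * p.1))) := by
      refine intervalIntegral.tendsto_integral_filter_of_dominated_convergence
        (fun _ => C * |p.2| + C * |p.1|) (Eventually.of_forall fun k => ?_)
        (Eventually.of_forall fun k => Eventually.of_forall fun s _ => ?_) (by simp) ?_
      · have h3 := (mollify_contDiff hul k).continuous
        have h4 := (mollify_contDiff hfl k).continuous
        exact Continuous.aestronglyMeasurable (by fun_prop)
      · rw [Real.norm_eq_abs]
        refine (abs_sub _ _).trans ?_
        rw [abs_mul, abs_mul]
        exact add_le_add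
          (mul_le_mul_of_nonneg_right (abs_mollify_le hu huC k _) (abs_nonneg _))
          (mul_le_mul_of_nonneg_right (abs_mollify_le hf hfC k _) (abs_nonneg _))
      · filter_upwards [h1, h2] with s h3 h4 _
        exact (h3.mul_const _).sub (h4.mul_const _)
    simp_rw [← hZint] at hlim
    exact hlim.cauchySeq
  have hcauchy : ∀ p, CauchySeq fun k => Zs k p := by
    intro p
    rw [Metric.cauchySeq_iff]
    intro ε hε
    -- A good point `q` within `r` of `p` changes every `Zs k` by less than `ε / 3`; the `+ 1` keeps
    -- the divisor positive when `C = 0`.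
    set r : ℝ := ε / (3 * (2 * C + 1)) with hr
    have hr0 : 0 < r := by positivity
    have hdense : Dense {p : ℝ × ℝ | CauchySeq fun k => Zs k p} := Measure.dense_of_ae hae
    obtain ⟨q, hq, hqp⟩ := Metric.dense_iff.1 hdense p r hr0
    rw [Metric.mem_ball, dist_comm, dist_eq_norm] at hq
    obtain ⟨K, hK⟩ := Metric.cauchySeq_iff.1 hqp (ε / 3) (by positivity)
    refine ⟨K, fun i hi j hj => ?_⟩
    have h1 := hlip i p q
    have h2 := hlip j p q
    have h3 := hK i hi j hj
    rw [Real.dist_eq] at h3 ⊢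
    have h4 : 2 * C * ‖p - q‖ < ε / 3 := by
      calc 2 * C * ‖p - q‖ ≤ 2 * C * r := by gcongr
        _ < (2 * C + 1) * r := by nlinarith
        _ = ε / 3 := by rw [hr]; field_simp
    rw [abs_sub_comm] at h2
    have h5 : Zs i p - Zs j p = (Zs i p - Zs i q) + (Zs i q - Zs j q) + (Zs j q - Zs j p) := by ring
    rw [h5]
    refine (abs_add_three _ _ _).trans_lt ?_
    linarith
  choose Z hZ using fun p => cauchySeq_tendsto_of_complete (hcauchy p)
  exact ⟨Zs, Z, hZs, hsnd, hfst, fun k => by simp [hZint], hZ⟩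

namespace IsPotential
variable {u f : ℝ × ℝ → ℝ} {Zs : ℕ → ℝ × ℝ → ℝ} {Z : ℝ × ℝ → ℝ}

theorem abs_sub_le (hZ : IsPotential u f Zs Z) (hu : AEStronglyMeasurable u volume)
    (hf : AEStronglyMeasurable f volume) {C : ℝ} (huC : ∀ᵐ p, |u p| ≤ C) (hfC : ∀ᵐ p, |f p| ≤ C)
    (k : ℕ) (p q : ℝ × ℝ) : |Zs k p - Zs k q| ≤ 2 * C * ‖p - q‖ := by
  refine abs_sub_le_of_fderiv (hZ.smooth k) (fun p => ?_) (fun p => ?_) p q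
  · rw [hZ.fderiv_fst, abs_neg]
    exact abs_mollify_le hf hfC k p
  · rw [hZ.fderiv_snd]
    exact abs_mollify_le hu huC k p

theorem continuous (hZ : IsPotential u f Zs Z) (hu : AEStronglyMeasurable u volume)
    (hf : AEStronglyMeasurable f volume) {C : ℝ} (huC : ∀ᵐ p, |u p| ≤ C) (hfC : ∀ᵐ p, |f p| ≤ C) :
    Continuous Z := by
  have h : ∀ p q, |Z p - Z q| ≤ 2 * C * ‖p - q‖ := fun p q =>
    le_of_tendsto ((hZ.tendsto p).sub (hZ.tendsto q)).abs
      (Eventually.of_forall fun k => hZ.abs_sub_le hu hf huC hfC k p q)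
  have hC0 : 0 ≤ C := by
    obtain ⟨p, hp⟩ := huC.exists
    exact (abs_nonneg _).trans hp
  have : LipschitzWith (2 * C).toNNReal Z := LipschitzWith.of_dist_le_mul fun p q => by
    rw [Real.coe_toNNReal _ (by positivity), dist_eq_norm p q]
    exact h p q
  exact this.continuous

theorem zero_eq (hZ : IsPotential u f Zs Z) : Z 0 = 0 :=
  tendsto_nhds_unique (hZ.tendsto 0) (by simp [hZ.zero])

theorem sub_eq_integral (hZ : IsPotential u f Zs Z) (hul : LocallyIntegrable u volume)
    (k : ℕ) (t x y : ℝ) :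
    Zs k (t, y) - Zs k (t, x) = ∫ s in x..y, mollify volume k u (t, s) := by
  have hd : ∀ s, HasDerivAt (fun s => Zs k (t, s)) (mollify volume k u (t, s)) s := by
    intro s
    have h1 : HasDerivAt (fun s : ℝ => (t, s)) ((0:ℝ), (1:ℝ)) s :=
      (hasDerivAt_const s t).prodMk (hasDerivAt_id s)
    have h2 := ((hZ.smooth k).differentiable (by simp) (t, s)).hasFDerivAt.comp_hasDerivAt s h1
    rw [hZ.fderiv_snd] at h2
    exact h2
  have hc := (mollify_contDiff hul k).continuous
  exact (intervalIntegral.integral_eq_sub_of_hasDerivAt (fun s _ => hd s)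
    (Continuous.intervalIntegrable (by fun_prop) _ _)).symm

theorem biLip_approx (hZ : IsPotential u f Zs Z) (hul : LocallyIntegrable u volume) {m M : ℝ}
    (hm : 0 < m) (hmu : ∀ᵐ p, m ≤ u p) (huM : ∀ᵐ p, u p ≤ M) (k : ℕ) (t : ℝ) :
    BiLip m M fun x => Zs k (t, x) := by
  have hc := (mollify_contDiff hul k).continuous
  refine BiLip.of_integral hm (fun x y => Continuous.intervalIntegrable (by fun_prop) _ _)
    (Eventually.of_forall fun x => ⟨?_, ?_⟩) (hZ.sub_eq_integral hul k t)
  · exact le_mollify hul hmu k _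
  · exact mollify_le hul huM k _

theorem biLip (hZ : IsPotential u f Zs Z) (hul : LocallyIntegrable u volume) {m M : ℝ}
    (hm : 0 < m) (hmu : ∀ᵐ p, m ≤ u p) (huM : ∀ᵐ p, u p ≤ M) (t : ℝ) :
    BiLip m M fun x => Z (t, x) := by
  have hk := fun k => hZ.biLip_approx hul hm hmu huM k t
  exact ⟨hm, fun x y hxy => ge_of_tendsto ((hZ.tendsto (t, y)).sub (hZ.tendsto (t, x)))
      (Eventually.of_forall fun k => (hk k).lower x y hxy),
    fun x y hxy => le_of_tendsto ((hZ.tendsto (t, y)).sub (hZ.tendsto (t, x)))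
      (Eventually.of_forall fun k => (hk k).upper x y hxy)⟩

/-- Convergence of the mollifications almost everywhere in the plane restricts to almost every time
slice only, so a prescribed time such as `0` needs a separate argument. -/
theorem ae_sub_eq_integral (hZ : IsPotential u f Zs Z) (hu : AEStronglyMeasurable u volume)
    {C : ℝ} (huC : ∀ᵐ p, |u p| ≤ C) :
    ∀ᵐ t : ℝ, ∀ x y, Z (t, y) - Z (t, x) = ∫ s in x..y, u (t, s) := by
  have hul := locallyIntegrable_of_abs_le hu huC
  have h := ae_tendsto_mollify hul
  rw [Measure.volume_eq_prod] at h
  filter_upwards [Measure.ae_ae_of_ae_prod h] with t ht x y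
  refine tendsto_nhds_unique ((hZ.tendsto (t, y)).sub (hZ.tendsto (t, x))) ?_
  simp_rw [hZ.sub_eq_integral hul]
  refine intervalIntegral.tendsto_integral_filter_of_dominated_convergence
    (fun _ => C) (Eventually.of_forall fun k => ?_)
    (Eventually.of_forall fun k => Eventually.of_forall fun s _ => ?_) (by simp) ?_
  · have hc := (mollify_contDiff hul k).continuous
    exact Continuous.aestronglyMeasurable (by fun_prop)
  · exact abs_mollify_le hu huC k _
  · filter_upwards [ht] with s hs _
    rwa [Measure.volume_eq_prod]

end IsPotential

/-! ### Weak ordinary differential equations and extension across the initial time. -/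

/-- Maps of the lines `t = const` which do not contract distances are nonsingular on the half
plane. -/
theorem ae_prod_comp {μ : Measure ℝ} [SFinite μ] {f : ℝ → ℝ → ℝ}
    (hf : Measurable fun p : ℝ × ℝ => f p.1 p.2)
    {m : ℝ} (hm : 0 < m) (hlow : ∀ t x y, m * |x - y| ≤ |f t x - f t y|) {P : ℝ × ℝ → Prop}
    (h : ∀ᵐ p ∂(μ.prod volume), P p) : ∀ᵐ p ∂(μ.prod volume), P (p.1, f p.1 p.2) := by
  set T : Set (ℝ × ℝ) := toMeasurable (μ.prod volume) {p | ¬ P p} with hT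
  have hT0 : (μ.prod volume) T = 0 := by rw [hT, measure_toMeasurable]; exact h
  have hTm : MeasurableSet T := measurableSet_toMeasurable _ _
  have hm' : Measurable fun p : ℝ × ℝ => (p.1, f p.1 p.2) := measurable_fst.prodMk hf
  have h1 : (μ.prod volume) ((fun p : ℝ × ℝ => (p.1, f p.1 p.2)) ⁻¹' T) = 0 := by
    rw [Measure.measure_prod_null (hm' hTm)]
    rw [Measure.measure_prod_null hTm] at hT0
    filter_upwards [hT0] with t ht
    have hft : Measurable (f t) := Measurable.comp (g := fun p : ℝ × ℝ => f p.1 p.2)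
      (f := fun x => (t, x)) hf measurable_prodMk_left
    exact (quasiMeasurePreserving_of_abs_lower hm hft (hlow t)).preimage_null ht
  filter_upwards [measure_eq_zero_iff_ae_notMem.1 h1] with p hp
  by_contra hP
  exact hp (subset_toMeasurable _ _ hP)

theorem hasDerivAt_mk_left {φ : ℝ × ℝ → ℝ} (hφ : ContDiff ℝ ∞ φ) (t x : ℝ) :
    HasDerivAt (fun t => φ (t, x)) (fderiv ℝ φ (t, x) (1, 0)) t := by
  have h1 : HasDerivAt (fun t : ℝ => (t, x)) ((1:ℝ), (0:ℝ)) t :=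
    (hasDerivAt_id t).prodMk (hasDerivAt_const t x)
  exact (hφ.differentiable (by simp) (t, x)).hasFDerivAt.comp_hasDerivAt t h1

theorem continuous_fderiv_apply {φ : ℝ × ℝ → ℝ} (hφ : ContDiff ℝ ∞ φ) (v : ℝ × ℝ) :
    Continuous fun p => fderiv ℝ φ p v :=
  (hφ.continuous_fderiv (by simp)).clm_apply continuous_const

/-- Weak solutions of `∂_t r = s` are given by integration in `t`. -/
theorem ae_eq_of_weak_ode {r P s : ℝ × ℝ → ℝ} {r₀ : ℝ → ℝ} (hr : Measurable r) (hP : Measurable P)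
    (hs : Measurable s) {C : ℝ} (hsC : ∀ p, |s p| ≤ C)
    (hPs : ∀ t z, P (t, z) = r₀ z + ∫ τ in (0:ℝ)..t, s (τ, z))
    (hbd : ∀ R, ∃ B, ∀ p, ‖p‖ ≤ R → |r p| ≤ B ∧ |P p| ≤ B)
    (h : ∀ ζ : ℝ × ℝ → ℝ, ContDiff ℝ ∞ ζ → HasCompactSupport ζ →
      (∫ p in halfPlane, (r p * fderiv ℝ ζ p (1, 0) + s p * ζ p)) + ∫ z, r₀ z * ζ (0, z) = 0) :
    ∀ᵐ p ∂(volume.restrict halfPlane), r p = P p := by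
  classical
  -- Since `r` and `P` have the same source and initial values, those terms cancel, and the
  -- difference extended by zero has vanishing weak `t`-derivative on the whole plane.
  set q : ℝ × ℝ → ℝ := halfPlane.indicator fun p => r p - P p with hq
  have hqm : Measurable q := (hr.sub hP).indicator measurableSet_halfPlane
  have hql : LocallyIntegrable q volume := by
    refine locallyIntegrable_iff.2 fun K hK => ?_
    obtain ⟨R, hR⟩ := hK.isBounded.subset_closedBall (0 : ℝ × ℝ)
    obtain ⟨B, hB⟩ := hbd R
    refine Measure.integrableOn_of_bounded (M := B + B) hK.measure_lt_top.ne
      hqm.aestronglyMeasurable ?_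
    filter_upwards [ae_restrict_mem hK.measurableSet] with p hp
    have hpR : ‖p‖ ≤ R := by simpa using hR hp
    have h1 := hB p hpR
    have h0 : 0 ≤ B := (abs_nonneg _).trans h1.1
    rw [hq, indicator_apply, Real.norm_eq_abs]
    split_ifs
    · exact (abs_sub _ _).trans (add_le_add h1.1 h1.2)
    · simp [h0]
  have hzero := ae_eq_zero_of_integral_mul_fderiv hql ?_ ?_
  · rw [ae_restrict_iff' measurableSet_halfPlane]
    filter_upwards [hzero] with p hp hph
    rw [hq, indicator_of_mem hph] at hp
    linarith
  · intro ζ hζ hc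
    obtain ⟨C₁, R, hC₁, hR0, hζC, hζR⟩ := exists_test_bound hζ hc
    obtain ⟨B, hB⟩ := hbd R
    have hB0 : 0 ≤ B := (abs_nonneg _).trans (hB 0 (by simpa using hR0.le)).1
    have hζt : Measurable fun p => fderiv ℝ ζ p (1, 0) := (continuous_fderiv_apply hζ _).measurable
    have hint : ∀ F : ℝ × ℝ → ℝ, Measurable F → (∀ p, ‖p‖ ≤ R → |F p| ≤ B) →
        Integrable (fun p => F p * fderiv ℝ ζ p (1, 0)) volume := by
      intro F hF hFB
      refine integrable_of_abs_le_of_support (C := B * C₁) (R := R)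
        (hF.mul hζt).aestronglyMeasurable (Eventually.of_forall fun p => ?_)
        (Eventually.of_forall fun p hp => by rw [(hζR p hp).2]; simp)
      by_cases hp : ‖p‖ ≤ R
      · rw [abs_mul]
        exact mul_le_mul (hFB p hp) (hζC p).2.1 (abs_nonneg _) hB0
      · rw [(hζR p (not_le.1 hp)).2]
        simp only [zero_apply, mul_zero, abs_zero]
        positivity
    have hrI := hint r hr fun p hp => (hB p hp).1
    have hPI := hint P hP fun p hp => (hB p hp).2
    have hsI : Integrable (fun p => s p * ζ p) volume := by
      refine integrable_of_abs_le_of_support (C := C * C₁) (R := R)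
        (hs.mul hζ.continuous.measurable).aestronglyMeasurable (Eventually.of_forall fun p => ?_)
        (Eventually.of_forall fun p hp => by rw [(hζR p hp).1]; simp)
      rw [abs_mul]
      exact mul_le_mul (hsC p) (hζC p).1 (abs_nonneg _) ((abs_nonneg _).trans (hsC p))
    have h1 := h ζ hζ hc
    have h2 : (∫ p in halfPlane, (P p * fderiv ℝ ζ p (1, 0) + s p * ζ p)) =
        - ∫ z, r₀ z * ζ (0, z) := by
      have hI : Integrable (fun p => P p * fderiv ℝ ζ p (1, 0) + s p * ζ p)
          ((volume.restrict (Ioi (0:ℝ))).prod volume) := by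
        rw [← volume_restrict_halfPlane]
        exact (hPI.add hsI).restrict
      rw [volume_restrict_halfPlane, integral_prod_symm _ hI, ← integral_neg]
      refine integral_congr_ae (Eventually.of_forall fun z => ?_)
      -- For fixed `z`, evaluating this function along the curve `P(t, z)` makes its total
      -- derivative equal `P ∂_t ζ + s ζ`.
      have hφ : ContDiff ℝ ∞ fun p : ℝ × ℝ => p.2 * ζ (p.1, z) :=
        contDiff_snd.mul (hζ.comp (contDiff_fst.prodMk contDiff_const))
      have h3 := integral_fderiv_along (hφ.of_le (by simp)) (T := R + 1) (by positivity)
        (fun t x ht => by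
          have : R < ‖(t, z)‖ := by
            rw [Prod.norm_def, Real.norm_eq_abs]
            exact lt_of_lt_of_le (by linarith) ((le_abs_self t).trans (le_max_left _ _))
          simp [(hζR _ this).1])
        (ℓ := fun τ => s (τ, z)) (hs.comp measurable_prodMk_right) (fun t => hsC _)
        (γ := fun t => P (t, z)) (γ₀ := r₀ z) (fun t => hPs t z)
      simp only
      rw [← h3]
      refine integral_congr_ae (Eventually.of_forall fun t => ?_)
      have hd1 : fderiv ℝ (fun p : ℝ × ℝ => p.2 * ζ (p.1, z)) (t, P (t, z)) (1, 0) =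
          P (t, z) * fderiv ℝ ζ (t, z) (1, 0) := by
        have e1 := hasDerivAt_mk_left hφ t (P (t, z))
        have e2 := (hasDerivAt_mk_left hζ t z).const_mul (P (t, z))
        exact e1.unique e2
      have hd2 : fderiv ℝ (fun p : ℝ × ℝ => p.2 * ζ (p.1, z)) (t, P (t, z)) (0, 1) =
          ζ (t, z) := by
        have e0 : HasDerivAt (fun x : ℝ => (t, x)) ((0:ℝ), (1:ℝ)) (P (t, z)) :=
          (hasDerivAt_const _ t).prodMk (hasDerivAt_id _)
        have e1 := (hφ.differentiable (by simp) (t, P (t, z))).hasFDerivAt.comp_hasDerivAt _ e0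
        have e2 := (hasDerivAt_id (P (t, z))).mul_const (ζ (t, z))
        rw [one_mul] at e2
        exact e1.unique e2
      simp only
      rw [hd1, hd2]
    rw [integral_add hrI.restrict hsI.restrict] at h1
    rw [integral_add hPI.restrict hsI.restrict] at h2
    have h4 : ∀ p, q p * fderiv ℝ ζ p (1, 0) = halfPlane.indicator
        (fun p => r p * fderiv ℝ ζ p (1, 0) - P p * fderiv ℝ ζ p (1, 0)) p := by
      intro p
      rw [hq, indicator_apply, indicator_apply]
      split_ifs
      · ring
      · ring
    simp_rw [h4]
    rw [integral_indicator measurableSet_halfPlane, integral_sub hrI.restrict hPI.restrict]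
    linarith
  · refine Eventually.of_forall fun p hp => ?_
    rw [hq, indicator_of_notMem]
    rintro ⟨h1, -⟩
    exact absurd h1 (not_lt.2 hp.le)

/-- Extension of a conservation law to negative times by the initial data. -/
theorem integral_extension_eq_zero {u f : ℝ × ℝ → ℝ} {u₀ : ℝ → ℝ} (hu : Measurable u)
    (hf : Measurable f) (hu₀ : Measurable u₀) {C : ℝ} (huC : ∀ p, |u p| ≤ C) (hfC : ∀ p, |f p| ≤ C)
    (hu₀C : ∀ x, |u₀ x| ≤ C)
    (h : WeakConservationLaw (fun t x => u (t, x)) (fun t x => f (t, x)) u₀)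
    (φ : ℝ × ℝ → ℝ) (hφ : ContDiff ℝ ∞ φ) (hc : HasCompactSupport φ) :
    ∫ p, ((if 0 < p.1 then u p else u₀ p.2) * fderiv ℝ φ p (1, 0) +
      (if 0 < p.1 then f p else 0) * fderiv ℝ φ p (0, 1)) = 0 := by
  obtain ⟨C₁, R, hC₁, hR0, hφC, hφR⟩ := exists_test_bound hφ hc
  have hpm : MeasurableSet {p : ℝ × ℝ | 0 < p.1} := measurableSet_lt measurable_const measurable_fst
  have hum : Measurable fun p : ℝ × ℝ => if 0 < p.1 then u p else u₀ p.2 :=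
    Measurable.ite hpm hu (hu₀.comp measurable_snd)
  have hfm : Measurable fun p : ℝ × ℝ => if 0 < p.1 then f p else 0 :=
    Measurable.ite hpm hf measurable_const
  have hC0 : 0 ≤ C := (abs_nonneg _).trans (huC 0)
  have hint : ∀ (F : ℝ × ℝ → ℝ) (v : ℝ × ℝ), Measurable F → (∀ p, |F p| ≤ C) →
      (∀ p, |fderiv ℝ φ p v| ≤ C₁) → Integrable (fun p => F p * fderiv ℝ φ p v) volume := by
    intro F v hF hFC hv
    refine integrable_of_abs_le_of_support (C := C * C₁) (R := R)
      (hF.mul (continuous_fderiv_apply hφ v).measurable).aestronglyMeasurable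
      (Eventually.of_forall fun p => ?_)
      (Eventually.of_forall fun p hp => by rw [(hφR p hp).2]; simp)
    rw [abs_mul]
    exact mul_le_mul (hFC p) (hv p) (abs_nonneg _) hC0
  have hI1 := hint _ (1, 0) hum (fun p => by
    split_ifs
    · exact huC p
    · exact hu₀C _) fun p => (hφC p).2.1
  have hI2 := hint _ (0, 1) hfm (fun p => by
    split_ifs
    · exact hfC p
    · simpa using hC0) fun p => (hφC p).2.2
  have hh := h φ hφ hc
  have hI12 : Integrable (fun p : ℝ × ℝ => (if 0 < p.1 then u p else u₀ p.2) *
      fderiv ℝ φ p (1, 0) + (if 0 < p.1 then f p else 0) * fderiv ℝ φ p (0, 1)) := hI1.add hI2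
  rw [← integral_add_compl measurableSet_halfPlane hI12]
  have e1 : ∫ p in halfPlane, ((if 0 < p.1 then u p else u₀ p.2) * fderiv ℝ φ p (1, 0) +
      (if 0 < p.1 then f p else 0) * fderiv ℝ φ p (0, 1)) =
      ∫ p in halfPlane, (u p * fderiv ℝ φ p (1, 0) + f p * fderiv ℝ φ p (0, 1)) := by
    refine setIntegral_congr_fun measurableSet_halfPlane fun p hp => ?_
    have hp' : 0 < p.1 := hp.1
    simp only [hp', if_true]
  have e2 : ∫ p in halfPlaneᶜ, ((if 0 < p.1 then u p else u₀ p.2) * fderiv ℝ φ p (1, 0) +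
      (if 0 < p.1 then f p else 0) * fderiv ℝ φ p (0, 1)) =
      ∫ p in halfPlaneᶜ, u₀ p.2 * fderiv ℝ φ p (1, 0) := by
    refine setIntegral_congr_fun measurableSet_halfPlane.compl fun p hp => ?_
    have hp' : ¬ 0 < p.1 := fun h => hp ⟨h, mem_univ _⟩
    simp only [hp', if_false, zero_mul, add_zero]
  have hcompl : (volume : Measure (ℝ × ℝ)).restrict halfPlaneᶜ =
      (volume.restrict (Iic (0:ℝ))).prod volume := by
    have : halfPlaneᶜ = Iic (0:ℝ) ×ˢ (univ : Set ℝ) := by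
      ext p
      simp [halfPlane]
    rw [this, Measure.volume_eq_prod, ← Measure.prod_restrict, Measure.restrict_univ]
  -- The extension to `t ≤ 0` is constant in time, so integration in `t` leaves exactly the initial
  -- term.
  have e3 : ∫ p in halfPlaneᶜ, u₀ p.2 * fderiv ℝ φ p (1, 0) = ∫ x, u₀ x * φ (0, x) := by
    have hI3 := hint (fun p => u₀ p.2) (1, 0) (hu₀.comp measurable_snd) (fun p => hu₀C _)
      fun p => (hφC p).2.1
    have hI4 : Integrable (fun p : ℝ × ℝ => u₀ p.2 * fderiv ℝ φ p (1, 0))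
        ((volume.restrict (Iic (0:ℝ))).prod volume) := by
      rw [← hcompl]
      exact hI3.restrict
    rw [hcompl, integral_prod_symm _ hI4]
    refine integral_congr_ae (Eventually.of_forall fun x => ?_)
    simp only
    rw [integral_const_mul]
    congr 1
    have hfar : ∀ t : ℝ, t ∉ Metric.closedBall (0:ℝ) R → R < ‖(t, x)‖ := fun t ht =>
      lt_of_lt_of_le (by simpa using ht) (le_max_left _ _)
    have hslice : HasCompactSupport fun t => φ (t, x) :=
      HasCompactSupport.intro (isCompact_closedBall 0 R) fun t ht => (hφR _ (hfar t ht)).1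
    have hdslice : HasCompactSupport fun t => fderiv ℝ φ (t, x) (1, 0) :=
      HasCompactSupport.intro (isCompact_closedBall 0 R) fun t ht => by
        rw [(hφR _ (hfar t ht)).2]; rfl
    have := integral_Iic_of_hasDerivAt_of_tendsto' (a := (0:ℝ)) (m := 0)
      (fun t _ => hasDerivAt_mk_left hφ t x)
      (((continuous_fderiv_apply hφ (1, 0)).comp (by fun_prop : Continuous fun t : ℝ => (t, x))
        ).integrable_of_hasCompactSupport hdslice).integrableOn
      (hslice.is_zero_at_infty.mono_left atBot_le_cocompact)
    rw [this, sub_zero]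
  rw [e1, e2, e3]
  exact hh

/-! ### Mass coordinates of a weak solution and transport in them. -/

/-- A density `u`, bounded away from `0` and `∞`, which is transported with bounded flux `f`. -/
structure IsMassFlux (u f : ℝ × ℝ → ℝ) (u₀ : ℝ → ℝ) (m M C : ℝ) : Prop where
  measurable_density : Measurable u
  measurable_flux : Measurable f
  measurable_init : Measurable u₀
  pos : 0 < m
  lower : ∀ p, m ≤ u p
  upper : ∀ p, u p ≤ M
  lower_init : ∀ x, m ≤ u₀ x
  upper_init : ∀ x, u₀ x ≤ M
  le : M ≤ C
  flux_le : ∀ p, |f p| ≤ C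
  law : WeakConservationLaw (fun t x => u (t, x)) (fun t x => f (t, x)) u₀

/-- The density, extended to `t ≤ 0` by its initial values. -/
noncomputable def extDensity (u : ℝ × ℝ → ℝ) (u₀ : ℝ → ℝ) (p : ℝ × ℝ) : ℝ :=
  if 0 < p.1 then u p else u₀ p.2

/-- The flux, extended to `t ≤ 0` by `0`. -/
noncomputable def extFlux (f : ℝ × ℝ → ℝ) (p : ℝ × ℝ) : ℝ := if 0 < p.1 then f p else 0

namespace IsMassFlux
variable {u f : ℝ × ℝ → ℝ} {u₀ : ℝ → ℝ} {m M C : ℝ}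

theorem nonneg (h : IsMassFlux u f u₀ m M C) : 0 ≤ C :=
  (abs_nonneg _).trans (h.flux_le 0)

theorem abs_density_le (h : IsMassFlux u f u₀ m M C) (p : ℝ × ℝ) : |u p| ≤ C := by
  rw [abs_of_nonneg (h.pos.le.trans (h.lower p))]
  exact (h.upper p).trans h.le

theorem abs_init_le (h : IsMassFlux u f u₀ m M C) (x : ℝ) : |u₀ x| ≤ C := by
  rw [abs_of_nonneg (h.pos.le.trans (h.lower_init x))]
  exact (h.upper_init x).trans h.le

theorem measurable_extDensity (h : IsMassFlux u f u₀ m M C) : Measurable (extDensity u u₀) :=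
  Measurable.ite (measurableSet_lt measurable_const measurable_fst) h.measurable_density
    (h.measurable_init.comp measurable_snd)

theorem measurable_extFlux (h : IsMassFlux u f u₀ m M C) : Measurable (extFlux f) :=
  Measurable.ite (measurableSet_lt measurable_const measurable_fst) h.measurable_flux
    measurable_const

theorem lower_ext (h : IsMassFlux u f u₀ m M C) (p : ℝ × ℝ) : m ≤ extDensity u u₀ p := by
  rw [extDensity]
  split_ifs
  exacts [h.lower p, h.lower_init p.2]

theorem upper_ext (h : IsMassFlux u f u₀ m M C) (p : ℝ × ℝ) : extDensity u u₀ p ≤ M := by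
  rw [extDensity]
  split_ifs
  exacts [h.upper p, h.upper_init p.2]

theorem abs_ext_le (h : IsMassFlux u f u₀ m M C) (p : ℝ × ℝ) : |extDensity u u₀ p| ≤ C := by
  rw [abs_of_nonneg (h.pos.le.trans (h.lower_ext p))]
  exact (h.upper_ext p).trans h.le

theorem abs_extFlux_le (h : IsMassFlux u f u₀ m M C) (p : ℝ × ℝ) : |extFlux f p| ≤ C := by
  rw [extFlux]
  split_ifs
  · exact h.flux_le p
  · simpa using h.nonneg

theorem exists_isPotential (h : IsMassFlux u f u₀ m M C) :
    ∃ Zs Z, IsPotential (extDensity u u₀) (extFlux f) Zs Z :=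
  exists_potential h.measurable_extDensity.aestronglyMeasurable
    h.measurable_extFlux.aestronglyMeasurable (Eventually.of_forall h.abs_ext_le)
    (Eventually.of_forall h.abs_extFlux_le)
    (integral_extension_eq_zero h.measurable_density h.measurable_flux h.measurable_init
      h.abs_density_le h.flux_le h.abs_init_le h.law)

theorem locallyIntegrable_ext (h : IsMassFlux u f u₀ m M C) :
    LocallyIntegrable (extDensity u u₀) volume :=
  locallyIntegrable_of_abs_le h.measurable_extDensity.aestronglyMeasurable
    (Eventually.of_forall h.abs_ext_le)

variable {Zs : ℕ → ℝ × ℝ → ℝ} {Z : ℝ × ℝ → ℝ}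

theorem biLip (h : IsMassFlux u f u₀ m M C)
    (hZ : IsPotential (extDensity u u₀) (extFlux f) Zs Z) (t : ℝ) :
    BiLip m M fun x => Z (t, x) :=
  hZ.biLip h.locallyIntegrable_ext h.pos (Eventually.of_forall h.lower_ext)
    (Eventually.of_forall h.upper_ext) t

theorem biLip_approx (h : IsMassFlux u f u₀ m M C)
    (hZ : IsPotential (extDensity u u₀) (extFlux f) Zs Z) (k : ℕ) (t : ℝ) :
    BiLip m M fun x => Zs k (t, x) :=
  hZ.biLip_approx h.locallyIntegrable_ext h.pos (Eventually.of_forall h.lower_ext)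
    (Eventually.of_forall h.upper_ext) k t

theorem abs_approx_sub_le (h : IsMassFlux u f u₀ m M C)
    (hZ : IsPotential (extDensity u u₀) (extFlux f) Zs Z) (k : ℕ) (p q : ℝ × ℝ) :
    |Zs k p - Zs k q| ≤ 2 * C * ‖p - q‖ :=
  hZ.abs_sub_le h.measurable_extDensity.aestronglyMeasurable
    h.measurable_extFlux.aestronglyMeasurable (Eventually.of_forall h.abs_ext_le)
    (Eventually.of_forall h.abs_extFlux_le) k p q

theorem abs_sub_le (h : IsMassFlux u f u₀ m M C)
    (hZ : IsPotential (extDensity u u₀) (extFlux f) Zs Z) (p q : ℝ × ℝ) :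
    |Z p - Z q| ≤ 2 * C * ‖p - q‖ :=
  le_of_tendsto ((hZ.tendsto p).sub (hZ.tendsto q)).abs
    (Eventually.of_forall fun k => h.abs_approx_sub_le hZ k p q)

theorem continuous_potential (h : IsMassFlux u f u₀ m M C)
    (hZ : IsPotential (extDensity u u₀) (extFlux f) Zs Z) : Continuous Z :=
  hZ.continuous h.measurable_extDensity.aestronglyMeasurable
    h.measurable_extFlux.aestronglyMeasurable (Eventually.of_forall h.abs_ext_le)
    (Eventually.of_forall h.abs_extFlux_le)

theorem ae_sub_eq (h : IsMassFlux u f u₀ m M C)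
    (hZ : IsPotential (extDensity u u₀) (extFlux f) Zs Z) :
    ∀ᵐ t : ℝ, ∀ x y, Z (t, y) - Z (t, x) = ∫ s in x..y, extDensity u u₀ (t, s) :=
  hZ.ae_sub_eq_integral h.measurable_extDensity.aestronglyMeasurable
    (Eventually.of_forall h.abs_ext_le)

/-- For almost every `t ≤ 0` the extended density is `u₀`, and continuity of `Z` carries the
identity to `t = 0`. This is the purpose of extending the law to negative times. -/
theorem init_sub_eq (h : IsMassFlux u f u₀ m M C)
    (hZ : IsPotential (extDensity u u₀) (extFlux f) Zs Z) (x y : ℝ) :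
    Z (0, y) - Z (0, x) = ∫ s in x..y, u₀ s := by
  have hc := h.continuous_potential hZ
  have hae : (fun t => Z (t, y) - Z (t, x)) =ᵐ[volume.restrict (Iic (0:ℝ))]
      fun _ => ∫ s in x..y, u₀ s := by
    filter_upwards [ae_restrict_of_ae (h.ae_sub_eq hZ), ae_restrict_mem measurableSet_Iic]
      with t ht ht0
    rw [ht]
    refine intervalIntegral.integral_congr fun s _ => ?_
    simp only [extDensity, if_neg (not_lt.2 (mem_Iic.1 ht0))]
  exact Measure.eqOn_of_ae_eq hae (by fun_prop) (by fun_prop) (by simp) (mem_Iic.2 le_rfl)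

theorem init_eq (h : IsMassFlux u f u₀ m M C)
    (hZ : IsPotential (extDensity u u₀) (extFlux f) Zs Z) (x : ℝ) :
    Z (0, x) = ∫ s in (0:ℝ)..x, u₀ s := by
  have h0 : Z (0, 0) = 0 := hZ.zero_eq
  rw [← h.init_sub_eq hZ, h0, sub_zero]

/-- Outside a large ball the map `(t, Zs k - κ t)` leaves a given ball. -/
theorem lt_norm_approx (h : IsMassFlux u f u₀ m M C)
    (hZ : IsPotential (extDensity u u₀) (extFlux f) Zs Z) (κ : ℝ) {R : ℝ} (hR : 0 < R) (k : ℕ)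
    {p : ℝ × ℝ} (hp : R + m⁻¹ * (R + 2 * C * R + |κ| * R) < ‖p‖) :
    R < ‖(p.1, Zs k p - κ * p.1)‖ := by
  have hC := h.nonneg
  have hm := h.pos
  by_contra! hle
  have ht : |p.1| ≤ R := (le_max_left _ _).trans hle
  have hz : |Zs k p - κ * p.1| ≤ R := (le_max_right _ _).trans hle
  have h1 := (h.biLip_approx hZ k p.1).abs_lower p.2 0
  have h2 := h.abs_approx_sub_le hZ k (p.1, 0) 0
  rw [hZ.zero, sub_zero, sub_zero] at h2
  rw [sub_zero] at h1
  have h3 : ‖((p.1, 0) : ℝ × ℝ)‖ ≤ R := by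
    rw [Prod.norm_def]
    exact max_le ht (by simpa using hR.le)
  have h4 : |κ * p.1| ≤ |κ| * R := by
    rw [abs_mul]
    gcongr
  have h5 : m * |p.2| ≤ R + 2 * C * R + |κ| * R := by
    refine h1.trans ?_
    have e : Zs k (p.1, p.2) - Zs k (p.1, 0) =
        (Zs k p - κ * p.1) + (κ * p.1) - Zs k (p.1, 0) := by simp
    rw [e]
    refine (abs_sub _ _).trans ?_
    have h6 := abs_add_le (Zs k p - κ * p.1) (κ * p.1)
    have h7 : |Zs k (p.1, 0)| ≤ 2 * C * R := h2.trans (by gcongr)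
    linarith
  have h6 : |p.2| ≤ m⁻¹ * (R + 2 * C * R + |κ| * R) := by
    rw [← div_eq_inv_mul, le_div_iff₀ hm, mul_comm]
    exact h5
  have h7 : 0 ≤ m⁻¹ * (R + 2 * C * R + |κ| * R) := (abs_nonneg _).trans h6
  have h8 : ‖p‖ ≤ R + m⁻¹ * (R + 2 * C * R + |κ| * R) := by
    rw [Prod.norm_def]
    exact max_le (by rw [Real.norm_eq_abs]; linarith) (by rw [Real.norm_eq_abs]; linarith)
  linarith

end IsMassFlux

theorem fderiv_mul_comp {Z : ℝ × ℝ → ℝ} (hZ : ContDiff ℝ ∞ Z) {θ : ℝ → ℝ} (hθ : ContDiff ℝ ∞ θ)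
    {ζ : ℝ × ℝ → ℝ} (hζ : ContDiff ℝ ∞ ζ) (κ : ℝ) (p v : ℝ × ℝ) :
    fderiv ℝ (fun p : ℝ × ℝ => θ p.2 * ζ (p.1, Z p - κ * p.1)) p v =
      deriv θ p.2 * v.2 * ζ (p.1, Z p - κ * p.1) +
        θ p.2 * (v.1 * fderiv ℝ ζ (p.1, Z p - κ * p.1) (1, 0) +
          (fderiv ℝ Z p v - κ * v.1) * fderiv ℝ ζ (p.1, Z p - κ * p.1) (0, 1)) := by
  have h1 : HasFDerivAt (fun p : ℝ × ℝ => θ p.2)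
      (deriv θ p.2 • ContinuousLinearMap.snd ℝ ℝ ℝ) p :=
    (hθ.differentiable (by simp) p.2).hasDerivAt.comp_hasFDerivAt p hasFDerivAt_snd
  have h2 : HasFDerivAt (fun p : ℝ × ℝ => (p.1, Z p - κ * p.1))
      ((ContinuousLinearMap.fst ℝ ℝ ℝ).prod (fderiv ℝ Z p - κ • ContinuousLinearMap.fst ℝ ℝ ℝ))
      p :=
    hasFDerivAt_fst.prodMk ((hZ.differentiable (by simp) p).hasFDerivAt.sub
      (hasFDerivAt_fst.const_mul κ))
  have h3 := (hζ.differentiable (by simp) (p.1, Z p - κ * p.1)).hasFDerivAt.comp p h2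
  have h4 := (h1.mul h3).fderiv
  have hsplit : ∀ (L : ℝ × ℝ →L[ℝ] ℝ) (v : ℝ × ℝ), L v = v.1 * L (1, 0) + v.2 * L (0, 1) := by
    intro L v
    have : v = v.1 • (1, 0) + v.2 • (0, 1) := by ext <;> simp
    conv_lhs => rw [this]
    rw [map_add, map_smul, map_smul, smul_eq_mul, smul_eq_mul]
  have h5 : fderiv ℝ (fun p : ℝ × ℝ => θ p.2 * ζ (p.1, Z p - κ * p.1)) p v =
      θ p.2 * fderiv ℝ ζ (p.1, Z p - κ * p.1) (v.1, fderiv ℝ Z p v - κ * v.1) +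
      ζ (p.1, Z p - κ * p.1) * (deriv θ p.2 * v.2) := by
    change fderiv ℝ (fun p : ℝ × ℝ => θ p.2 * (ζ ∘ fun p => (p.1, Z p - κ * p.1)) p) p v = _
    erw [h4]
    simp
  rw [h5, hsplit (fderiv ℝ ζ _)]
  ring

namespace IsMassFlux
variable {u f : ℝ × ℝ → ℝ} {u₀ : ℝ → ℝ} {m M C : ℝ} {Zs : ℕ → ℝ × ℝ → ℝ} {Z : ℝ × ℝ → ℝ}

/-- A transported quantity `u g` with velocity `ℓ`, tested with functions of the mass
coordinate. -/
theorem integral_comp_potential (h : IsMassFlux u f u₀ m M C)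
    (hZ : IsPotential (extDensity u u₀) (extFlux f) Zs Z) {κ : ℝ} {g ℓ : ℝ × ℝ → ℝ} {g₀ : ℝ → ℝ}
    (hg : Measurable g) (hℓ : Measurable ℓ) (hg₀ : Measurable g₀) {G : ℝ} (hgG : ∀ p, |g p| ≤ G)
    (hg₀G : ∀ x, |g₀ x| ≤ G) {Λ : ℝ} (hℓΛ : ∀ p, |ℓ p| ≤ Λ) (hκ : ∀ p, u p * ℓ p = f p + κ)
    (hlaw : WeakConservationLaw (fun t x => u (t, x) * g (t, x))
      (fun t x => u (t, x) * ℓ (t, x) * g (t, x)) (fun x => u₀ x * g₀ x))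
    {θ : ℝ → ℝ} (hθ : ContDiff ℝ ∞ θ) {ζ : ℝ × ℝ → ℝ} (hζ : ContDiff ℝ ∞ ζ)
    (hc : HasCompactSupport ζ) :
    (∫ p in halfPlane, u p * (g p * θ p.2 * fderiv ℝ ζ (p.1, Z p - κ * p.1) (1, 0) +
        g p * ℓ p * deriv θ p.2 * ζ (p.1, Z p - κ * p.1))) +
      ∫ x, u₀ x * (g₀ x * θ x * ζ (0, Z (0, x))) = 0 := by
  obtain ⟨C₁, R, hC₁, hR0, hζC, hζR⟩ := exists_test_bound hζ hc
  have hC0 := h.nonneg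
  have hm := h.pos
  have hG0 : 0 ≤ G := (abs_nonneg _).trans (hg₀G 0)
  have hΛ0 : 0 ≤ Λ := (abs_nonneg _).trans (hℓΛ 0)
  -- All test functions below vanish outside the ball of radius `R'`, uniformly in `k`, which
  -- supplies the dominating functions. The cutoff comes from `ζ` alone, so `θ` may grow.
  set R' : ℝ := R + m⁻¹ * (R + 2 * C * R + |κ| * R) with hR'
  have hfar : ∀ k (p : ℝ × ℝ), R' < ‖p‖ → R < ‖(p.1, Zs k p - κ * p.1)‖ := fun k p hp =>
    h.lt_norm_approx hZ κ hR0 k hp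
  have hdθ : Continuous (deriv θ) := hθ.continuous_deriv (by simp)
  obtain ⟨Θ₁, hΘ₁⟩ := (isCompact_Icc (a := -R') (b := R')).exists_bound_of_continuousOn
    hθ.continuous.continuousOn
  obtain ⟨Θ₂, hΘ₂⟩ := (isCompact_Icc (a := -R') (b := R')).exists_bound_of_continuousOn
    hdθ.continuousOn
  set Θ : ℝ := max (max Θ₁ Θ₂) 0 with hΘ
  have hΘ0 : 0 ≤ Θ := le_max_right _ _
  have hθΘ : ∀ x, |x| ≤ R' → |θ x| ≤ Θ := fun x hx =>
    (hΘ₁ x (abs_le.1 hx)).trans ((le_max_left _ _).trans (le_max_left _ _))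
  have hdθΘ : ∀ x, |x| ≤ R' → |deriv θ x| ≤ Θ := fun x hx =>
    (hΘ₂ x (abs_le.1 hx)).trans ((le_max_right _ _).trans (le_max_left _ _))
  have hζt := continuous_fderiv_apply hζ (1, 0)
  have hζx := continuous_fderiv_apply hζ (0, 1)
  have hZsc : ∀ k, Continuous (Zs k) := fun k => (hZ.smooth k).continuous
  have hmk : ∀ k p, |mollify volume k (extDensity u u₀) p| ≤ C := fun k p =>
    abs_mollify_le h.measurable_extDensity.aestronglyMeasurable
      (Eventually.of_forall h.abs_ext_le) k p
  have hmfk : ∀ k p, |mollify volume k (extFlux f) p| ≤ C := fun k p =>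
    abs_mollify_le h.measurable_extFlux.aestronglyMeasurable
      (Eventually.of_forall h.abs_extFlux_le) k p
  have hmc : ∀ k, Continuous (mollify volume k (extDensity u u₀)) := fun k =>
    (mollify_contDiff (μ := volume) h.locallyIntegrable_ext k).continuous
  have hlf : LocallyIntegrable (extFlux f) volume :=
    locallyIntegrable_of_abs_le h.measurable_extFlux.aestronglyMeasurable
      (Eventually.of_forall h.abs_extFlux_le)
  have hmfc : ∀ k, Continuous (mollify volume k (extFlux f)) := fun k =>
    (mollify_contDiff (μ := volume) hlf k).continuous
  let A : ℕ → ℝ × ℝ → ℝ := fun k p => u p * g p * (θ p.2 *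
      (fderiv ℝ ζ (p.1, Zs k p - κ * p.1) (1, 0) +
        (-mollify volume k (extFlux f) p - κ) * fderiv ℝ ζ (p.1, Zs k p - κ * p.1) (0, 1))) +
    u p * ℓ p * g p * (deriv θ p.2 * ζ (p.1, Zs k p - κ * p.1) +
      θ p.2 * (mollify volume k (extDensity u u₀) p *
        fderiv ℝ ζ (p.1, Zs k p - κ * p.1) (0, 1)))
  have htest : ∀ k, (∫ p in halfPlane, A k p) +
      ∫ x, u₀ x * g₀ x * (θ x * ζ (0, Zs k (0, x))) = 0 := by
    intro k
    -- The potential itself is only Lipschitz; the smooth approximations make an admissible test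
    -- function, and the limit is taken afterwards.
    have h1 := hlaw (fun p => θ p.2 * ζ (p.1, Zs k p - κ * p.1))
      ((hθ.comp contDiff_snd).mul (hζ.comp (contDiff_fst.prodMk
        ((hZ.smooth k).sub (contDiff_const.mul contDiff_fst)))))
      (HasCompactSupport.intro (isCompact_closedBall 0 R') fun p hp => by
        rw [(hζR _ (hfar k p (by simpa using hp))).1, mul_zero])
    simp only [mul_zero, sub_zero] at h1
    refine Eq.trans ?_ h1
    congr 1
    refine integral_congr_ae (Eventually.of_forall fun p => ?_)
    simp only
    rw [fderiv_mul_comp (hZ.smooth k) hθ hζ, fderiv_mul_comp (hZ.smooth k) hθ hζ,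
      hZ.fderiv_fst, hZ.fderiv_snd]
    simp only [A]
    ring
  have hmapc : ∀ p : ℝ × ℝ, Tendsto (fun k => (p.1, Zs k p - κ * p.1)) atTop
      (𝓝 (p.1, Z p - κ * p.1)) := fun p =>
    tendsto_const_nhds.prodMk_nhds ((hZ.tendsto p).sub tendsto_const_nhds)
  have hlim1 : Tendsto (fun k => ∫ p in halfPlane, A k p) atTop
      (𝓝 (∫ p in halfPlane, u p * (g p * θ p.2 * fderiv ℝ ζ (p.1, Z p - κ * p.1) (1, 0) +
        g p * ℓ p * deriv θ p.2 * ζ (p.1, Z p - κ * p.1)))) := by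
    refine tendsto_integral_of_dominated_convergence
      ((Metric.closedBall (0 : ℝ × ℝ) R').indicator fun _ =>
        C * G * (Θ * (C₁ + (C + |κ|) * C₁)) + C * Λ * G * (Θ * C₁ + Θ * (C * C₁)))
      (fun k => ?_) ?_ (fun k => Eventually.of_forall fun p => ?_) ?_
    · have c1 : Continuous fun p : ℝ × ℝ => (p.1, Zs k p - κ * p.1) := by
        have := hZsc k
        fun_prop
      have c2 := hζt.comp c1
      have c3 := hζx.comp c1
      have c4 := hζ.continuous.comp c1
      have c5 := hmc k
      have c6 := hmfc k
      have c7 := hθ.continuous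
      refine (((h.measurable_density.mul hg).mul (Continuous.measurable ?_)).add
        (((h.measurable_density.mul hℓ).mul hg).mul (Continuous.measurable ?_))
        ).aestronglyMeasurable
      · exact (c7.comp continuous_snd).mul (c2.add ((c6.neg.sub continuous_const).mul c3))
      · exact ((hdθ.comp continuous_snd).mul c4).add
          ((c7.comp continuous_snd).mul (c5.mul c3))
    · refine ((integrable_indicator_iff Metric.isClosed_closedBall.measurableSet).2 ?_).restrict
      exact integrableOn_const (isCompact_closedBall 0 R').measure_lt_top.ne
    · by_cases hp : p ∈ Metric.closedBall (0 : ℝ × ℝ) R'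
      · rw [indicator_of_mem hp, Real.norm_eq_abs]
        have hpR : ‖p‖ ≤ R' := by simpa using hp
        have hp2 : |p.2| ≤ R' := (le_max_right _ _).trans hpR
        have b1 := hθΘ _ hp2
        have b2 := hdθΘ _ hp2
        obtain ⟨b3, b4, b5⟩ := hζC (p.1, Zs k p - κ * p.1)
        have b6 := h.abs_density_le p
        have b7 := hgG p
        have b8 := hℓΛ p
        have b9 : |-mollify volume k (extFlux f) p - κ| ≤ C + |κ| :=
          (abs_sub _ _).trans (by rw [abs_neg]; gcongr; exact hmfk k p)
        have b10 := hmk k p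
        simp only [A]
        refine (abs_add_le _ _).trans ?_
        have e1 := abs_add_le (fderiv ℝ ζ (p.1, Zs k p - κ * p.1) (1, 0))
          ((-mollify volume k (extFlux f) p - κ) * fderiv ℝ ζ (p.1, Zs k p - κ * p.1) (0, 1))
        have e2 := abs_add_le (deriv θ p.2 * ζ (p.1, Zs k p - κ * p.1)) (θ p.2 *
          (mollify volume k (extDensity u u₀) p * fderiv ℝ ζ (p.1, Zs k p - κ * p.1) (0, 1)))
        simp only [abs_mul] at e1 e2 ⊢
        refine add_le_add ?_ ?_
        · refine mul_le_mul (by gcongr) ?_ (by positivity) (by positivity)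
          refine mul_le_mul b1 (e1.trans ?_) (abs_nonneg _) hΘ0
          gcongr
        · refine mul_le_mul (by gcongr) (e2.trans ?_) (abs_nonneg _) (by positivity)
          gcongr
      · rw [indicator_of_notMem hp]
        obtain ⟨z1, z2⟩ := hζR _ (hfar k p (by simpa using hp))
        simp [A, z1, z2]
    · filter_upwards [ae_restrict_of_ae (ae_tendsto_mollify h.locallyIntegrable_ext),
        ae_restrict_of_ae (ae_tendsto_mollify hlf), ae_restrict_mem measurableSet_halfPlane]
        with p h1 h2 hp
      have hp0 : 0 < p.1 := hp.1
      rw [extDensity, if_pos hp0] at h1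
      rw [extFlux, if_pos hp0] at h2
      have t1 := (hζt.tendsto _).comp (hmapc p)
      have t2 := (hζx.tendsto _).comp (hmapc p)
      have t3 := (hζ.continuous.tendsto _).comp (hmapc p)
      have t5 := (((t1.add ((h2.neg.sub_const κ).mul t2)).const_mul (θ p.2)).const_mul
        (u p * g p)).add (((t3.const_mul (deriv θ p.2)).add
          ((h1.mul t2).const_mul (θ p.2))).const_mul (u p * ℓ p * g p))
      refine t5.congr' (Eventually.of_forall fun k => rfl) |>.trans_eq ?_
      congr 1
      -- In the limit the coefficient of `∂_y ζ` is `u g θ (u ℓ - f - κ)`, zero by `hκ`: no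
      -- derivative along the mass coordinate survives.
      linear_combination
        (u p * g p * θ p.2 * fderiv ℝ ζ (p.1, Z p - κ * p.1) (0, 1)) * hκ p
  have hlim2 : Tendsto (fun k => ∫ x, u₀ x * g₀ x * (θ x * ζ (0, Zs k (0, x)))) atTop
      (𝓝 (∫ x, u₀ x * (g₀ x * θ x * ζ (0, Z (0, x))))) := by
    refine tendsto_integral_of_dominated_convergence
      ((Metric.closedBall (0 : ℝ) R').indicator fun _ => C * G * (Θ * C₁))
      (fun k => ?_) ?_ (fun k => Eventually.of_forall fun x => ?_)
      (Eventually.of_forall fun x => ?_)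
    · have := hZsc k
      have c1 := hζ.continuous.comp (by fun_prop : Continuous fun x : ℝ => ((0:ℝ), Zs k (0, x)))
      exact ((h.measurable_init.mul hg₀).mul
        (hθ.continuous.mul c1).measurable).aestronglyMeasurable
    · refine (integrable_indicator_iff Metric.isClosed_closedBall.measurableSet).2 ?_
      exact integrableOn_const (isCompact_closedBall 0 R').measure_lt_top.ne
    · by_cases hx : x ∈ Metric.closedBall (0 : ℝ) R'
      · rw [indicator_of_mem hx, Real.norm_eq_abs]
        have b1 := hθΘ x (by simpa using hx)
        have b2 := (hζC (0, Zs k (0, x))).1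
        have b3 := h.abs_init_le x
        have b4 := hg₀G x
        simp only [abs_mul]
        gcongr
      · rw [indicator_of_notMem hx]
        have h1 : R' < ‖((0:ℝ), x)‖ := lt_of_lt_of_le (by simpa using hx) (le_max_right _ _)
        have h2 := hfar k _ h1
        simp only [mul_zero, sub_zero] at h2
        simp [(hζR _ h2).1]
    · have t1 := (hζ.continuous.tendsto _).comp (hmapc (0, x))
      simp only [mul_zero, sub_zero] at t1
      have t2 := (t1.const_mul (θ x)).const_mul (u₀ x * g₀ x)
      refine t2.trans_eq ?_
      congr 1
      ring
  exact tendsto_nhds_unique ((hlim1.add hlim2).congr htest) tendsto_const_nhds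

end IsMassFlux

/-- The position, at time `t`, of a given value of the potential. -/
noncomputable def massInv (Z : ℝ × ℝ → ℝ) (t : ℝ) : ℝ → ℝ := Function.invFun fun x => Z (t, x)

namespace IsMassFlux
variable {u f : ℝ × ℝ → ℝ} {u₀ : ℝ → ℝ} {m M C : ℝ} {Zs : ℕ → ℝ × ℝ → ℝ} {Z : ℝ × ℝ → ℝ}

theorem apply_massInv (h : IsMassFlux u f u₀ m M C)
    (hZ : IsPotential (extDensity u u₀) (extFlux f) Zs Z) (t y : ℝ) :
    Z (t, massInv Z t y) = y := (h.biLip hZ t).apply_inv y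

theorem massInv_apply (h : IsMassFlux u f u₀ m M C)
    (hZ : IsPotential (extDensity u u₀) (extFlux f) Zs Z) (t x : ℝ) :
    massInv Z t (Z (t, x)) = x := (h.biLip hZ t).inv_apply x

/-- Evaluating the potential at time `t` at both positions, the lower slope `m` bounds their
distance, while the Lipschitz bound of `Z` accounts for the change of time. -/
theorem abs_massInv_sub_le (h : IsMassFlux u f u₀ m M C)
    (hZ : IsPotential (extDensity u u₀) (extFlux f) Zs Z) (t s y z : ℝ) :
    |massInv Z t y - massInv Z s z| ≤ m⁻¹ * (|y - z| + 2 * C * |t - s|) := by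
  have h1 := (h.biLip hZ t).abs_lower (massInv Z t y) (massInv Z s z)
  rw [h.apply_massInv hZ] at h1
  have h2 := h.abs_sub_le hZ (s, massInv Z s z) (t, massInv Z s z)
  rw [h.apply_massInv hZ, Prod.mk_sub_mk, sub_self] at h2
  have h3 : ‖((s - t, 0) : ℝ × ℝ)‖ = |t - s| := by
    rw [Prod.norm_def]
    simp [abs_sub_comm]
  rw [h3] at h2
  rw [← div_eq_inv_mul, le_div_iff₀ h.pos, mul_comm]
  refine h1.trans ?_
  have : y - Z (t, massInv Z s z) = (y - z) + (z - Z (t, massInv Z s z)) := by ring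
  rw [this]
  exact (abs_add_le _ _).trans (by gcongr)

theorem continuous_massInv (h : IsMassFlux u f u₀ m M C)
    (hZ : IsPotential (extDensity u u₀) (extFlux f) Zs Z) :
    Continuous fun p : ℝ × ℝ => massInv Z p.1 p.2 := by
  have hC := h.nonneg
  have hm := h.pos
  refine (LipschitzWith.of_dist_le_mul (K := (m⁻¹ * (1 + 2 * C)).toNNReal)
    fun p q => ?_).continuous
  rw [Real.coe_toNNReal _ (by positivity), Real.dist_eq, dist_eq_norm]
  refine (h.abs_massInv_sub_le hZ p.1 q.1 p.2 q.2).trans ?_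
  have h1 : |p.1 - q.1| ≤ ‖p - q‖ := le_max_left _ _
  have h2 : |p.2 - q.2| ≤ ‖p - q‖ := le_max_right _ _
  rw [mul_assoc m⁻¹, add_mul, one_mul]
  gcongr

/-- The change of variables `(t, x) ↦ (t, Z(t, x) - κ t)`. -/
theorem integral_mul_eq (h : IsMassFlux u f u₀ m M C)
    (hZ : IsPotential (extDensity u u₀) (extFlux f) Zs Z) (κ : ℝ) {F : ℝ × ℝ → ℝ}
    (hF : Measurable F) :
    ∫ p in halfPlane, u p * F p = ∫ p in halfPlane, F (p.1, massInv Z p.1 (p.2 + κ * p.1)) := by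
  have hZc := h.continuous_potential hZ
  have hmp : MeasurePreserving (fun p : ℝ × ℝ => (p.1, Z (p.1, p.2) - κ * p.1))
      (((volume.restrict (Ioi (0:ℝ))).prod volume).withDensity fun p => ENNReal.ofReal (u p))
      ((volume.restrict (Ioi (0:ℝ))).prod volume) := by
    refine measurePreserving_prodMk (f := fun t x => Z (t, x) - κ * t)
      (Continuous.measurable (by fun_prop)) h.measurable_density.ennreal_ofReal ?_
    filter_upwards [ae_restrict_of_ae (h.ae_sub_eq hZ), ae_restrict_mem measurableSet_Ioi]
      with t ht ht0
    have e : ∀ s, extDensity u u₀ (t, s) = u (t, s) := fun s => if_pos ht0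
    simp only [e] at ht
    have h1 := (h.biLip hZ t).measurePreserving (ρ := fun x => u (t, x))
      (Eventually.of_forall fun x => h.pos.le.trans (h.lower _)) (fun x y =>
        intervalIntegrable_of_abs_le (h.measurable_density.comp
          measurable_prodMk_left).aestronglyMeasurable
          (Eventually.of_forall fun x => h.abs_density_le (t, x)) x y) ht
    exact (measurePreserving_sub_right volume (κ * t)).comp h1
  have hm1 : Measurable fun p : ℝ × ℝ => (p.1, massInv Z p.1 (p.2 + κ * p.1)) := by
    have := h.continuous_massInv hZ
    have h2 : Continuous fun p : ℝ × ℝ => massInv Z p.1 (p.2 + κ * p.1) :=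
      Continuous.comp (g := fun p : ℝ × ℝ => massInv Z p.1 p.2)
        (f := fun p : ℝ × ℝ => (p.1, p.2 + κ * p.1)) this (by fun_prop)
    exact (continuous_fst.prodMk h2).measurable
  rw [volume_restrict_halfPlane, ← hmp.integral_comp_eq
    (F := fun p => F (p.1, massInv Z p.1 (p.2 + κ * p.1))) (hF.comp hm1).aestronglyMeasurable,
    integral_withDensity_ofReal h.measurable_density
      (Eventually.of_forall fun p => h.pos.le.trans (h.lower p))]
  refine integral_congr_ae (Eventually.of_forall fun p => ?_)
  simp only [sub_add_cancel, h.massInv_apply hZ]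

theorem integral_init_mul_eq (h : IsMassFlux u f u₀ m M C)
    (hZ : IsPotential (extDensity u u₀) (extFlux f) Zs Z) {F : ℝ → ℝ} (hF : Measurable F) :
    ∫ x, u₀ x * F x = ∫ z, F (massInv Z 0 z) := by
  have hmp := (h.biLip hZ 0).measurePreserving (ρ := u₀)
      (Eventually.of_forall fun x => h.pos.le.trans (h.lower_init _)) (fun x y =>
        intervalIntegrable_of_abs_le h.measurable_init.aestronglyMeasurable
          (Eventually.of_forall h.abs_init_le) x y) (h.init_sub_eq hZ)
  have hm1 : Measurable (massInv Z 0) := (h.biLip hZ 0).inv.continuous.measurable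
  rw [← hmp.integral_comp_eq (F := fun z => F (massInv Z 0 z))
    (hF.comp hm1).aestronglyMeasurable, integral_withDensity_ofReal h.measurable_init
    (Eventually.of_forall fun x => h.pos.le.trans (h.lower_init x))]
  refine integral_congr_ae (Eventually.of_forall fun x => ?_)
  simp only [h.massInv_apply hZ]

/-- The law of a transported quantity in mass coordinates. -/
theorem integral_mass_coordinates (h : IsMassFlux u f u₀ m M C)
    (hZ : IsPotential (extDensity u u₀) (extFlux f) Zs Z) {κ : ℝ} {g ℓ : ℝ × ℝ → ℝ} {g₀ : ℝ → ℝ}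
    (hg : Measurable g) (hℓ : Measurable ℓ) (hg₀ : Measurable g₀) {G : ℝ} (hgG : ∀ p, |g p| ≤ G)
    (hg₀G : ∀ x, |g₀ x| ≤ G) {Λ : ℝ} (hℓΛ : ∀ p, |ℓ p| ≤ Λ) (hκ : ∀ p, u p * ℓ p = f p + κ)
    (hlaw : WeakConservationLaw (fun t x => u (t, x) * g (t, x))
      (fun t x => u (t, x) * ℓ (t, x) * g (t, x)) (fun x => u₀ x * g₀ x))
    {θ : ℝ → ℝ} (hθ : ContDiff ℝ ∞ θ) {ζ : ℝ × ℝ → ℝ} (hζ : ContDiff ℝ ∞ ζ)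
    (hc : HasCompactSupport ζ) :
    (∫ p in halfPlane, (g (p.1, massInv Z p.1 (p.2 + κ * p.1)) *
        θ (massInv Z p.1 (p.2 + κ * p.1)) * fderiv ℝ ζ p (1, 0) +
        g (p.1, massInv Z p.1 (p.2 + κ * p.1)) * ℓ (p.1, massInv Z p.1 (p.2 + κ * p.1)) *
          deriv θ (massInv Z p.1 (p.2 + κ * p.1)) * ζ p)) +
      ∫ z, g₀ (massInv Z 0 z) * θ (massInv Z 0 z) * ζ (0, z) = 0 := by
  have hZc := h.continuous_potential hZ
  have hdθ : Continuous (deriv θ) := hθ.continuous_deriv (by simp)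
  refine Eq.trans ?_ (h.integral_comp_potential hZ hg hℓ hg₀ hgG hg₀G hℓΛ hκ hlaw hθ hζ hc)
  rw [h.integral_mul_eq hZ κ, h.integral_init_mul_eq hZ]
  · simp only [h.apply_massInv hZ, add_sub_cancel_right]
  · exact (hg₀.mul hθ.continuous.measurable).mul
      (hζ.continuous.comp (by fun_prop : Continuous fun x : ℝ => ((0:ℝ), Z (0, x)))).measurable
  · have c1 : Continuous fun p : ℝ × ℝ => (p.1, Z p - κ * p.1) := by fun_prop
    exact ((hg.mul (hθ.continuous.comp continuous_snd).measurable).mul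
      ((continuous_fderiv_apply hζ _).comp c1).measurable).add
      (((hg.mul hℓ).mul (hdθ.comp continuous_snd).measurable).mul
        (hζ.continuous.comp c1).measurable)

/-- A transported quantity is constant along its characteristics. -/
theorem ae_eq_along_characteristic (h : IsMassFlux u f u₀ m M C)
    (hZ : IsPotential (extDensity u u₀) (extFlux f) Zs Z) {κ : ℝ} {g ℓ : ℝ × ℝ → ℝ} {g₀ : ℝ → ℝ}
    (hg : Measurable g) (hℓ : Measurable ℓ) (hg₀ : Measurable g₀) {G : ℝ} (hgG : ∀ p, |g p| ≤ G)
    (hg₀G : ∀ x, |g₀ x| ≤ G) {Λ : ℝ} (hℓΛ : ∀ p, |ℓ p| ≤ Λ) (hκ : ∀ p, u p * ℓ p = f p + κ)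
    (hlaw : WeakConservationLaw (fun t x => u (t, x) * g (t, x))
      (fun t x => u (t, x) * ℓ (t, x) * g (t, x)) (fun x => u₀ x * g₀ x)) :
    ∀ᵐ p ∂(volume.restrict halfPlane), g p = g₀ (massInv Z 0 (Z p - κ * p.1)) := by
  have hZc := h.continuous_potential hZ
  have hX := h.continuous_massInv hZ
  have hX1 : Continuous fun p : ℝ × ℝ => massInv Z p.1 (p.2 + κ * p.1) :=
    Continuous.comp (g := fun p : ℝ × ℝ => massInv Z p.1 p.2)
      (f := fun p : ℝ × ℝ => (p.1, p.2 + κ * p.1)) hX (by fun_prop)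
  have hX0 : Continuous (massInv Z 0) := (h.biLip hZ 0).inv.continuous
  -- With `θ = 1` the law in mass coordinates says that `g`, at fixed label `Z - κ t`, has zero weak
  -- time derivative.
  have h1 := ae_eq_of_weak_ode (r := fun p => g (p.1, massInv Z p.1 (p.2 + κ * p.1)))
    (P := fun p => g₀ (massInv Z 0 p.2)) (s := fun _ => 0) (r₀ := fun z => g₀ (massInv Z 0 z))
    (hg.comp (continuous_fst.prodMk hX1).measurable)
    (hg₀.comp (hX0.comp continuous_snd).measurable) measurable_const (C := 0) (by simp)
    (by simp) (fun R => ⟨G, fun p _ => ⟨hgG _, hg₀G _⟩⟩) (fun ζ hζ hc => by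
      have := h.integral_mass_coordinates hZ hg hℓ hg₀ hgG hg₀G hℓΛ hκ hlaw
        (contDiff_const (c := (1:ℝ))) hζ hc
      simpa using this)
  rw [volume_restrict_halfPlane] at h1 ⊢
  have h2 := ae_prod_comp (f := fun t x => Z (t, x) - κ * t)
    (Continuous.measurable (by fun_prop)) h.pos (fun t x y => by
      have := (h.biLip hZ t).abs_lower x y
      simpa using this) h1
  filter_upwards [h2] with p hp
  simpa [h.massInv_apply hZ] using hp

/-- The particle paths of a mass flux. -/
theorem ae_massInv_eq (h : IsMassFlux u f u₀ m M C)
    (hZ : IsPotential (extDensity u u₀) (extFlux f) Zs Z) {ℓ s P : ℝ × ℝ → ℝ}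
    (hℓ : Measurable ℓ) {Λ : ℝ} (hℓΛ : ∀ p, |ℓ p| ≤ Λ) (hκ : ∀ p, u p * ℓ p = f p)
    (hs : Measurable s) (hsΛ : ∀ p, |s p| ≤ Λ) (hP : Continuous P)
    (hPs : ∀ t z, P (t, z) = massInv Z 0 z + ∫ τ in (0:ℝ)..t, s (τ, z))
    (hℓs : ∀ᵐ p ∂(volume.restrict halfPlane), ℓ (p.1, massInv Z p.1 p.2) = s p) :
    ∀ᵐ p ∂(volume.restrict halfPlane), massInv Z p.1 p.2 = P p := by
  have hX := h.continuous_massInv hZ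
  refine ae_eq_of_weak_ode hX.measurable hP.measurable hs hsΛ hPs (fun R => ?_)
    (fun ζ hζ hc => ?_)
  · obtain ⟨B₁, hB₁⟩ := (isCompact_closedBall (0 : ℝ × ℝ) R).exists_bound_of_continuousOn
      hX.continuousOn
    obtain ⟨B₂, hB₂⟩ := (isCompact_closedBall (0 : ℝ × ℝ) R).exists_bound_of_continuousOn
      hP.continuousOn
    refine ⟨max B₁ B₂, fun p hp => ⟨(hB₁ p (by simpa using hp)).trans (le_max_left _ _),
      (hB₂ p (by simpa using hp)).trans (le_max_right _ _)⟩⟩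
  -- Taking `g = 1` and `θ = id` turns the mass law into the weak equation for the position of a
  -- particle with velocity `ℓ`.
  · have h1 := h.integral_mass_coordinates hZ (κ := 0) (g := fun _ => 1) (g₀ := fun _ => 1)
      measurable_const hℓ measurable_const (G := 1) (by simp) (by simp) hℓΛ (by simpa using hκ)
      (by simpa [hκ] using h.law) contDiff_id hζ hc
    refine Eq.trans ?_ h1
    congr 1
    · refine integral_congr_ae ?_
      filter_upwards [hℓs] with p hp
      simp [← hp]
    · simp

end IsMassFlux

/-! ### Uniqueness of entropy solutions. -/

namespace BlockSystem
variable {n : ℕ} (S : BlockSystem n) {w₀ : ℝ → State n}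

theorem lag_mem_Icc {a b : State n} (hw₀ : ∀ x, w₀ x ∈ Icc a b) (t y : ℝ) :
    S.lag w₀ t y ∈ Icc a b :=
  ⟨fun i => (hw₀ _).1 i, fun i => (hw₀ _).2 i⟩

/-- Uniqueness: a weak solution is the one constructed in mass coordinates. -/
theorem ae_eq_sol (hw₀ : Measurable w₀) {a b : State n} (hQ : ∀ x, w₀ x ∈ Icc a b)
    {u f ℓ₀ : ℝ × ℝ → ℝ} {W : ℝ × ℝ → State n} {ℓ : Fin n → ℝ × ℝ → ℝ} {m M C : ℝ}
    (h : IsMassFlux u f (fun x => (S.vol (w₀ x))⁻¹) m M C) (hW : Measurable W)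
    (hℓm : ∀ i, Measurable (ℓ i)) (hℓ₀m : Measurable ℓ₀) {G Λ : ℝ} (hWG : ∀ p i, |W p i| ≤ G)
    (hw₀G : ∀ x i, |w₀ x i| ≤ G) (hℓΛ : ∀ i p, |ℓ i p| ≤ Λ) (hℓ₀Λ : ∀ p, |ℓ₀ p| ≤ Λ)
    (hκ : ∀ i p, u p * ℓ i p = f p + S.c (S.block i)) (hκ₀ : ∀ p, u p * ℓ₀ p = f p)
    (hℓ₀ : ∀ p, W p ∈ Icc a b → ℓ₀ p = S.vel 0 (W p))
    (hlaw : ∀ i, WeakConservationLaw (fun t x => u (t, x) * W (t, x) i)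
      (fun t x => u (t, x) * ℓ i (t, x) * W (t, x) i) (fun x => (S.vol (w₀ x))⁻¹ * w₀ x i)) :
    ∀ᵐ p ∂(volume.restrict halfPlane), W p = S.sol w₀ p.1 p.2 := by
  obtain ⟨Zs, Z, hZ⟩ := h.exists_isPotential
  have hZc := h.continuous_potential hZ
  -- Both potentials start from the same initial mass coordinate, normalized at the origin.
  have hmass : massInv Z 0 = S.pos₀ w₀ := by
    have : (fun x => Z (0, x)) = S.mass w₀ := funext fun x => h.init_eq hZ x
    rw [massInv, this, pos₀]
  have h1 : ∀ᵐ p ∂(volume.restrict halfPlane), W p = S.lag w₀ p.1 (Z p) := by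
    have h2 : ∀ i, ∀ᵐ p ∂(volume.restrict halfPlane), W p i = S.lag w₀ p.1 (Z p) i := by
      intro i
      have h3 := h.ae_eq_along_characteristic hZ (g := fun p => W p i) (g₀ := fun x => w₀ x i)
        ((measurable_pi_apply i).comp hW) (hℓm i) ((measurable_pi_apply i).comp hw₀)
        (fun p => hWG p i) (fun x => hw₀G x i) (hℓΛ i) (hκ i) (hlaw i)
      rw [hmass] at h3
      exact h3
    filter_upwards [ae_all_iff.2 h2] with p hp
    exact funext hp
  have h1' := h1
  rw [volume_restrict_halfPlane] at h1'
  have h4 := ae_prod_comp (f := massInv Z) (h.continuous_massInv hZ).measurable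
    (h.biLip hZ 0).inv.pos (fun t x y => (h.biLip hZ t).inv.abs_lower x y) h1'
  rw [← volume_restrict_halfPlane] at h4
  -- In mass coordinates the state is already known to be `lag`. It takes values in the box, so the
  -- velocity is `vel 0` of it, and the particle paths must be `pos`.
  have h5 : ∀ᵐ p ∂(volume.restrict halfPlane), massInv Z p.1 p.2 = S.pos w₀ p.1 p.2 := by
    refine h.ae_massInv_eq hZ (ℓ := ℓ₀) (s := fun p => S.vel 0 (S.lag w₀ p.1 p.2))
      (P := fun p => S.pos w₀ p.1 p.2) (Λ := max Λ (S.velBound 0)) hℓ₀m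
      (fun p => (hℓ₀Λ p).trans (le_max_left _ _)) hκ₀
      ((S.continuous_vel 0).measurable.comp (S.measurable_lag hw₀))
      (fun p => (S.abs_vel_le 0 _).trans (le_max_right _ _)) (S.continuous_pos hw₀)
      (fun t z => ?_) ?_
    · have := S.pos_add_mul hw₀ 0 t z
      simp only [zero_mul, add_zero] at this
      rw [this, hmass]
    · filter_upwards [h4] with p hp
      rw [h.apply_massInv hZ] at hp
      rw [hℓ₀ _ (by rw [hp]; exact S.lag_mem_Icc hQ _ _), hp]
  rw [volume_restrict_halfPlane] at h5
  have h6 := ae_prod_comp (f := fun t x => Z (t, x)) hZc.measurable h.pos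
    (fun t x y => (h.biLip hZ t).abs_lower x y) h5
  rw [← volume_restrict_halfPlane] at h6
  filter_upwards [h1, h6] with p hp1 hp6
  simp only [h.massInv_apply hZ] at hp6
  have h7 : S.massAt w₀ p.1 p.2 = Z p := by
    rw [hp6]
    exact (S.biLip_pos hw₀ p.1).inv_apply _
  rw [hp1, sol, h7]

end BlockSystem

/-- The explicit construction wants data that are Borel measurable with values in the box at every
point; clamping a measurable representative changes it on a null set only. -/
theorem IsL1Data.exists_measurable {n : ℕ} {a b : State n} {w0 : ℝ → State n}
    (h : IsL1Data a b w0) :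
    ∃ w₀ : ℝ → State n, Measurable w₀ ∧ (∀ x, w₀ x ∈ Icc a b) ∧ w₀ =ᵐ[volume] w0 := by
  obtain ⟨x, hx⟩ := h.2.exists
  have hab : a ≤ b := hx.1.trans hx.2
  refine ⟨fun x => clamp a b (h.1.1.mk w0 x),
    (lipschitzWith_clamp a b).continuous.measurable.comp
      h.1.1.stronglyMeasurable_mk.measurable, fun x => clamp_mem hab _, ?_⟩
  filter_upwards [h.1.1.ae_eq_mk, h.2] with x h1 h2
  rw [← h1, clamp_eq_self h2]

theorem WeakConservationLaw.congr {u f u' f' : ℝ → ℝ → ℝ} {u₀ u₀' : ℝ → ℝ}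
    (h : WeakConservationLaw u f u₀)
    (hu : ∀ᵐ p ∂(volume.restrict halfPlane), u p.1 p.2 = u' p.1 p.2)
    (hf : ∀ᵐ p ∂(volume.restrict halfPlane), f p.1 p.2 = f' p.1 p.2) (hu₀ : ∀ᵐ x, u₀ x = u₀' x) :
    WeakConservationLaw u' f' u₀' := by
  intro φ hφ hc
  refine Eq.trans ?_ (h φ hφ hc)
  congr 1
  · refine integral_congr_ae ?_
    filter_upwards [hu, hf] with p h1 h2
    rw [h1, h2]
  · refine integral_congr_ae ?_
    filter_upwards [hu₀] with x h1
    rw [h1]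

theorem IsEntropySolution.congr {n : ℕ} {O : Set (State n)} {lam N : Fin n → State n → ℝ}
    {w0 w0' : ℝ → State n} {w w' : ℝ → ℝ → State n} (h : IsEntropySolution O lam N w0 w)
    (hw : ∀ᵐ p ∂(volume.restrict halfPlane), w p.1 p.2 = w' p.1 p.2) (hw0 : ∀ᵐ x, w0 x = w0' x) :
    IsEntropySolution O lam N w0' w' where
  measurable := h.measurable.congr hw
  bounded := by
    obtain ⟨K, hK, hKO, hwK⟩ := h.bounded
    refine ⟨K, hK, hKO, ?_⟩
    filter_upwards [hw, hwK] with p h1 h2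
    rwa [← h1]
  entropy_one i := (h.entropy_one i).congr (hw.mono fun p hp => by rw [hp])
    (hw.mono fun p hp => by rw [hp]) (hw0.mono fun x hx => by rw [hx])
  entropy_id i := (h.entropy_id i).congr (hw.mono fun p hp => by rw [hp])
    (hw.mono fun p hp => by rw [hp]) (hw0.mono fun x hx => by rw [hx])

theorem exists_abs_apply_le {n : ℕ} {K : Set (State n)} (hK : IsCompact K) :
    ∃ G, ∀ w ∈ K, ∀ i, |w i| ≤ G := by
  obtain ⟨G, hG⟩ := hK.isBounded.exists_norm_le
  exact ⟨G, fun w hw i => (norm_le_pi_norm w i).trans (hG w hw)⟩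

theorem ContinuousOn.measurable_comp_of_forall_mem {α β γ : Type*} [MeasurableSpace α]
    [TopologicalSpace β] [MeasurableSpace β] [BorelSpace β] [TopologicalSpace γ]
    [MeasurableSpace γ] [BorelSpace γ] {K : Set β} {F : β → γ} (hF : ContinuousOn F K) {W : α → β}
    (hW : Measurable W) (hWK : ∀ p, W p ∈ K) : Measurable fun p => F (W p) :=
  Measurable.comp (g := K.domRestrict F) (f := fun p => ⟨W p, hWK p⟩)
    (continuousOn_iff_continuous_domRestrict.1 hF).measurable (hW.subtype_mk)

namespace BlockSystem
variable {n : ℕ} (S : BlockSystem n) {O : Set (State n)} {lam : Fin n → State n → ℝ}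
  {N : State n → ℝ} {a b : State n} {w₀ : ℝ → State n}

/-- The solution constructed in mass coordinates is an entropy solution. -/
theorem isEntropySolution_sol (hbox : Icc a b ⊆ O)
    (hS : ∀ w ∈ Icc a b, N w = (S.vol w)⁻¹ ∧ ∀ i, lam i w = S.vel (S.c (S.block i)) w)
    (hw₀ : Measurable w₀) (hQ : ∀ x, w₀ x ∈ Icc a b) :
    IsEntropySolution O lam (fun _ => N) w₀ (S.sol w₀) := by
  have hmem : ∀ t x, S.sol w₀ t x ∈ Icc a b := fun t x => S.lag_mem_Icc hQ _ _
  have hN : ∀ t x, N (S.sol w₀ t x) = (S.vol (S.sol w₀ t x))⁻¹ := fun t x => (hS _ (hmem t x)).1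
  have hl : ∀ t x i, lam i (S.sol w₀ t x) = S.vel (S.c (S.block i)) (S.sol w₀ t x) :=
    fun t x => (hS _ (hmem t x)).2
  have hN0 : ∀ x, N (w₀ x) = (S.vol (w₀ x))⁻¹ := fun x => (hS _ (hQ x)).1
  obtain ⟨G, hG⟩ := exists_abs_apply_le (isCompact_Icc (a := a) (b := b))
  refine ⟨(S.measurable_sol hw₀).aestronglyMeasurable, ⟨Icc a b, isCompact_Icc, hbox,
    Eventually.of_forall fun p => hmem _ _⟩, fun i => ?_, fun i => ?_⟩
  · simp only [hN, hl, hN0]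
    have := S.weakLaw hw₀ (S.c (S.block i)) (g := fun _ => 1) measurable_const (B := 1) (by simp)
    simpa using this
  · simp only [hN, hl, hN0]
    have := S.weakLaw hw₀ (S.c (S.block i)) (g := fun y => S.data w₀ y i)
      ((measurable_pi_apply i).comp (S.measurable_data hw₀)) (B := G) (fun y => hG _ (hQ _) i)
    have h1 : ∀ x, S.data w₀ (S.mass w₀ x) = w₀ x := fun x => by
      rw [data, pos₀, (S.biLip_mass hw₀).inv_apply]
    simp only [h1] at this
    exact this

/-- Before uniqueness is known, the solution is confined merely to a compact subset of `O`. Its mass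
flux therefore uses `N` and `λ_{i₀}` directly, and the relations between the speeds come from the
constants valid on `O`; the block formulas are invoked only on the box. -/
theorem ae_eq_sol_of_isEntropySolution (hsys : IsLinDegRichSystem O lam fun _ => N)
    (hbox : Icc a b ⊆ O) {i₀ : Fin n}
    (hS : ∀ w ∈ Icc a b, N w = (S.vol w)⁻¹ ∧ ∀ i, lam i w = S.vel (S.c (S.block i)) w)
    (hSO : ∀ w ∈ O, ∀ i, N w * (lam i w - lam i₀ w) = S.c (S.block i))
    (hS₀ : S.c (S.block i₀) = 0)
    (hw₀ : Measurable w₀) (hQ : ∀ x, w₀ x ∈ Icc a b) {w : ℝ → ℝ → State n}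
    (h : IsEntropySolution O lam (fun _ => N) w₀ w) :
    ∀ᵐ p ∂(volume.restrict halfPlane), w p.1 p.2 = S.sol w₀ p.1 p.2 := by
  classical
  obtain ⟨K₀, hK₀, hK₀O, hwK₀⟩ := h.bounded
  set K : Set (State n) := K₀ ∪ Icc a b with hKdef
  have hK : IsCompact K := hK₀.union isCompact_Icc
  have hKO : K ⊆ O := union_subset hK₀O hbox
  -- A measurable representative with values in `K` everywhere: `N` and the eigenvalues need not be
  -- measurable or bounded outside `O`. The value `w₀ 0` is an arbitrary point of `K`.
  set W : ℝ × ℝ → State n := fun p => if h.measurable.mk _ p ∈ K then h.measurable.mk _ p else w₀ 0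
    with hWdef
  have hmk : Measurable (h.measurable.mk _) := h.measurable.stronglyMeasurable_mk.measurable
  have hW : Measurable W :=
    Measurable.ite (hmk hK.isClosed.measurableSet) hmk measurable_const
  have hWK : ∀ p, W p ∈ K := by
    intro p
    rw [hWdef]
    simp only
    split_ifs with hp
    · exact hp
    · exact Or.inr (hQ 0)
  have hWw : ∀ᵐ p ∂(volume.restrict halfPlane), w p.1 p.2 = W p := by
    filter_upwards [h.measurable.ae_eq_mk, hwK₀] with p h1 h2
    rw [hWdef]
    simp only
    rw [← h1, if_pos (show w p.1 p.2 ∈ K from Or.inl h2)]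
  have hh := h.congr (w' := fun t x => W (t, x)) hWw (Eventually.of_forall fun _ => rfl)
  have hNc : ContinuousOn N K := (hsys.richnessFactor i₀).smooth.continuousOn.mono hKO
  have hlc : ContinuousOn (fun w i => lam i w) K :=
    continuousOn_pi.2 fun i => (hsys.smooth i).continuousOn.mono hKO
  have hNpos : ∀ w ∈ K, 0 < N w := fun w hw => (hsys.richnessFactor i₀).pos w (hKO hw)
  obtain ⟨wm, hwm, hmin⟩ := hK.exists_isMinOn ⟨w₀ 0, Or.inr (hQ 0)⟩ hNc
  obtain ⟨wM, hwM, hmax⟩ := hK.exists_isMaxOn ⟨w₀ 0, Or.inr (hQ 0)⟩ hNc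
  obtain ⟨Λ, hΛ⟩ := hK.exists_bound_of_continuousOn hlc
  obtain ⟨G, hG⟩ := exists_abs_apply_le hK
  have hlΛ : ∀ w ∈ K, ∀ i, |lam i w| ≤ Λ := fun w hw i =>
    (norm_le_pi_norm (fun i => lam i w) i).trans (hΛ w hw)
  have hlm : ∀ i, Measurable fun p => lam i (W p) := fun i =>
    ContinuousOn.measurable_comp_of_forall_mem ((hsys.smooth i).continuousOn.mono hKO) hW hWK
  have hNm : Measurable fun p => N (W p) := hNc.measurable_comp_of_forall_mem hW hWK
  have hN0 : ∀ x, N (w₀ x) = (S.vol (w₀ x))⁻¹ := fun x => (hS _ (hQ x)).1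
  have hQK : ∀ x, w₀ x ∈ K := fun x => Or.inr (hQ x)
  have hflux : IsMassFlux (fun p => N (W p)) (fun p => N (W p) * lam i₀ (W p))
      (fun x => (S.vol (w₀ x))⁻¹) (N wm) (N wM) (max (N wM) (N wM * Λ)) := by
    refine ⟨hNm, hNm.mul (hlm i₀), S.measurable_inv_vol hw₀, hNpos _ hwm, fun p => hmin (hWK p),
      fun p => hmax (hWK p), fun x => ?_, fun x => ?_, le_max_left _ _, fun p => ?_, ?_⟩
    · rw [← hN0]
      exact hmin (hQK x)
    · rw [← hN0]
      exact hmax (hQK x)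
    · rw [abs_mul, abs_of_pos (hNpos _ (hWK p))]
      refine le_trans ?_ (le_max_right _ _)
      exact mul_le_mul (hmax (hWK p)) (hlΛ _ (hWK p) i₀) (abs_nonneg _) (hNpos _ hwM).le
    · have := hh.entropy_one i₀
      simp only [hN0] at this
      exact this
  have key := S.ae_eq_sol hw₀ hQ (ℓ₀ := fun p => lam i₀ (W p)) (ℓ := fun i p => lam i (W p))
    hflux hW hlm (hlm i₀) (G := G) (Λ := Λ) (fun p i => hG _ (hWK p) i)
    (fun x i => hG _ (hQK x) i) (fun i p => hlΛ _ (hWK p) i) (fun p => hlΛ _ (hWK p) i₀)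
    (fun i p => by
      have := hSO _ (hKO (hWK p)) i
      linarith)
    (fun p => rfl)
    (fun p hp => by rw [(hS _ hp).2, hS₀]) (fun i => by
      have := hh.entropy_id i
      simp only [hN0] at this
      exact this)
  filter_upwards [hWw, key] with p h1 h2
  rw [h1, h2]

end BlockSystem

/-! ### Continuous versions, and the constants of the stability estimates. -/

theorem frequently_nhdsGT_of_ae {P : ℝ → Prop} {s c : ℝ} (hs : c ≤ s)
    (h : ∀ᵐ t ∂(volume.restrict (Ioi c)), P t) : ∃ᶠ t in 𝓝[>] s, P t := by
  intro hP
  obtain ⟨e, he, hsub⟩ := mem_nhdsGT_iff_exists_Ioo_subset.1 hP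
  rw [ae_restrict_iff' measurableSet_Ioi] at h
  have h0 : volume (Ioo s e) = 0 := by
    refine measure_mono_null (fun t ht => ?_) h
    intro hP
    exact hsub ht (hP (hs.trans_lt ht.1))
  rw [Real.volume_Ioo, ENNReal.ofReal_eq_zero] at h0
  exact absurd (mem_Ioi.1 he) (not_lt.2 (by linarith))

/-- Two `L¹`-continuous functions which agree almost everywhere agree at all times. -/
theorem IsL1Continuous.ae_eq {n : ℕ} {w w' : ℝ → ℝ → State n} (h : IsL1Continuous w)
    (h' : IsL1Continuous w') (hw : ∀ᵐ p ∂(volume.restrict halfPlane), w p.1 p.2 = w' p.1 p.2)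
    {s : ℝ} (hs : 0 ≤ s) : w s =ᵐ[volume] w' s := by
  rw [volume_restrict_halfPlane] at hw
  have hfreq := frequently_nhdsGT_of_ae hs (Measure.ae_ae_of_ae_prod hw)
  have hle : 𝓝[>] s ≤ 𝓝[Ici 0] s := nhdsWithin_mono _ fun t ht => hs.trans (le_of_lt ht)
  have hlim := ((h.2 s hs).mono_left hle).add ((h'.2 s hs).mono_left hle)
  rw [add_zero] at hlim
  have hm := (h.1 s hs).1.sub (h'.1 s hs).1
  have h0 : eLpNorm (w s - w' s) 1 volume ≤ 0 := by
    -- At times `t` of agreement the distance at time `s` is at most the sum of the two increments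
    -- from `s` to `t`; such `t` accumulate at `s` from the right, and the increments tend to zero.
    refine ge_of_tendsto_of_frequently hlim ?_
    refine (hfreq.and_eventually (self_mem_nhdsWithin)).mono ?_
    rintro t ⟨ht, hts⟩
    have ht0 : 0 ≤ t := hs.trans (le_of_lt hts)
    have e : eLpNorm (w s - w' s) 1 volume =
        eLpNorm ((fun x => w' t x - w' s x) - fun x => w t x - w s x) 1 volume := by
      refine eLpNorm_congr_ae ?_
      filter_upwards [ht] with x hx
      simp only [Pi.sub_apply]
      rw [show w t x = w' t x from hx]
      abel
    rw [e, add_comm]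
    exact eLpNorm_sub_le ((h'.1 t ht0).1.sub (h'.1 s hs).1) ((h.1 t ht0).1.sub (h.1 s hs).1) le_rfl
  have h1 := (eLpNorm_eq_zero_iff hm one_ne_zero).1 (le_antisymm h0 bot_le)
  filter_upwards [h1] with x hx
  exact sub_eq_zero.1 hx

theorem MemW11.apply {n : ℕ} {f g : ℝ → State n} (h : MemW11 f g) (i : Fin n) :
    ∃ c, ∀ᵐ x, f x i = c + ∫ s in (0:ℝ)..x, g s i := by
  obtain ⟨hf, hg, hfg⟩ := h
  have hfi := fun i => (memLp_one_iff_integrable.1 hf).eval i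
  have hgi := fun i => (memLp_one_iff_integrable.1 hg).eval i
  refine exists_ae_eq_primitive (hfi i).locallyIntegrable (hgi i) fun φ hφ hc => ?_
  have hdφ : Continuous (deriv φ) := hφ.continuous_deriv (by simp)
  obtain ⟨C₁, hC₁⟩ := hdφ.bounded_above_of_compact_support hc.deriv
  obtain ⟨C₂, hC₂⟩ := hφ.continuous.bounded_above_of_compact_support hc
  have h1 := congrFun (hfg φ hφ hc) i
  rw [Pi.neg_apply, eval_integral, eval_integral] at h1
  · simpa using h1
  · exact fun j => (hgi j).bdd_mul hφ.continuous.aestronglyMeasurable (Eventually.of_forall hC₂)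
  · exact fun j => (hfi j).bdd_mul hdφ.aestronglyMeasurable (Eventually.of_forall hC₁)

theorem MemW11.compModulus {n : ℕ} {f f' g : ℝ → State n} (h : MemW11 f g) (hf : f' =ᵐ[volume] f)
    (i : Fin n) {m : ℝ} (hm : 0 < m) {V : ℝ} (hV : eLpNorm g 1 volume ≤ ENNReal.ofReal V) {δ : ℝ}
    (hδ : 0 ≤ δ) :
    CompModulus m (fun x => f' x i) δ (ENNReal.ofReal (2 * m⁻¹ * δ * V)) := by
  intro A B hA hB hAm hBm hAB
  obtain ⟨c, hc⟩ := h.apply i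
  have hc' : ∀ᵐ x, f' x i = c + ∫ s in (0:ℝ)..x, g s i := by
    filter_upwards [hf, hc] with x h1 h2
    rw [h1, h2]
  refine (lintegral_comp_sub_comp_le ((memLp_one_iff_integrable.1 h.2.1).eval i) hc' hm hA hB hAm
    hBm hAB).trans ?_
  rw [ENNReal.ofReal_mul (p := 2 * m⁻¹ * δ) (by positivity)]
  gcongr
  exact (lintegral_enorm_apply_le g i).trans hV

theorem exists_pos_mul_le {A e : ℝ} (hA : 0 ≤ A) (he : 0 < e) : ∃ δ, 0 < δ ∧ A * δ ≤ e := by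
  refine ⟨e / (A + 1), by positivity, ?_⟩
  rw [← mul_div_assoc, div_le_iff₀ (by positivity)]
  nlinarith

namespace BlockSystem
variable {n : ℕ} (S : BlockSystem n) {w₁ w₂ : ℝ → State n}

theorem exists_stability (hn : 1 ≤ n) (h₁ : Measurable w₁) (hi₁ : MemLp w₁ 1 volume) {ε : ℝ}
    (hε : 0 < ε) :
    ∃ δ : ℝ, 0 < δ ∧ ∀ w₂ : ℝ → State n, Measurable w₂ → MemLp w₂ 1 volume →
      eLpNorm (fun x => w₂ x - w₁ x) 1 volume ≤ ENNReal.ofReal δ → ∀ t,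
        eLpNorm (fun x => S.sol w₂ t x - S.sol w₁ t x) 1 volume ≤ ENNReal.ofReal ε := by
  have hn0 : (0:ℝ) < n := by exact_mod_cast hn
  have hD := S.distortion_pos
  have hM := S.M_pos
  have hm := S.m_pos
  have hdl := S.densLip_nonneg
  have hmod : ∀ e : ℝ, 0 < e → ∃ η, 0 < η ∧
      ∀ i, CompModulus S.distortion (fun x => w₁ x i) η (ENNReal.ofReal e) := by
    intro e he
    have h := eventually_all.2 fun i => eventually_compModulus ((measurable_pi_apply i).comp h₁)
      (integrable_apply hi₁ i) hD (ENNReal.ofReal_pos.2 he).ne'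
    obtain ⟨η, hη, hη0⟩ := (h.and self_mem_nhdsWithin).exists
    exact ⟨η, hη0, hη⟩
  -- The tolerances are chosen backwards: each of `n` components gets `ε / n`, half for the change
  -- of data and half for the displacement of the feet. The latter fixes `η₂`, half of which pays
  -- for `K * ε₁`, and `ε₁` in turn fixes `η₁`.
  obtain ⟨η₂, hη₂, hmod₂⟩ := hmod (ε / (2 * n)) (by positivity)
  set K : ℝ := S.M * (S.m⁻¹ * (S.s * S.L * n)) with hK
  have hK0 : 0 ≤ K := by positivity
  obtain ⟨ε₁, hε₁, hKε⟩ := exists_pos_mul_le hK0 (half_pos hη₂)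
  obtain ⟨η₁, hη₁, hmod₁⟩ := hmod ε₁ hε₁
  obtain ⟨δa, ha, ha'⟩ := exists_pos_mul_le (A := S.M * S.densLip) (by positivity) hη₁
  obtain ⟨δb, hb, hb'⟩ := exists_pos_mul_le (A := S.distortion⁻¹) (e := ε / (2 * n))
    (by positivity) (by positivity)
  obtain ⟨δc, hc, hc'⟩ := exists_pos_mul_le (A := K * S.distortion⁻¹ + S.M * S.densLip)
    (by positivity) (half_pos hη₂)
  refine ⟨min δa (min δb δc), by positivity, fun w₂ h₂ hi₂ hle t => ?_⟩
  set d : ℝ := (eLpNorm (fun x => w₂ x - w₁ x) 1 volume).toReal with hd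
  have hd0 : 0 ≤ d := ENNReal.toReal_nonneg
  have hde : eLpNorm (fun x => w₂ x - w₁ x) 1 volume = ENNReal.ofReal d :=
    (ENNReal.ofReal_toReal (hle.trans_lt ENNReal.ofReal_lt_top).ne).symm
  have hdδ : d ≤ min δa (min δb δc) := by
    rw [hde] at hle
    exact (ENNReal.ofReal_le_ofReal_iff (by positivity)).1 hle
  have hda : d ≤ δa := hdδ.trans (min_le_left _ _)
  have hdb : d ≤ δb := hdδ.trans ((min_le_right _ _).trans (min_le_left _ _))
  have hdc : d ≤ δc := hdδ.trans ((min_le_right _ _).trans (min_le_right _ _))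
  have hcomp : ∀ i, ∫⁻ x, ‖S.sol w₂ t x i - S.sol w₁ t x i‖ₑ ≤ ENNReal.ofReal (ε / n) := by
    intro i
    refine (S.lintegral_sol_sub_sol_le h₁ h₂ hi₁ hi₂ hε₁.le hd0 hde (δ₁ := η₁) (δ₂ := η₂) ?_ hmod₁
      ?_ hmod₂ t i).trans ?_
    · rw [← mul_assoc]
      exact (by gcongr : _ ≤ S.M * S.densLip * δa).trans ha'
    · have e : S.M * (S.m⁻¹ * (S.s * S.L * (n * (S.distortion⁻¹ * d + ε₁)))) +
          S.M * (S.densLip * d) = (K * S.distortion⁻¹ + S.M * S.densLip) * d + K * ε₁ := by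
        rw [hK]
        ring
      rw [e]
      have : (K * S.distortion⁻¹ + S.M * S.densLip) * d ≤
          (K * S.distortion⁻¹ + S.M * S.densLip) * δc := by gcongr
      linarith
    · rw [hde, ← ENNReal.ofReal_mul (by positivity), ← ENNReal.ofReal_add (by positivity)
        (by positivity)]
      refine ENNReal.ofReal_le_ofReal ?_
      have h1 : S.distortion⁻¹ * d ≤ S.distortion⁻¹ * δb := by gcongr
      have h2 : ε / n = ε / (2 * n) + ε / (2 * n) := by field_simp; ring
      linarith
  refine (eLpNorm_one_le_sum ((S.measurable_sol_apply h₂ t).sub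
    (S.measurable_sol_apply h₁ t))).trans ?_
  refine (Finset.sum_le_sum fun i _ => hcomp i).trans ?_
  rw [Finset.sum_const, Finset.card_univ, Fintype.card_fin, nsmul_eq_mul, ← ENNReal.ofReal_natCast,
    ← ENNReal.ofReal_mul hn0.le]
  exact ENNReal.ofReal_le_ofReal (by field_simp; rfl)

/-- A Lipschitz constant of the solution operator at data with derivative bounded by `V`. -/
noncomputable def stabilityConst (V : ℝ) : ℝ :=
  S.distortion⁻¹ + 2 * S.distortion⁻¹ * (S.M * (S.m⁻¹ * (S.s * S.L * (n * (S.distortion⁻¹ +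
    2 * S.distortion⁻¹ * (S.M * S.densLip) * V)))) + S.M * S.densLip) * V

theorem stabilityConst_pos {V : ℝ} (hV : 0 ≤ V) : 0 < S.stabilityConst V := by
  have hD := S.distortion_pos
  have hM := S.M_pos
  have hm := S.m_pos
  have hdl := S.densLip_nonneg
  unfold stabilityConst
  positivity

/-- For a datum with integrable derivative the modulus at `δ` is linear in `δ`. Both uses of it are
then linear in the distance `d`, and collecting the factors gives `stabilityConst`; only the first
datum needs a derivative bound. -/
theorem lintegral_sol_sub_sol_le_of_memW11 (h₁ : Measurable w₁) (h₂ : Measurable w₂)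
    (hi₁ : MemLp w₁ 1 volume) (hi₂ : MemLp w₂ 1 volume) {V : ℝ} (hV : 0 ≤ V) {w g : ℝ → State n}
    (hg : MemW11 w g) (hw : w₁ =ᵐ[volume] w) (hgV : eLpNorm g 1 volume ≤ ENNReal.ofReal V) (t : ℝ)
    (i : Fin n) :
    ∫⁻ x, ‖S.sol w₂ t x i - S.sol w₁ t x i‖ₑ ≤
      ENNReal.ofReal (S.stabilityConst V) * eLpNorm (fun x => w₂ x - w₁ x) 1 volume := by
  have hD := S.distortion_pos
  have hM := S.M_pos
  have hm := S.m_pos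
  have hdl := S.densLip_nonneg
  set d : ℝ := (eLpNorm (fun x => w₂ x - w₁ x) 1 volume).toReal with hd
  have hd0 : 0 ≤ d := ENNReal.toReal_nonneg
  have hde : eLpNorm (fun x => w₂ x - w₁ x) 1 volume = ENNReal.ofReal d :=
    (ENNReal.ofReal_toReal (hi₂.sub hi₁).2.ne).symm
  set δ₁ : ℝ := S.M * (S.densLip * d) with hδ₁
  set ε₁ : ℝ := 2 * S.distortion⁻¹ * δ₁ * V with hε₁
  set δ₂ : ℝ := S.M * (S.m⁻¹ * (S.s * S.L * (n * (S.distortion⁻¹ * d + ε₁)))) +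
      S.M * (S.densLip * d) with hδ₂
  have hδ₁0 : 0 ≤ δ₁ := by positivity
  have hε₁0 : 0 ≤ ε₁ := by positivity
  have hδ₂0 : 0 ≤ δ₂ := by positivity
  refine (S.lintegral_sol_sub_sol_le h₁ h₂ hi₁ hi₂ hε₁0 hd0 hde le_rfl
    (fun i => hg.compModulus hw i hD hgV hδ₁0) le_rfl
    (fun i => hg.compModulus hw i hD hgV hδ₂0) t i).trans_eq ?_
  rw [hde, ← ENNReal.ofReal_mul (by positivity), ← ENNReal.ofReal_add (by positivity)
    (by positivity), ← ENNReal.ofReal_mul (S.stabilityConst_pos hV).le]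
  congr 1
  rw [stabilityConst, hε₁, hδ₁]
  ring

end BlockSystem

theorem theorem4p1 {n : ℕ} (hn : 1 ≤ n) (O : Set (State n)) (lam : Fin n → State n → ℝ)
    (N : State n → ℝ) (hsys : IsLinDegRichSystem O lam (fun _ => N))
    (a b : State n) (hbox : Icc a b ⊆ O) :
    -- existence and uniqueness of the entropy solution, which has an `L¹`-continuous version
    (∀ w0 : ℝ → State n, IsL1Data a b w0 →
      ∃ w : ℝ → ℝ → State n, IsEntropySolution O lam (fun _ => N) w0 w ∧ IsL1Continuous w ∧
        ∀ w' : ℝ → ℝ → State n, IsEntropySolution O lam (fun _ => N) w0 w' →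
          ∀ᵐ p ∂(volume.restrict halfPlane), w' p.1 p.2 = w p.1 p.2) ∧
    -- `L¹` stability, uniformly in time
    (∀ w10 : ℝ → State n, IsL1Data a b w10 → ∀ ε : ℝ, 0 < ε → ∃ δ : ℝ, 0 < δ ∧
      ∀ w20 : ℝ → State n, IsL1Data a b w20 →
      ∀ w1 w2 : ℝ → ℝ → State n,
        IsEntropySolution O lam (fun _ => N) w10 w1 → IsL1Continuous w1 →
        IsEntropySolution O lam (fun _ => N) w20 w2 → IsL1Continuous w2 →
        eLpNorm (fun x => w20 x - w10 x) 1 volume ≤ ENNReal.ofReal δ →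
        ∀ t : ℝ, 0 ≤ t →
          eLpNorm (fun x => w2 t x - w1 t x) 1 volume ≤ ENNReal.ofReal ε) ∧
    -- strong `L¹` stability for `W^{1,1}` data
    (∀ V : ℝ, 0 ≤ V → ∃ C : ℝ, 0 < C ∧
      ∀ w10 w20 g1 g2 : ℝ → State n, IsL1Data a b w10 → IsL1Data a b w20 →
        MemW11 w10 g1 → MemW11 w20 g2 → eLpNorm g1 1 volume ≤ ENNReal.ofReal V →
      ∀ w1 w2 : ℝ → ℝ → State n,
        IsEntropySolution O lam (fun _ => N) w10 w1 → IsL1Continuous w1 →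
        IsEntropySolution O lam (fun _ => N) w20 w2 → IsL1Continuous w2 →
        ∀ t : ℝ, 0 ≤ t → ∀ i : Fin n,
          eLpNorm (fun x => w2 t x i - w1 t x i) 1 volume ≤
            ENNReal.ofReal C * eLpNorm (fun x => w20 x - w10 x) 1 volume) := by
  by_cases hab : a ≤ b
  swap
  -- An empty box admits no data.
  · have hno : ∀ w0 : ℝ → State n, ¬ IsL1Data a b w0 := fun w0 h => by
      obtain ⟨x, hx⟩ := h.2.exists
      exact hab (hx.1.trans hx.2)
    exact ⟨fun w0 h => absurd h (hno w0), fun w0 h => absurd h (hno w0),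
      fun V _ => ⟨1, one_pos, fun w0 _ _ _ h => absurd h (hno w0)⟩⟩
  -- Any index can serve as the reference characteristic; `1 ≤ n` provides the first one. The block
  -- system depends on the system and the box only, hence so do the constants.
  obtain ⟨S, hS, hSO, hS₀⟩ := hsys.exists_blockSystem hab hbox ⟨0, hn⟩
  have huniq : ∀ {w0 w₀ : ℝ → State n}, w₀ =ᵐ[volume] w0 → Measurable w₀ →
      (∀ x, w₀ x ∈ Icc a b) → ∀ {w : ℝ → ℝ → State n},
      IsEntropySolution O lam (fun _ => N) w0 w →
      ∀ᵐ p ∂(volume.restrict halfPlane), w p.1 p.2 = S.sol w₀ p.1 p.2 :=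
    fun hw hm hQ w hent => S.ae_eq_sol_of_isEntropySolution hsys hbox hS hSO hS₀ hm hQ
      (hent.congr (Eventually.of_forall fun _ => rfl) hw.symm)
  have hat : ∀ {w0 w₀ : ℝ → State n}, IsL1Data a b w0 → w₀ =ᵐ[volume] w0 → Measurable w₀ →
      (∀ x, w₀ x ∈ Icc a b) → ∀ {w : ℝ → ℝ → State n},
      IsEntropySolution O lam (fun _ => N) w0 w → IsL1Continuous w →
      ∀ t, 0 ≤ t → w t =ᵐ[volume] S.sol w₀ t :=
    fun hd hw hm hQ w hent hcont t ht => hcont.ae_eq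
      (S.isL1Continuous_sol hm ((memLp_congr_ae hw).2 hd.1)) (huniq hw hm hQ hent) ht
  refine ⟨fun w0 h => ?_, fun w10 h1 ε hε => ?_, fun V hV => ?_⟩
  · obtain ⟨w₀, hm, hQ, hw⟩ := h.exists_measurable
    exact ⟨S.sol w₀, (S.isEntropySolution_sol hbox hS hm hQ).congr
      (Eventually.of_forall fun _ => rfl) hw,
      S.isL1Continuous_sol hm ((memLp_congr_ae hw).2 h.1), fun w' hw' => huniq hw hm hQ hw'⟩
  · obtain ⟨w₁, hm₁, hQ₁, hw₁⟩ := h1.exists_measurable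
    obtain ⟨δ, hδ, hstab⟩ := S.exists_stability hn hm₁ ((memLp_congr_ae hw₁).2 h1.1) hε
    refine ⟨δ, hδ, fun w20 h2 w1 w2 he1 hc1 he2 hc2 hle t ht => ?_⟩
    obtain ⟨w₂, hm₂, hQ₂, hw₂⟩ := h2.exists_measurable
    have e1 := hat h1 hw₁ hm₁ hQ₁ he1 hc1 t ht
    have e2 := hat h2 hw₂ hm₂ hQ₂ he2 hc2 t ht
    refine (eLpNorm_congr_ae (e2.sub e1)).trans_le
      (hstab w₂ hm₂ ((memLp_congr_ae hw₂).2 h2.1) ?_ t)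
    exact (eLpNorm_congr_ae (hw₂.sub hw₁)).trans_le hle
  · refine ⟨S.stabilityConst V, S.stabilityConst_pos hV, fun w10 w20 g1 g2 h1 h2 hg1 hg2 hgV
      w1 w2 he1 hc1 he2 hc2 t ht i => ?_⟩
    obtain ⟨w₁, hm₁, hQ₁, hw₁⟩ := h1.exists_measurable
    obtain ⟨w₂, hm₂, hQ₂, hw₂⟩ := h2.exists_measurable
    have e1 := hat h1 hw₁ hm₁ hQ₁ he1 hc1 t ht
    have e2 := hat h2 hw₂ hm₂ hQ₂ he2 hc2 t ht
    have e3 : (fun x => w2 t x i - w1 t x i) =ᵐ[volume]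
        fun x => S.sol w₂ t x i - S.sol w₁ t x i := by
      filter_upwards [e1, e2] with x hx1 hx2
      rw [hx1, hx2]
    have e4 : eLpNorm (fun x => w₂ x - w₁ x) 1 volume = eLpNorm (fun x => w20 x - w10 x) 1 volume :=
      eLpNorm_congr_ae (hw₂.sub hw₁)
    rw [eLpNorm_congr_ae e3, eLpNorm_one_eq_lintegral_enorm, ← e4]
    exact S.lintegral_sol_sub_sol_le_of_memW11 hm₁ hm₂ ((memLp_congr_ae hw₁).2 h1.1)
      ((memLp_congr_ae hw₂).2 h2.1) hV hg1 hw₁ hgV t i
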